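/- Let $k$ be a field of characteristic $0$ and let $X$ be a normal $k$-variety, that is, an integral scheme of finite type over $k$ all of whose local rings are integrally closed. Let $\mathcal{E}$ be a locally free $\mathcal{O}_X$-module of constant finite rank $r\geq 2$ which is simple, meaning that every endomorphism of the $\mathcal{O}_X$-module $\mathcal{E}$ is a scalar homothety, i.e. multiplication by some $c\in\Gamma(X,\mathcal{O}_X)$ (in particular, this holds if every endomorphism is multiplication by an element of $k$). Let $\mathbb{P}_X(\mathcal{E})=\mathrm{Proj}_X(\mathrm{Sym}^{\cdot}\mathcal{E})$ be the associated projective bundle. Then the $k$-scheme $\mathbb{P}_X(\mathcal{E})$ admits no vector group structure: there is no action $\mu\colon\mathbb{U}\times_k\mathbb{P}_X(\mathcal{E})\to\mathbb{P}_X(\mathcal{E})$ of an abelian unipotent algebraic $k$-group scheme $\mathbb{U}$ which is effective and has a Zariski dense open orbit. Here an action of $\mathbb{U}$ on a $k$-scheme $P$ is effective if, for every $k$-scheme $T$, only the neutral element of $\mathbb{U}(T)$ acts trivially on $P\times_k T$, and a nonempty open subscheme $V\subseteq P$ is an orbit if the image of $(\mu,\mathrm{p}_2)\colon\mathbb{U}\times_k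 V\to P\times_k P$ is $V\times_k V$. -/

import Mathlib

universe u

open CategoryTheory Limits AlgebraicGeometry TopologicalSpace

noncomputable section

namespace SymmetricAlgebra

section Grading

variable (R M : Type*) [CommRing R] [AddCommGroup M] [Module R M]

/-- The degree `n` part `Symⁿ M` of the symmetric algebra. -/
def gradedPiece (n : ℕ) : Submodule R (SymmetricAlgebra R M) :=
  LinearMap.range (ι R M) ^ n

instance gradedPiece_gradedMonoid : SetLike.GradedMonoid (gradedPiece R M) :=
  inferInstanceAs (SetLike.GradedMonoid ((LinearMap.range (ι R M) ^ ·) : ℕ → Submodule R _))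

variable {R M} in
lemma ι_mem_gradedPiece (m : M) : ι R M m ∈ gradedPiece R M 1 := by
  simp [gradedPiece]

def gradedι : M →ₗ[R] DirectSum ℕ (fun i => gradedPiece R M i) :=
  DirectSum.lof R ℕ (fun i => gradedPiece R M i) 1 ∘ₗ
    (ι R M).codRestrict _ ι_mem_gradedPiece

instance gradedAlgebra : GradedAlgebra (gradedPiece R M) :=
  GradedAlgebra.ofAlgHom _ (lift (gradedι R M))
    (by
      ext m
      simp [gradedι, DirectSum.lof_eq_of])
    fun i x => by
      obtain ⟨x, hx⟩ := x
      dsimp only [Subtype.coe_mk, DirectSum.lof_eq_of]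
      have hx' : x ∈ LinearMap.range (ι R M) ^ i := hx
      induction hx' using Submodule.pow_induction_on_left' with
      | algebraMap r =>
        rw [AlgHom.commutes, DirectSum.algebraMap_apply]; rfl
      | add x y i hx₁ hy₁ ihx ihy =>
        rw [map_add, ihx hx₁, ihy hy₁, ← map_add]
        rfl
      | mem_mul m hm i x hx₁ ih =>
        obtain ⟨_, rfl⟩ := hm
        rw [map_mul, ih hx₁, lift_ι_apply]
        simp only [gradedι, LinearMap.comp_apply, DirectSum.lof_eq_of]
        erw [DirectSum.of_mul_of]
        exact DirectSum.of_eq_of_gradedMonoid_eq (Sigma.subtype_ext (add_comm _ _) rfl)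

end Grading

section Map

variable {R S T M N L : Type*} [CommRing R] [CommRing S] [CommRing T] [AddCommGroup M]
  [AddCommGroup N] [AddCommGroup L] [Module R M] [Module S N] [Module T L]

/-- The ring homomorphism `Sym_R M → Sym_S N` induced by a semilinear map `M → N`. -/
def semilinearMap (φ : R →+* S) (f : M →ₛₗ[φ] N) :
    SymmetricAlgebra R M →+* SymmetricAlgebra S N :=
  letI : Algebra R (SymmetricAlgebra S N) := ((algebraMap S (SymmetricAlgebra S N)).comp φ).toAlgebra
  (lift (R := R) (M := M) (A := SymmetricAlgebra S N)
    { toFun := fun m => ι S N (f m)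
      map_add' := fun a b => by simp
      map_smul' := fun r a => by
        rw [LinearMap.map_smulₛₗ, map_smul, Algebra.smul_def, Algebra.smul_def]; rfl }).toRingHom

@[simp] lemma semilinearMap_ι (φ : R →+* S) (f : M →ₛₗ[φ] N) (m : M) :
    semilinearMap φ f (ι R M m) = ι S N (f m) := by
  let : Algebra R (SymmetricAlgebra S N) :=
    ((algebraMap S (SymmetricAlgebra S N)).comp φ).toAlgebra
  exact lift_ι_apply _ m

@[simp] lemma semilinearMap_algebraMap (φ : R →+* S) (f : M →ₛₗ[φ] N) (r : R) :
    semilinearMap φ f (algebraMap R _ r) = algebraMap S _ (φ r) := by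
  let : Algebra R (SymmetricAlgebra S N) :=
    ((algebraMap S (SymmetricAlgebra S N)).comp φ).toAlgebra
  exact AlgHom.commutes (lift (R := R) (M := M) (A := SymmetricAlgebra S N) _) r

lemma ringHom_ext {B : Type*} [CommRing B] {f g : SymmetricAlgebra R M →+* B}
    (h₁ : ∀ r : R, f (algebraMap R _ r) = g (algebraMap R _ r))
    (h₂ : ∀ m : M, f (ι R M m) = g (ι R M m)) : f = g := by
  refine RingHom.ext fun x => ?_
  induction x using SymmetricAlgebra.induction with
  | algebraMap r => exact h₁ r
  | ι m => exact h₂ m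
  | mul a b ha hb => simp [ha, hb]
  | add a b ha hb => simp [ha, hb]

lemma semilinearMap_mem (φ : R →+* S) (f : M →ₛₗ[φ] N) {n : ℕ} {x : SymmetricAlgebra R M}
    (hx : x ∈ gradedPiece R M n) : semilinearMap φ f x ∈ gradedPiece S N n := by
  have hx' : x ∈ LinearMap.range (ι R M) ^ n := hx
  induction hx' using Submodule.pow_induction_on_left' with
  | algebraMap r => simp [gradedPiece]
  | add x y i hx₁ hy₁ ihx ihy => rw [map_add]; exact add_mem (ihx hx₁) (ihy hy₁)
  | mem_mul m hm i x hx₁ ih =>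
    obtain ⟨m, rfl⟩ := hm
    rw [map_mul, semilinearMap_ι, Nat.succ_eq_add_one, add_comm]
    exact SetLike.GradedMul.mul_mem (ι_mem_gradedPiece _) (ih hx₁)

/-- `semilinearMap` as a homomorphism of graded rings. -/
def gradedMap (φ : R →+* S) (f : M →ₛₗ[φ] N) : gradedPiece R M →+*ᵍ gradedPiece S N where
  __ := semilinearMap φ f
  map_mem := semilinearMap_mem φ f

@[simp] lemma gradedMap_apply (φ : R →+* S) (f : M →ₛₗ[φ] N) (x : SymmetricAlgebra R M) :
    gradedMap φ f x = semilinearMap φ f x := rfl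

/-- If `N` is spanned by the image of `M`, the irrelevant ideal of `Sym N` is generated by the
image of the irrelevant ideal of `Sym M`. -/
lemma irrelevant_le_map (φ : R →+* S) (f : M →ₛₗ[φ] N)
    (hf : Submodule.span S (Set.range f) = ⊤) :
    HomogeneousIdeal.irrelevant (gradedPiece S N) ≤
      (HomogeneousIdeal.irrelevant (gradedPiece R M)).map (gradedMap φ f) := by
  have h1 : ∀ y : N, ι S N y ∈ ((HomogeneousIdeal.irrelevant (gradedPiece R M)).map
      (gradedMap φ f)).toIdeal := by
    intro y
    have hy : y ∈ Submodule.span S (Set.range f) := hf ▸ Submodule.mem_top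
    induction hy using Submodule.span_induction with
    | mem x hx =>
      obtain ⟨m, rfl⟩ := hx
      rw [← semilinearMap_ι φ f]
      refine Ideal.mem_map_of_mem (gradedMap φ f) ?_
      change ι R M m ∈ HomogeneousIdeal.irrelevant (gradedPiece R M)
      rw [HomogeneousIdeal.mem_irrelevant_iff]
      exact DirectSum.decompose_of_mem_ne _ (ι_mem_gradedPiece m) one_ne_zero
    | zero => simp
    | add x y _ _ hx hy => rw [map_add]; exact add_mem hx hy
    | smul a x _ hx => rw [map_smul, Algebra.smul_def]; exact Ideal.mul_mem_left _ _ hx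
  change (HomogeneousIdeal.irrelevant (gradedPiece S N)).toIdeal ≤
    ((HomogeneousIdeal.irrelevant (gradedPiece R M)).map (gradedMap φ f)).toIdeal
  refine (HomogeneousIdeal.toIdeal_irrelevant_le _).mpr ?_
  intro i hi x hx
  obtain ⟨j, rfl⟩ : ∃ j, i = j + 1 := ⟨i - 1, by omega⟩
  have hx' : x ∈ LinearMap.range (ι S N) ^ (j + 1) := hx
  rw [pow_succ'] at hx'
  induction hx' using Submodule.mul_induction_on' with
  | mem_mul_mem m hm n hn =>
    obtain ⟨m, rfl⟩ := hm
    exact Ideal.mul_mem_right _ _ (h1 m)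
  | add x hx₁ y hy₁ ihx ihy =>
    rw [← pow_succ'] at hx₁ hy₁
    exact add_mem (ihx hx₁) (ihy hy₁)

lemma semilinearMap_id : semilinearMap (RingHom.id R) (LinearMap.id : M →ₗ[R] M) = RingHom.id _ :=
  ringHom_ext (by simp) (by simp)

end Map

section Localization

variable {R S M N : Type*} [CommRing R] [CommRing S] [AddCommGroup M] [AddCommGroup N]
  [Module R M] [Module S N]

lemma exists_semilinearMap_eq (φ : R →+* S) (f : M →ₛₗ[φ] N) (r : R)
    (hφ : ∀ t : S, ∃ (n : ℕ) (a : R), φ a = φ r ^ n * t)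
    (hf : ∀ y : N, ∃ (n : ℕ) (m : M), f m = φ r ^ n • y) (b : SymmetricAlgebra S N) :
    ∃ (n : ℕ) (a : SymmetricAlgebra R M),
      semilinearMap φ f a = algebraMap S _ (φ r) ^ n * b := by
  induction b using SymmetricAlgebra.induction with
  | algebraMap t =>
    obtain ⟨n, a, h⟩ := hφ t
    exact ⟨n, algebraMap R _ a, by simp [h]⟩
  | ι y =>
    obtain ⟨n, m, h⟩ := hf y
    exact ⟨n, ι R M m, by simp [h, Algebra.smul_def]⟩
  | mul b c hb hc =>
    obtain ⟨n, a, h⟩ := hb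
    obtain ⟨n', a', h'⟩ := hc
    exact ⟨n + n', a * a', by rw [map_mul, h, h']; ring⟩
  | add b c hb hc =>
    obtain ⟨n, a, h⟩ := hb
    obtain ⟨n', a', h'⟩ := hc
    refine ⟨n + n', algebraMap R _ r ^ n' * a + algebraMap R _ r ^ n * a', ?_⟩
    rw [map_add, map_mul, map_mul, map_pow, map_pow, semilinearMap_algebraMap, h, h']
    ring

lemma exists_pow_mul_eq_zero (φ : R →+* S) (f : M →ₛₗ[φ] N) (r : R)
    (hu : IsUnit (φ r))
    (hφ : ∀ t : S, ∃ (n : ℕ) (a : R), φ a = φ r ^ n * t)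
    (hφ' : ∀ a : R, φ a = 0 → ∃ n : ℕ, r ^ n * a = 0)
    (hf : ∀ y : N, ∃ (n : ℕ) (m : M), f m = φ r ^ n • y)
    (hf' : ∀ m : M, f m = 0 → ∃ n : ℕ, r ^ n • m = 0)
    (a : SymmetricAlgebra R M) (ha : semilinearMap φ f a = 0) :
    ∃ n : ℕ, algebraMap R _ r ^ n * a = 0 := by
  let : Algebra R S := φ.toAlgebra
  let : Module R N := Module.compHom N φ
  have : IsScalarTower R S N := ⟨fun x y z => by
    change (φ x * y) • z = φ x • (y • z); rw [mul_smul]⟩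
  have : IsLocalization.Away r S := IsLocalization.Away.mk r hu
    (fun s => by obtain ⟨n, a, h⟩ := hφ s; exact ⟨n, a, by rw [mul_comm]; exact h.symm⟩)
    (fun a b hab => by
      obtain ⟨n, hn⟩ := hφ' (a - b) (by rw [map_sub]; exact sub_eq_zero.mpr hab)
      exact ⟨n, by rwa [mul_sub, sub_eq_zero] at hn⟩)
  let g : M →ₗ[R] N := { toFun := f, map_add' := map_add f, map_smul' := fun r m => f.map_smulₛₗ r m }
  have : IsLocalizedModule (.powers r) g := by
    refine IsLocalizedModule.Away.mk_of_addCommGroup ?_ ?_ ?_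
    · rw [Module.End.isUnit_iff]
      obtain ⟨u, hu⟩ := hu
      refine ⟨fun x y hxy => ?_, fun y => ⟨(↑u⁻¹ : S) • y, ?_⟩⟩
      · have : φ r • x = φ r • y := hxy
        rw [← hu] at this
        simpa [← mul_smul] using congr((↑u⁻¹ : S) • $this)
      · change φ r • ((↑u⁻¹ : S) • y) = y
        rw [← hu, ← mul_smul]; simp
    · intro y
      obtain ⟨n, m, h⟩ := hf y
      refine ⟨n, m, ?_⟩
      rw [← map_pow] at h
      exact h.symm
    · intro m hm
      exact hf' m hm
  let B := Localization.Away (algebraMap R (SymmetricAlgebra R M) r)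
  have hB : IsUnit (algebraMap (SymmetricAlgebra R M) B (algebraMap R _ r)) :=
    IsLocalization.Away.algebraMap_isUnit _
  have hB' : IsUnit (algebraMap R B r) := by
    rwa [IsScalarTower.algebraMap_apply R (SymmetricAlgebra R M) B]
  let ψ : S →+* B := IsLocalization.Away.lift r hB'
  have hψ : ∀ x : R, ψ (φ x) = algebraMap R B x := fun x => IsLocalization.Away.lift_eq r hB' x
  let : Algebra S B := ψ.toAlgebra
  have : IsScalarTower R S B := .of_algebraMap_eq fun x => (hψ x).symm
  let h₀ : M →ₗ[R] B := ((IsScalarTower.toAlgHom R (SymmetricAlgebra R M) B).toLinearMap) ∘ₗ ι R M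
  have hunit : ∀ x : Submonoid.powers r, IsUnit (algebraMap R (Module.End R B) x) := by
    rintro ⟨_, n, rfl⟩
    rw [map_pow]
    refine IsUnit.pow n ?_
    rw [Module.End.isUnit_iff]
    have : ⇑(algebraMap R (Module.End R B) r) = fun x => algebraMap R B r * x := by
      ext x; simp [Algebra.smul_def]
    rw [this]
    exact IsUnit.isUnit_iff_mulLeft_bijective.mp hB'
  let h₁ : N →ₗ[R] B := IsLocalizedModule.lift (.powers r) g h₀ hunit
  let h₂ : N →ₗ[S] B := h₁.extendScalarsOfIsLocalization (.powers r) S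
  let σ : SymmetricAlgebra S N →ₐ[S] B := lift h₂
  have hσ : (σ : SymmetricAlgebra S N →+* B).comp (semilinearMap φ f) =
      algebraMap (SymmetricAlgebra R M) B := by
    refine ringHom_ext (fun x => ?_) (fun m => ?_)
    · simp only [RingHom.comp_apply, semilinearMap_algebraMap]
      exact (σ.commutes (φ x)).trans (hψ x)
    · simp only [RingHom.comp_apply, semilinearMap_ι]
      refine (lift_ι_apply h₂ (f m)).trans ?_
      exact IsLocalizedModule.lift_apply (.powers r) g h₀ hunit m
  have h0 : algebraMap (SymmetricAlgebra R M) B a = algebraMap (SymmetricAlgebra R M) B 0 := by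
    rw [← hσ, RingHom.comp_apply, ha]; simp
  obtain ⟨n, hn⟩ := IsLocalization.Away.exists_of_eq (algebraMap R (SymmetricAlgebra R M) r) h0
  exact ⟨n, by simpa using hn⟩

end Localization

end SymmetricAlgebra

namespace AlgebraicGeometry.Proj

open HomogeneousLocalization

variable {A B : Type u} [CommRing A] [CommRing B] {σ τ : Type u} [SetLike σ A]
  [AddSubgroupClass σ A] [SetLike τ B] [AddSubgroupClass τ B]
  {𝒜 : ℕ → σ} {ℬ : ℕ → τ} [GradedRing 𝒜] [GradedRing ℬ]

/-- If `ℬ` is the localization of `𝒜` at `r ∈ 𝒜 0`, then `ℬ_(g s)` is the localization of `𝒜_(s)`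
at `r / 1`. -/
lemma isLocalization_awayMap (g : 𝒜 →+*ᵍ ℬ) (r : 𝒜 0) (r' : ℬ 0) (hr : g r * r' = 1)
    (hs : ∀ b : B, ∃ (n : ℕ) (a : A), g a = g r ^ n * b)
    (hi : ∀ a : A, g a = 0 → ∃ n : ℕ, (r : A) ^ n * a = 0)
    {d : ℕ} {s : A} (hsd : s ∈ 𝒜 d) :
    letI := (Away.map g s).toAlgebra
    IsLocalization.Away (fromZeroRingHom 𝒜 (.powers s) r) (Away ℬ (g s)) := by
  let := (Away.map g s).toAlgebra
  have hg0 : g r ∈ ℬ 0 := g.map_mem r.2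
  have hmap : ∀ x : 𝒜 0, Away.map g s (fromZeroRingHom 𝒜 (.powers s) x) =
      fromZeroRingHom ℬ (.powers (g s)) ⟨g x, g.map_mem x.2⟩ := fun x => by
    ext
    change Localization.mk (g x) ⟨g 1, _⟩ = Localization.mk (g x) ⟨1, _⟩
    simp
  refine IsLocalization.Away.mk _ ?_ ?_ ?_
  · rw [RingHom.algebraMap_toAlgebra, hmap]
    refine IsUnit.map _ (IsUnit.of_mul_eq_one r' (Subtype.ext hr))
  · intro z
    obtain ⟨n, b, hb, rfl⟩ := Away.mk_surjective ℬ (g.map_mem hsd) z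
    obtain ⟨k, a, ha⟩ := hs b
    let a' : A := DirectSum.decompose 𝒜 a (n • d)
    have ha' : g a' = g r ^ k * b := by
      rw [GradedRingHom.map_directSumDecompose, ha]
      have : g r ^ k * b ∈ ℬ (n • d) := by
        have := SetLike.mul_mem_graded (SetLike.pow_mem_graded k hg0) hb
        simpa using this
      exact DirectSum.decompose_of_mem_same _ this
    refine ⟨k, Away.mk 𝒜 hsd n a' (SetLike.coe_mem _), ?_⟩
    rw [RingHom.algebraMap_toAlgebra, hmap, Away.map_mk, ← map_pow]
    ext
    rw [val_mul, Away.val_mk, Away.val_mk]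
    change Localization.mk b _ * Localization.mk ((⟨g r, hg0⟩ ^ k : ℬ 0) : B) 1 = _
    rw [Localization.mk_mul, ha', mul_one, SetLike.GradeZero.coe_pow, mul_comm]
    rfl
  · intro x y hxy
    obtain ⟨k, hk⟩ : ∃ k : ℕ, fromZeroRingHom 𝒜 (.powers s) r ^ k * (x - y) = 0 := by
      have h0 : Away.map g s (x - y) = 0 := by
        rw [map_sub]; exact sub_eq_zero.mpr hxy
      generalize x - y = z at h0
      obtain ⟨n, a, ha, rfl⟩ := Away.mk_surjective 𝒜 hsd z
      rw [Away.map_mk] at h0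
      have h1 := congr(HomogeneousLocalization.val $h0)
      rw [Away.val_mk, val_zero, Localization.mk_eq_mk', IsLocalization.mk'_eq_zero_iff] at h1
      obtain ⟨⟨_, l, rfl⟩, hl⟩ := h1
      obtain ⟨k, hk⟩ := hi (s ^ l * a) (by simpa using hl)
      refine ⟨k, ?_⟩
      rw [← map_pow]
      ext
      simp only [fromZeroRingHom, val_mul, Away.val_mk, val_zero]
      change Localization.mk _ _ * _ = _
      rw [Localization.mk_mul, Localization.mk_eq_mk', IsLocalization.mk'_eq_zero_iff]
      refine ⟨⟨s ^ l, l, rfl⟩, ?_⟩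
      simpa [mul_left_comm] using hk
    exact ⟨k, by rwa [mul_sub, sub_eq_zero] at hk⟩

lemma isOpenImmersion_map (g : 𝒜 →+*ᵍ ℬ)
    (hg : HomogeneousIdeal.irrelevant ℬ ≤ (HomogeneousIdeal.irrelevant 𝒜).map g)
    (r : 𝒜 0) (r' : ℬ 0) (hr : g r * r' = 1)
    (hs : ∀ b : B, ∃ (n : ℕ) (a : A), g a = g r ^ n * b)
    (hi : ∀ a : A, g a = 0 → ∃ n : ℕ, (r : A) ^ n * a = 0) :
    IsOpenImmersion (Proj.map g hg) := by
  have hcov : ⨆ s : Σ i : PNat, 𝒜 i, basicOpen 𝒜 (s.2 : A) = ⊤ := by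
    refine top_le_iff.mp fun x _ => ?_
    obtain ⟨y, hy⟩ := (affineOpenCover 𝒜).covers x
    refine TopologicalSpace.Opens.mem_iSup.mpr ⟨(affineOpenCover 𝒜).idx x, ?_⟩
    rw [← opensRange_awayι 𝒜 _ ((affineOpenCover 𝒜).idx x).2.2 ((affineOpenCover 𝒜).idx x).1.2]
    exact ⟨y, hy⟩
  refine (IsZariskiLocalAtTarget.iff_of_iSup_eq_top (P := @IsOpenImmersion)
    (fun s : Σ i : PNat, 𝒜 i => basicOpen 𝒜 (s.2 : A)) hcov).mpr fun s => ?_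
  obtain ⟨⟨d, hd⟩, s, hsd⟩ := s
  change s ∈ 𝒜 d at hsd
  change IsOpenImmersion (Proj.map g hg ∣_ basicOpen 𝒜 s)
  have h1 := isLocalization_awayMap g r r' hr hs hi hsd
  let := (Away.map g s).toAlgebra
  have h2 : IsOpenImmersion (Spec.map (CommRingCat.ofHom (Away.map g s))) :=
    IsOpenImmersion.of_isLocalization (R := Away 𝒜 s) (S := Away ℬ (g s))
      (fromZeroRingHom 𝒜 (.powers s) r)
  have h3 : (basicOpen ℬ (g s)).ι ≫ Proj.map g hg =
      (basicOpenIsoSpec ℬ (g s) (g.map_mem hsd) hd).hom ≫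
        Spec.map (CommRingCat.ofHom (Away.map g s)) ≫ awayι 𝒜 s hsd hd := by
    rw [← awayι_comp_map g hg hd s hsd, ← basicOpenIsoSpec_inv_ι]
    simp
  have h4 : IsOpenImmersion ((Proj.map g hg ∣_ basicOpen 𝒜 s) ≫ (basicOpen 𝒜 s).ι) := by
    rw [morphismRestrict_ι]
    change IsOpenImmersion ((basicOpen ℬ (g s)).ι ≫ Proj.map g hg)
    rw [h3]
    infer_instance
  exact IsOpenImmersion.of_comp _ (basicOpen 𝒜 s).ι

/-- Points of `Proj 𝒜` at which `r ∈ 𝒜 0` is invertible come from `Proj ℬ`. -/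
lemma mem_range_map (g : 𝒜 →+*ᵍ ℬ)
    (hg : HomogeneousIdeal.irrelevant ℬ ≤ (HomogeneousIdeal.irrelevant 𝒜).map g)
    (r : 𝒜 0) (r' : ℬ 0) (hr : g r * r' = 1)
    (hs : ∀ b : B, ∃ (n : ℕ) (a : A), g a = g r ^ n * b)
    (hi : ∀ a : A, g a = 0 → ∃ n : ℕ, (r : A) ^ n * a = 0)
    (x : Proj 𝒜) (hx : r ∉ (toSpecZero 𝒜 x).asIdeal) : x ∈ Set.range (Proj.map g hg) := by
  obtain ⟨y, hy⟩ := (affineOpenCover 𝒜).covers x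
  generalize (affineOpenCover 𝒜).idx x = s at y hy
  obtain ⟨⟨d, hd⟩, s, hsd⟩ := s
  change s ∈ 𝒜 d at hsd
  change Spec (.of (Away 𝒜 s)) at y
  change awayι 𝒜 s hsd hd y = x at hy
  subst hy
  change r ∉ (toSpecZero 𝒜 (awayι 𝒜 s hsd hd y)).asIdeal at hx
  rw [← Scheme.Hom.comp_apply, awayι_toSpecZero] at hx
  have h1 := isLocalization_awayMap g r r' hr hs hi hsd
  let := (Away.map g s).toAlgebra
  have h2 := PrimeSpectrum.localization_away_comap_range (Away ℬ (g s))
    (fromZeroRingHom 𝒜 (.powers s) r)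
  have h3 : (show PrimeSpectrum (Away 𝒜 s) from y) ∈
      (PrimeSpectrum.basicOpen (fromZeroRingHom 𝒜 (.powers s) r) : Set _) := hx
  rw [← h2] at h3
  obtain ⟨z, hz⟩ := h3
  let z' : Spec (.of (Away ℬ (g s))) := z
  have hz' : Spec.map (CommRingCat.ofHom (Away.map g s)) z' = y := hz
  refine ⟨awayι ℬ (g s) (g.map_mem hsd) hd z', ?_⟩
  rw [← Scheme.Hom.comp_apply, awayι_comp_map g hg hd s hsd, Scheme.Hom.comp_apply, hz']

end AlgebraicGeometry.Proj

namespace AlgebraicGeometry.Scheme.Modules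

variable {X : Scheme.{u}} (E : X.Modules)

/-- The restriction map of an `𝒪_X`-module, as a semilinear map. -/
def res {U V : X.Opens} (h : V ≤ U) :
    Γ(E, U) →ₛₗ[(X.presheaf.map (homOfLE h).op).hom] Γ(E, V) where
  toFun := E.presheaf.map (homOfLE h).op
  map_add' := map_add _
  map_smul' r x := E.map_smul (homOfLE h) r x

lemma res_apply {U V : X.Opens} (h : V ≤ U) (x : Γ(E, U)) :
    E.res h x = E.presheaf.map (homOfLE h).op x := rfl

lemma res_res {U V W : X.Opens} (h : V ≤ U) (h' : W ≤ V) (x : Γ(E, U)) :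
    E.res h' (E.res h x) = E.res (h'.trans h) x := by
  simp only [res_apply, ← ConcreteCategory.comp_apply, ← Functor.map_comp, ← op_comp, homOfLE_comp]

lemma res_self {U : X.Opens} (x : Γ(E, U)) : E.res le_rfl x = x := by
  change E.presheaf.map (𝟙 _) x = x
  simp

lemma fromSpec_image_le {U : X.Opens} (hU : IsAffineOpen U) (W : (Spec Γ(X, U)).Opens) :
    hU.fromSpec ''ᵁ W ≤ U :=
  (hU.fromSpec.image_mono le_top).trans (by simp)

lemma smul_restrict_fromSpec {U : X.Opens} (hU : IsAffineOpen U) (W : (Spec Γ(X, U)).Opens)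
    (r : Γ(X, U)) (x : Γ(E.restrict hU.fromSpec, W)) :
    (E.restrictAppIso hU.fromSpec W).hom (r • x) =
      X.presheaf.map (homOfLE (fromSpec_image_le hU W)).op r •
        (E.restrictAppIso hU.fromSpec W).hom x := by
  rw [smul_Spec_def]
  refine (smul_restrictAppIso_hom_apply hU.fromSpec E W _ x).trans ?_
  change _ • (E.restrictAppIso hU.fromSpec W).hom x = _
  congr 1
  have : X.presheaf.map (homOfLE (fromSpec_image_le hU W)).op ≫ (hU.fromSpec.appIso W).hom =
      (ΓSpecIso _).inv ≫ (Spec Γ(X, U)).presheaf.map W.leTop.op := by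
    rw [Scheme.Hom.appIso_hom', Scheme.Hom.map_appLE, Scheme.Hom.appLE, hU.fromSpec_app_self,
      Category.assoc, ← Functor.map_comp]
    rfl
  rw [← Iso.eq_comp_inv] at this
  rw [this]
  rfl

lemma isLocalizing_Spec {R : CommRingCat.{u}} (M : (Spec R).Modules) [M.IsQuasicoherent] (f : R)
    (D : (Spec R).Opens) (hD : D = PrimeSpectrum.basicOpen f) :
    (∀ y : Γ(M, D), ∃ (n : ℕ) (m : Γ(M, ⊤)), f ^ n • y = M.res (le_top : D ≤ ⊤) m) ∧
    ∀ m : Γ(M, ⊤), M.res (le_top : D ≤ ⊤) m = 0 → ∃ n : ℕ, f ^ n • m = 0 := by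
  subst hD
  have h1 := (isIso_fromTildeΓ_iff_isLocalizing M).mp inferInstance f
  refine ⟨fun y => ?_, fun m hm => ?_⟩
  · obtain ⟨⟨m, ⟨_, n, rfl⟩⟩, h⟩ := h1.surj y
    exact ⟨n, m, h⟩
  · obtain ⟨⟨_, n, rfl⟩, h⟩ := (IsLocalizedModule.eq_zero_iff (.powers f)
      ((modulesSpecToSheaf.obj M).obj.map (PrimeSpectrum.basicOpen f).leTop.op).hom).mp hm
    exact ⟨n, h⟩

/-- Over an affine open `U`, sections of a quasi-coherent module over `D(f)` are the localization
at `f` of the sections over `U`. -/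
lemma isLocalizing_res [E.IsQuasicoherent] {U V : X.Opens} (hU : IsAffineOpen U) (f : Γ(X, U))
    (hV : X.basicOpen f = V) (h : V ≤ U) :
    (∀ y : Γ(E, V), ∃ (n : ℕ) (m : Γ(E, U)),
      E.res h m = X.presheaf.map (homOfLE h).op f ^ n • y) ∧
    ∀ m : Γ(E, U), E.res h m = 0 → ∃ n : ℕ, f ^ n • m = 0 := by
  subst hV
  obtain ⟨D, hD⟩ : ∃ D : (Spec Γ(X, U)).Opens, D = PrimeSpectrum.basicOpen f := ⟨_, rfl⟩
  have h1 := isLocalizing_Spec (E.restrict hU.fromSpec) f D hD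
  have e1 : hU.fromSpec ''ᵁ D = X.basicOpen f :=
    hD ▸ hU.fromSpec_image_basicOpen f
  have e0 : hU.fromSpec ''ᵁ ⊤ = U := by simp
  have hρ : ∀ m, (E.restrictAppIso hU.fromSpec D).hom
      ((E.restrict hU.fromSpec).res (le_top : D ≤ ⊤) m) =
      E.res (hU.fromSpec.image_mono le_top) ((E.restrictAppIso hU.fromSpec ⊤).hom m) := fun m => rfl
  refine ⟨fun y => ?_, fun m hm => ?_⟩
  · obtain ⟨n, m, hm⟩ := h1.1
      ((E.restrictAppIso hU.fromSpec D).inv (E.res e1.le y))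
    refine ⟨n, E.res e0.ge ((E.restrictAppIso hU.fromSpec ⊤).hom m), ?_⟩
    have h2 := congr(E.res e1.ge ((E.restrictAppIso hU.fromSpec D).hom $hm))
    rw [hρ, smul_restrict_fromSpec, Iso.inv_hom_id_apply, LinearMap.map_smulₛₗ, res_res, res_res,
      res_self] at h2
    rw [res_res, ← h2, map_pow, map_pow]
    congr 2
    rw [← CommRingCat.comp_apply, ← Functor.map_comp]
    rfl
  · have h2 := h1.2 ((E.restrictAppIso hU.fromSpec ⊤).inv (E.res e0.le m)) (by
      refine (ConcreteCategory.bijective_of_isIso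
        (E.restrictAppIso hU.fromSpec D).hom).1 ?_
      rw [hρ, Iso.inv_hom_id_apply, res_res, ← res_res E h e1.le, hm, map_zero, map_zero])
    obtain ⟨n, hn⟩ := h2
    refine ⟨n, ?_⟩
    have h3 := congr(E.res e0.ge ((E.restrictAppIso hU.fromSpec ⊤).hom $hn))
    rw [smul_restrict_fromSpec, Iso.inv_hom_id_apply, LinearMap.map_smulₛₗ, res_res,
      res_self, map_zero, map_zero] at h3
    rw [← h3]
    congr 1
    rw [← CommRingCat.comp_apply, ← Functor.map_comp]
    exact (congr($(X.presheaf.map_id (.op U)) (f ^ n))).symm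

end AlgebraicGeometry.Scheme.Modules
namespace SymmetricAlgebra

section Proj

variable {R S M N : Type u} [CommRing R] [CommRing S] [AddCommGroup M] [AddCommGroup N]
  [Module R M] [Module S N]

variable (R M) in
/-- The structure map `R → Sym⁰ M`. -/
def toZero : R →+* gradedPiece R M 0 where
  toFun r := ⟨algebraMap R _ r, by simp [gradedPiece]⟩
  map_one' := Subtype.ext (map_one _)
  map_mul' a b := Subtype.ext (map_mul _ a b)
  map_zero' := Subtype.ext (map_zero _)
  map_add' a b := Subtype.ext (map_add _ a b)

variable (R M) in
/-- The structure morphism `Proj (Sym_R M) ⟶ Spec R`. -/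
def projToSpec : Proj (gradedPiece R M) ⟶ Spec (.of R) :=
  Proj.toSpecZero (gradedPiece R M) ≫ Spec.map (CommRingCat.ofHom (toZero R M))

lemma map_projToSpec (φ : R →+* S) (f : M →ₛₗ[φ] N)
    (hf : Submodule.span S (Set.range f) = ⊤) :
    Proj.map (gradedMap φ f) (irrelevant_le_map φ f hf) ≫ projToSpec R M =
      projToSpec S N ≫ Spec.map (CommRingCat.ofHom φ) := by
  refine (Proj.mapAffineOpenCover _ (irrelevant_le_map φ f hf)).openCover.hom_ext _ _ fun s => ?_
  obtain ⟨⟨d, hd⟩, s, hsd⟩ := s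
  change s ∈ gradedPiece R M d at hsd
  change Proj.awayι (gradedPiece S N) (gradedMap φ f s) ((gradedMap φ f).map_mem hsd) hd ≫ _ =
    Proj.awayι (gradedPiece S N) (gradedMap φ f s) ((gradedMap φ f).map_mem hsd) hd ≫ _
  rw [Proj.awayι_comp_map_assoc _ _ hd _ hsd, projToSpec, projToSpec,
    Proj.awayι_toSpecZero_assoc, Category.assoc, Proj.awayι_toSpecZero_assoc,
    ← Spec.map_comp, ← Spec.map_comp, ← Spec.map_comp, ← Spec.map_comp]
  congr 1
  ext x
  change Localization.mk (semilinearMap φ f (algebraMap R _ x)) ⟨gradedMap φ f 1, _⟩ =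
    Localization.mk (algebraMap S _ (φ x)) ⟨1, _⟩
  simp

lemma isPullback_proj (φ : R →+* S) (f : M →ₛₗ[φ] N)
    (hspan : Submodule.span S (Set.range f) = ⊤) (r : R)
    (hu : IsUnit (φ r))
    (hφ : ∀ t : S, ∃ (n : ℕ) (a : R), φ a = φ r ^ n * t)
    (hφ' : ∀ a : R, φ a = 0 → ∃ n : ℕ, r ^ n * a = 0)
    (hf : ∀ y : N, ∃ (n : ℕ) (m : M), f m = φ r ^ n • y)
    (hf' : ∀ m : M, f m = 0 → ∃ n : ℕ, r ^ n • m = 0)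
    [IsOpenImmersion (Spec.map (CommRingCat.ofHom φ))] :
    IsPullback (Proj.map (gradedMap φ f) (irrelevant_le_map φ f hspan))
      (projToSpec S N) (projToSpec R M) (Spec.map (CommRingCat.ofHom φ)) := by
  obtain ⟨u, hu'⟩ := hu.exists_right_inv
  have hr : gradedMap φ f (toZero R M r : SymmetricAlgebra R M) * (toZero S N u) = 1 := by
    change semilinearMap φ f (algebraMap R _ r) * algebraMap S _ u = 1
    rw [semilinearMap_algebraMap, ← map_mul, hu', map_one]
  have hs : ∀ b : SymmetricAlgebra S N, ∃ (n : ℕ) (a : SymmetricAlgebra R M),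
      gradedMap φ f a = gradedMap φ f (toZero R M r : SymmetricAlgebra R M) ^ n * b := by
    intro b
    obtain ⟨n, a, h⟩ := exists_semilinearMap_eq φ f r hφ hf b
    refine ⟨n, a, h.trans ?_⟩
    rw [← semilinearMap_algebraMap φ f]
    rfl
  have hi : ∀ a : SymmetricAlgebra R M, gradedMap φ f a = 0 →
      ∃ n : ℕ, (toZero R M r : SymmetricAlgebra R M) ^ n * a = 0 :=
    exists_pow_mul_eq_zero φ f r hu hφ hφ' hf hf'
  have := Proj.isOpenImmersion_map _ (irrelevant_le_map φ f hspan) _ _ hr hs hi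
  have hcomm := map_projToSpec φ f hspan
  refine (IsOpenImmersion.isPullback _ _ _ _ hcomm ?_).flip
  refine le_antisymm ?_ ?_
  · intro x hx
    refine Proj.mem_range_map _ (irrelevant_le_map φ f hspan) _ _ hr hs hi x ?_
    obtain ⟨y, hy⟩ := hx
    intro hmem
    have h1 : r ∈ (projToSpec R M x).asIdeal := hmem
    rw [← hy] at h1
    have h2 : φ r ∈ y.asIdeal := h1
    exact y.2.ne_top (Ideal.eq_top_of_isUnit_mem _ h2 hu)
  · rintro _ ⟨y, rfl⟩
    refine ⟨projToSpec S N y, ?_⟩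
    have := congr($hcomm y)
    exact this.symm

end Proj

end SymmetricAlgebra
namespace AlgebraicGeometry.Scheme.Modules

open Scheme.AffineZariskiSite SymmetricAlgebra

variable {X : Scheme.{u}} (E : X.Modules) [E.IsQuasicoherent]

lemma span_range_res {U V : X.AffineZariskiSite} (h : V ≤ U) :
    Submodule.span Γ(X, V.toOpens) (Set.range (E.res (toOpens_mono h))) = ⊤ := by
  obtain ⟨f, hf⟩ := h
  have h' : V.toOpens ≤ U.toOpens := hf ▸ X.basicOpen_le f
  refine top_le_iff.mp fun y _ => ?_
  obtain ⟨n, m, hm⟩ := (E.isLocalizing_res U.2 f hf h').1 y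
  have hu : IsUnit (X.presheaf.map (homOfLE h').op f ^ n) := by
    refine IsUnit.pow n ?_
    obtain ⟨V, hV⟩ := V
    change X.basicOpen f = V at hf
    subst hf
    exact RingedSpace.isUnit_res_basicOpen _ f
  obtain ⟨u, hu⟩ := hu
  have : y = (↑u⁻¹ : Γ(X, V.toOpens)) • E.res h' m := by
    rw [hm, ← hu, ← mul_smul]; simp
  rw [this]
  exact Submodule.smul_mem _ _ (Submodule.subset_span ⟨m, rfl⟩)

/-- The functor `U ↦ Proj (Sym_{Γ(X, U)} Γ(E, U))` on affine opens `U` of `X`. -/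
def projFunctor : X.AffineZariskiSite ⥤ Scheme.{u} where
  obj U := Proj (gradedPiece Γ(X, U.toOpens) Γ(E, U.toOpens))
  map {V U} i := Proj.map (gradedMap _ (E.res (toOpens_mono i.le)))
    (irrelevant_le_map _ _ (E.span_range_res i.le))
  map_id U := by
    rw [← Proj.map_id]
    congr 1
    refine GradedRingHom.ext fun x => ?_
    exact congr($(ringHom_ext (f := semilinearMap _ (E.res le_rfl)) (g := RingHom.id _)
      (fun r => by
        rw [semilinearMap_algebraMap]
        exact congr(algebraMap _ _ ($(X.presheaf.map_id (.op U.toOpens)) r)))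
      (fun m => by rw [semilinearMap_ι, res_self]; rfl)) x)
  map_comp {W V U} i j := by
    rw [← Proj.map_comp]
    congr 1
    refine GradedRingHom.ext fun x => ?_
    exact congr($(ringHom_ext
      (f := semilinearMap _ (E.res ((toOpens_mono i.le).trans (toOpens_mono j.le))))
      (g := (semilinearMap _ (E.res (toOpens_mono i.le))).comp
        (semilinearMap _ (E.res (toOpens_mono j.le))))
      (fun r => by
        rw [RingHom.comp_apply, semilinearMap_algebraMap, semilinearMap_algebraMap,
          semilinearMap_algebraMap, ← CommRingCat.comp_apply, ← X.presheaf.map_comp]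
        rfl)
      (fun m => by rw [RingHom.comp_apply, semilinearMap_ι, semilinearMap_ι, semilinearMap_ι,
          res_res])) x)

/-- The structure morphisms `Proj (Sym_{Γ(X, U)} Γ(E, U)) ⟶ Spec Γ(X, U)`. -/
def projFunctorToSpec :
    E.projFunctor ⟶ toOpensFunctor X ⋙ X.presheaf.rightOp ⋙ Scheme.Spec where
  app U := projToSpec Γ(X, U.toOpens) Γ(E, U.toOpens)
  naturality _ _ i := map_projToSpec _ _ (E.span_range_res i.le)

lemma equifibered_projFunctorToSpec : E.projFunctorToSpec.Equifibered := by
  intro V U i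
  obtain ⟨f, hf⟩ := i.le
  have h' : V.toOpens ≤ U.toOpens := hf ▸ X.basicOpen_le f
  have hloc : letI := (X.presheaf.map (homOfLE h').op).hom.toAlgebra
      IsLocalization.Away f Γ(X, V.toOpens) := by
    obtain ⟨V, hV⟩ := V
    change X.basicOpen f = V at hf
    subst hf
    exact U.2.isLocalization_basicOpen f
  let := (X.presheaf.map (homOfLE h').op).hom.toAlgebra
  have : IsOpenImmersion (Spec.map (CommRingCat.ofHom
      (X.presheaf.map (homOfLE (toOpens_mono i.le)).op).hom)) :=
    IsOpenImmersion.of_isLocalization (R := Γ(X, U.toOpens)) (S := Γ(X, V.toOpens)) f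
  have hE := E.isLocalizing_res U.2 f hf h'
  refine isPullback_proj _ _ (E.span_range_res i.le) f ?_ ?_ ?_ hE.1 hE.2
  · exact IsLocalization.Away.algebraMap_isUnit (S := Γ(X, V.toOpens)) f
  · intro t
    obtain ⟨n, a, ha⟩ := IsLocalization.Away.surj f t
    exact ⟨n, a, by rw [mul_comm]; exact ha.symm⟩
  · intro a ha
    obtain ⟨n, hn⟩ := IsLocalization.Away.exists_of_eq (S := Γ(X, V.toOpens)) f
      (ha.trans (map_zero _).symm)
    exact ⟨n, by simpa using hn⟩

/-- The gluing data of `Proj_X (Sym E)` over the affine opens of `X`. -/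
def projGluingData : (directedCover X).RelativeGluingData where
  functor := E.projFunctor
  natTrans := E.projFunctorToSpec ≫ (restrictIsoSpec X).inv
  equifibered := E.equifibered_projFunctorToSpec.comp
    (NatTrans.Equifibered.of_isIso (restrictIsoSpec X).symm.hom)

/-- The projective bundle `ℙ_X(E) = Proj_X (Sym E)` of a quasi-coherent module `E`. -/
def projectiveBundle : Scheme.{u} := E.projGluingData.glued

/-- The structure morphism `π : ℙ_X(E) ⟶ X`. -/
def projectiveBundleπ : E.projectiveBundle ⟶ X := E.projGluingData.toBase

end AlgebraicGeometry.Scheme.Modules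
section ModuleNotions

namespace AlgebraicGeometry.Scheme.Modules

variable {X : Scheme.{u}} (E : X.Modules)

instance isQuasicoherent_of_isLocallyFree [h : E.IsLocallyFree] : E.IsQuasicoherent :=
  SheafOfModules.instIsQuasicoherentOfIsLocallyFree (R := X.ringCatSheaf) E

/-- `E` is locally free of constant rank `r`: it is free on `r` generators on each member of some
open cover of `X`. -/
def IsLocallyFreeOfRank (r : ℕ) : Prop :=
  ∃ q : SheafOfModules.LocalGeneratorsData.{u} E,
    q.IsLocallyFreeData ∧ ∀ i, Nonempty ((q.generators i).I ≃ Fin r)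

lemma IsLocallyFreeOfRank.isLocallyFree {r : ℕ} (h : E.IsLocallyFreeOfRank r) :
    E.IsLocallyFree := by
  obtain ⟨q, hq, -⟩ := h
  exact q.isLocallyFree

/-- `E` is simple: every endomorphism of `E` is multiplication by a global function on `X`. -/
def IsSimple : Prop :=
  ∀ φ : E ⟶ E, ∃ c : Γ(X, ⊤), ∀ (U : X.Opens) (s : Γ(E, U)),
    φ.app U s = X.presheaf.map (homOfLE (le_top : U ≤ ⊤)).op c • s

end AlgebraicGeometry.Scheme.Modules

end ModuleNotions

section VectorGroups

open TensorProduct MonoidalCategory CartesianMonoidalCategory MonObj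

/-- A right comodule structure on the vector space `V` over the coalgebra `A`. -/
structure IsRightCoaction (k A V : Type u) [Field k] [AddCommGroup A] [Module k A] [Coalgebra k A]
    [AddCommGroup V] [Module k V] (ρ : V →ₗ[k] V ⊗[k] A) : Prop where
  counit : TensorProduct.rid k V ∘ₗ (Coalgebra.counit (R := k) (A := A)).lTensor V ∘ₗ ρ =
    LinearMap.id
  coassoc : (TensorProduct.assoc k V A A).toLinearMap ∘ₗ ρ.rTensor A ∘ₗ ρ =
    (Coalgebra.comul (R := k) (A := A)).lTensor V ∘ₗ ρ

/-- The affine group scheme `Spec A` of a commutative Hopf algebra `A` is unipotent: every nonzero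
finite-dimensional representation, that is, every nonzero finite-dimensional `A`-comodule, has a
nonzero fixed vector. -/
def IsUnipotentHopfAlgebra (k A : Type u) [Field k] [CommRing A] [HopfAlgebra k A] : Prop :=
  ∀ (V : Type u) [AddCommGroup V] [Module k V] [Module.Finite k V] [Nontrivial V]
    (ρ : V →ₗ[k] V ⊗[k] A), IsRightCoaction k A V ρ → ∃ v : V, v ≠ 0 ∧ ρ v = v ⊗ₜ[k] (1 : A)

/-- `Spec A` is a vector group over `k`: an abelian unipotent algebraic group scheme. -/
structure IsVectorGroup (k A : Type u) [Field k] [CommRing A] [HopfAlgebra k A] : Prop where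
  finiteType : Algebra.FiniteType k A
  cocomm : Coalgebra.IsCocomm k A
  unipotent : IsUnipotentHopfAlgebra k A

/-- The group scheme `Spec A` over `Spec k` of a commutative Hopf algebra `A` over `k`. -/
abbrev groupScheme (k A : Type u) [Field k] [CommRing A] [HopfAlgebra k A] :
    Over (Spec (.of k)) :=
  (Spec (.of A)).asOver (Spec (.of k))

section Action

variable {S : Scheme.{u}} (G P : Over S) [GrpObj G] [ModObj G P]

/-- The action of the group scheme `G` on `P` is effective: a `T`-valued point of `G` which acts
trivially on `P ×_S T` is the neutral element, for every `S`-scheme `T`. -/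
def IsEffectiveAction : Prop :=
  ∀ (T : Over S) (g : T ⟶ G), (g ▷ P) ≫ γ[G, P] = snd T P → g = toUnit T ≫ η[G]

/-- The morphism `(μ, p₂) : G ×_S P ⟶ P ×_S P`, `(g, x) ↦ (g x, x)`. -/
def actionGraph : G ⊗ P ⟶ P ⊗ P := lift γ[G, P] (snd G P)

/-- The open subscheme `V` of `P` is an orbit: it is nonempty, and the image of
`(μ, p₂) : G ×_S V ⟶ P ×_S P` is the set of points of `V ×_S V`. -/
def IsOpenOrbit (V : P.left.Opens) : Prop :=
  (V : Set P.left).Nonempty ∧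
    ∀ z : (P ⊗ P : Over S).left, (snd P P).left z ∈ V →
      (z ∈ Set.range (actionGraph G P).left ↔ (fst P P).left z ∈ V)

end Action

/-- The `k`-scheme `P` admits a vector group structure: an effective action of a vector group with
a Zariski dense open orbit. -/
def AdmitsVectorGroupStructure (k : Type u) [Field k] (P : Over (Spec (.of k))) : Prop :=
  ∃ (A : Type u) (_ : CommRing A) (_ : HopfAlgebra k A), IsVectorGroup k A ∧
    ∃ _ : ModObj (groupScheme k A) P, IsEffectiveAction (groupScheme k A) P ∧
      ∃ V : P.left.Opens, Dense (V : Set P.left) ∧ IsOpenOrbit (groupScheme k A) P V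

end VectorGroups

end

/-! Geometrically: a vector group in characteristic zero is some 𝔾ₐⁿ. If it acts on P = ℙ(E) with a
dense orbit, the action descends to X. Since dim X < dim P ≤ n, the stabilizer of a general point of
X is positive dimensional; by commutativity it fixes all of X. This gives a nonzero vector field on
P which is vertical over X. But vertical vector fields on ℙ(E) are traceless endomorphisms of E, and
a simple E of rank invertible in k has none but zero.

The proof works inside the function field K of P. A vector field is a derivation of K that preserves
the coordinate ring of every affine chart of P (`PreservesCharts`), and the action is used only
through points with values in rings. The argument rests on four results.

(1) `UnipotentHopf.exists_primitive_coordinates`: the Hopf algebra is a polynomial ring on primitive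
elements. Unipotence makes `id - ηε` locally nilpotent for convolution, so the convolution powers of
the identity are polynomial in the exponent. Their linear coefficient, the logarithm of the
identity, projects onto the primitive elements.

(2) `IsGenericallyTransitive.exists_eq_zero_on_intermediateField`: let the vector fields preserve a
field L over which K is not algebraic. Then L has transcendence degree less than n, so the n basic
fields are L-linearly dependent on L. Commutativity makes the space of relations stable under the
fields, so it contains a relation whose coefficients are killed by all of them. The orbit map `ρ : K
→ K(x₁, …, xₙ)` turns the fields into the partial derivatives, and transitivity then forces such
coefficients into k.

(3) `IsFrame.map_mem_range`, a form of Blanchard's lemma: every vector field on P preserves the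
function field of X, since an element regular on two different standard charts above an affine open
U of X comes from U.

(4) `IsHomogeneouslyIndependent.exists_traceless` and `traceless_unique`: a derivation preserving
the standard charts of projective space over a ring is governed on coordinate ratios by a unique
traceless matrix. For vertical fields, uniqueness makes the local matrices glue to an endomorphism
of E (`IsFrame.vertical_derivation_eq_zero`). Simplicity makes it a scalar, and the zero trace makes
it zero.

Applying (2) with L the function field of X contradicts (4). Effectiveness of the action is what
makes the field obtained from (2) nonzero. -/

noncomputable section

/-! ### Unipotence as local nilpotence of `id - ηε` under convolution -/

namespace UnipotentHopf

open TensorProduct WithConv Coalgebra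

variable {k A : Type u} [Field k] [CommRing A] [HopfAlgebra k A]

section Comodule

variable {V : Type u} [AddCommGroup V] [Module k V] {ρ : V →ₗ[k] V ⊗[k] A}

variable (k A) in
/-- The convolution difference of the identity and the trivial endomorphism. -/
def reducedId : WithConv (A →ₗ[k] A) := toConv LinearMap.id - 1

@[simp] lemma reducedId_one : (reducedId k A).ofConv 1 = 0 := by
  change (1 : A) - algebraMap k A (counit 1) = 0
  simp

/-- Coassociativity of the coaction turns convolution into composition: the operator `(id ⊗ (f * g))
ρ` is the operator of `g` followed by that of `f`, with the two `A`-factors multiplied. -/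
lemma lTensor_convMul_comp (h : IsRightCoaction k A V ρ) (f g : WithConv (A →ₗ[k] A)) :
    (f * g).ofConv.lTensor V ∘ₗ ρ =
      ((LinearMap.mul' k A).lTensor V ∘ₗ (TensorProduct.assoc k V A A).toLinearMap ∘ₗ
        (f.ofConv.lTensor V ∘ₗ ρ).rTensor A) ∘ₗ (g.ofConv.lTensor V ∘ₗ ρ) := by
  have h1 : (f * g).ofConv.lTensor V =
      (LinearMap.mul' k A).lTensor V ∘ₗ (TensorProduct.map f.ofConv g.ofConv).lTensor V ∘ₗ
        (comul (R := k) (A := A)).lTensor V := by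
    rw [LinearMap.convMul_def, ofConv_toConv, LinearMap.lTensor_comp, LinearMap.lTensor_comp]
  have h2 : (TensorProduct.map f.ofConv g.ofConv).lTensor V ∘ₗ
      (TensorProduct.assoc k V A A).toLinearMap =
      (TensorProduct.assoc k V A A).toLinearMap ∘ₗ
        TensorProduct.map (f.ofConv.lTensor V) g.ofConv := by
    ext; simp
  rw [h1, LinearMap.comp_assoc, LinearMap.comp_assoc, ← h.coassoc, ← LinearMap.comp_assoc (ρ.rTensor A ∘ₗ ρ), h2]
  simp only [LinearMap.comp_assoc]
  congr 2
  simp only [← LinearMap.comp_assoc]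
  congr 1
  ext; simp

/-- The coaction on the quotient by the line spanned by a fixed vector. -/
def quotCoaction (ρ : V →ₗ[k] V ⊗[k] A) (v : V) (hv : ρ v = v ⊗ₜ 1) :
    (V ⧸ (k ∙ v)) →ₗ[k] (V ⧸ (k ∙ v)) ⊗[k] A :=
  (k ∙ v).liftQ ((k ∙ v).mkQ.rTensor A ∘ₗ ρ) (by
    rw [Submodule.span_singleton_le_iff_mem, LinearMap.mem_ker, LinearMap.comp_apply, hv]
    have : (Submodule.Quotient.mk v : V ⧸ (k ∙ v)) = 0 :=
      (Submodule.Quotient.mk_eq_zero _).mpr (Submodule.mem_span_singleton_self v)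
    simp [this])

lemma quotCoaction_comp_mkQ (v : V) (hv : ρ v = v ⊗ₜ 1) :
    quotCoaction ρ v hv ∘ₗ (k ∙ v).mkQ = (k ∙ v).mkQ.rTensor A ∘ₗ ρ :=
  Submodule.liftQ_mkQ _ _ _

lemma isRightCoaction_quotCoaction (h : IsRightCoaction k A V ρ) (v : V) (hv : ρ v = v ⊗ₜ 1) :
    IsRightCoaction k A _ (quotCoaction ρ v hv) where
  counit := by
    apply Submodule.linearMap_qext
    simp only [LinearMap.comp_assoc, quotCoaction_comp_mkQ]
    ext x
    have := congr((k ∙ v).mkQ ($h.counit x))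
    simp only [LinearMap.comp_apply, LinearMap.id_apply] at this ⊢
    refine Eq.trans ?_ this
    generalize ρ x = y
    induction y with
    | zero => simp
    | add a b ha hb => rw [map_add, map_add, map_add, ha, hb]; simp
    | tmul a b => simp
  coassoc := by
    apply Submodule.linearMap_qext
    simp only [LinearMap.comp_assoc, quotCoaction_comp_mkQ]
    rw [← LinearMap.comp_assoc ρ _ (LinearMap.rTensor A _), ← LinearMap.rTensor_comp,
      quotCoaction_comp_mkQ, ← LinearMap.comp_assoc ρ, ← LinearMap.comp_assoc ρ]
    have h1 : (TensorProduct.assoc k (V ⧸ (k ∙ v)) A A).toLinearMap ∘ₗ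
        LinearMap.rTensor A ((k ∙ v).mkQ.rTensor A) =
        (k ∙ v).mkQ.rTensor (A ⊗[k] A) ∘ₗ (TensorProduct.assoc k V A A).toLinearMap := by
      ext; simp
    rw [LinearMap.rTensor_comp, ← LinearMap.comp_assoc _ _ (TensorProduct.assoc k _ A A).toLinearMap,
      h1, LinearMap.comp_assoc, LinearMap.comp_assoc, h.coassoc, ← LinearMap.comp_assoc,
      LinearMap.rTensor_comp_lTensor, ← LinearMap.lTensor_comp_rTensor, LinearMap.comp_assoc]

/-- Induction on the dimension. Modulo a fixed line the `n`-th power vanishes, so on `V` its image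
lies in (line) ⊗ A. One more factor kills this, because a fixed vector has coaction `v ⊗ 1` and
`reducedId` sends 1 to 0. -/
lemma lTensor_reducedId_pow_comp (hA : IsUnipotentHopfAlgebra k A) (n : ℕ) :
    ∀ {V : Type u} [AddCommGroup V] [Module k V] [Module.Finite k V] (ρ : V →ₗ[k] V ⊗[k] A),
      IsRightCoaction k A V ρ → Module.finrank k V = n →
      ((reducedId k A) ^ n).ofConv.lTensor V ∘ₗ ρ = 0 := by
  induction n with
  | zero =>
    intro V _ _ _ ρ h hn
    have := Module.finrank_zero_iff.mp hn
    ext x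
    rw [Subsingleton.elim x 0]; simp
  | succ n ih =>
    intro V _ _ _ ρ h hn
    have : Nontrivial V := Module.nontrivial_of_finrank_pos (R := k) (by omega)
    obtain ⟨v, hv0, hv⟩ := hA V ρ h
    have hfin : Module.finrank k (V ⧸ (k ∙ v)) = n := by
      have h1 := (k ∙ v).finrank_quotient_add_finrank
      rw [finrank_span_singleton hv0] at h1
      omega
    have h1 := ih _ (isRightCoaction_quotCoaction h v hv) hfin
    rw [pow_succ', lTensor_convMul_comp h]
    ext x
    have h2 : (k ∙ v).mkQ.rTensor A (((reducedId k A) ^ n).ofConv.lTensor V (ρ x)) = 0 := by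
      have h3 := congr($h1 ((k ∙ v).mkQ x))
      simp only [LinearMap.comp_apply, LinearMap.zero_apply] at h3
      rw [← LinearMap.comp_apply (quotCoaction ρ v hv), quotCoaction_comp_mkQ] at h3
      rw [← LinearMap.comp_apply, LinearMap.rTensor_comp_lTensor, ← LinearMap.lTensor_comp_rTensor]
      exact h3
    -- An element of `V ⊗ A` that dies modulo the line comes from (line) ⊗ A, by right exactness.
    rw [← LinearMap.mem_ker, (rTensor_exact A (LinearMap.exact_subtype_mkQ (k ∙ v))
      (Submodule.mkQ_surjective _)).linearMap_ker_eq] at h2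
    obtain ⟨y, hy⟩ := h2
    rw [LinearMap.comp_apply, LinearMap.comp_apply _ ρ, ← hy, LinearMap.comp_apply,
      LinearMap.comp_apply, ← LinearMap.comp_apply (LinearMap.rTensor A _), ← LinearMap.rTensor_comp]
    have h4 : ((reducedId k A).ofConv.lTensor V ∘ₗ ρ) ∘ₗ (k ∙ v).subtype = 0 := by
      ext ⟨w, hw⟩
      obtain ⟨c, rfl⟩ := Submodule.mem_span_singleton.mp hw
      simp [hv]
    rw [h4]
    simp

end Comodule

section LocallyFinite

lemma rTensor_lTensor_apply {V W M N : Type*} [AddCommGroup V] [Module k V] [AddCommGroup W]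
    [Module k W] [AddCommGroup M] [Module k M] [AddCommGroup N] [Module k N] (f : V →ₗ[k] W)
    (g : M →ₗ[k] N) (z : V ⊗[k] M) : f.rTensor N (g.lTensor V z) = g.lTensor W (f.rTensor M z) := by
  rw [← LinearMap.comp_apply, LinearMap.rTensor_comp_lTensor, ← LinearMap.lTensor_comp_rTensor,
    LinearMap.comp_apply]

lemma comul_comp_rid_lTensor (f : A →ₗ[k] k) :
    comul ∘ₗ (TensorProduct.rid k A).toLinearMap ∘ₗ f.lTensor A =
      ((TensorProduct.rid k A).toLinearMap ∘ₗ f.lTensor A).lTensor A ∘ₗ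
        (TensorProduct.assoc k A A A).toLinearMap ∘ₗ (comul (R := k)).rTensor A := by
  ext x y
  simp only [AlgebraTensorModule.curry_apply, curry_apply, LinearMap.coe_restrictScalars,
    LinearMap.comp_apply, LinearMap.lTensor_tmul, LinearEquiv.coe_coe, rid_tmul, map_smul,
    LinearMap.rTensor_tmul]
  generalize comul (R := k) x = z
  induction z with
  | zero => simp
  | add x y hx hy => simp [hx, hy, add_tmul]
  | tmul x y => simp

variable (k A) in
-- Expand `Δ a = ∑ cᵢ ⊗ bᵢ` in a basis `b` of the second factor; the finitely many nonzero `cᵢ` span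
-- `V`. The counit axiom puts `a` in `V`, and coassociativity makes `V` a subcomodule.
lemma exists_finite_subcomodule (a : A) : ∃ V : Submodule k A, Module.Finite k V ∧ a ∈ V ∧
    ∀ v ∈ V, comul (R := k) v ∈ LinearMap.range (V.subtype.rTensor A) := by
  classical
  let b := Module.Basis.ofVectorSpace k A
  let F := fun i => (TensorProduct.rid k A).toLinearMap ∘ₗ (b.coord i).lTensor A
  let c := fun i => F i (comul (R := k) a)
  let e := TensorProduct.equivFinsuppOfBasisRight (M := A) b
  have he : ∀ i, e (comul (R := k) a) i = c i := by
    intro i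
    simp only [c, e, F]
    generalize comul (R := k) a = y
    induction y with
    | zero => simp
    | add x y hx hy => simp only [map_add, Finsupp.add_apply, hx, hy]
    | tmul x y => simp [TensorProduct.equivFinsuppOfBasisRight_apply_tmul]
  let V : Submodule k A := Submodule.span k (c '' (e (comul (R := k) a)).support)
  have hcV : ∀ i, c i ∈ V := by
    intro i
    by_cases hi : i ∈ (e (comul (R := k) a)).support
    · exact Submodule.subset_span ⟨i, hi, rfl⟩
    · rw [Finsupp.notMem_support_iff, he] at hi
      rw [hi]; exact zero_mem _
  have hsum : comul (R := k) a = (e (comul (R := k) a)).sum fun i m => m ⊗ₜ[k] b i := by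
    conv_lhs => rw [← e.symm_apply_apply (comul (R := k) a)]
    exact TensorProduct.equivFinsuppOfBasisRight_symm_apply b _
  have ha : comul (R := k) a ∈ LinearMap.range (V.subtype.rTensor A) := by
    rw [hsum]
    refine Submodule.sum_mem _ fun i _ => ⟨⟨c i, hcV i⟩ ⊗ₜ b i, ?_⟩
    simp [he]
  obtain ⟨y, hy⟩ := ha
  refine ⟨V, Module.Finite.span_of_finite k ((Finset.finite_toSet _).image _), ?_, ?_⟩
  · have h1 : a = TensorProduct.rid k A ((counit (R := k)).lTensor A (comul (R := k) a)) := by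
      simp
    rw [h1, ← hy]
    clear hy
    induction y with
    | zero => simp
    | add x y hx hy => simp only [map_add]; exact add_mem hx hy
    | tmul x y => simpa using V.smul_mem _ x.2
  · intro v hv
    induction hv using Submodule.span_induction with
    | mem x hx =>
      obtain ⟨i, -, rfl⟩ := hx
      have h1 := congr($(comul_comp_rid_lTensor (b.coord i)) (comul (R := k) a))
      simp only [LinearMap.comp_apply, LinearEquiv.coe_coe, Coalgebra.coassoc_apply] at h1
      refine ⟨(F i ∘ₗ comul).lTensor V y, h1.symm ▸ ?_⟩
      rw [← LinearMap.comp_apply, LinearMap.rTensor_comp_lTensor, ← LinearMap.lTensor_comp_rTensor,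
        LinearMap.comp_apply, hy, LinearMap.lTensor_comp]
      rfl
    | zero => simp
    | add x y _ _ hx hy => rw [map_add]; exact add_mem hx hy
    | smul r x _ hx => rw [map_smul]; exact Submodule.smul_mem _ _ hx

/-- Restrict `Δ` to a finite-dimensional subcomodule containing `a`; the dimension of that
subcomodule bounds the exponent. -/
lemma isUnipotent_exists_pow_eq_zero (hA : IsUnipotentHopfAlgebra k A) (a : A) :
    ∃ n, ∀ m, n ≤ m → ((reducedId k A) ^ m).ofConv a = 0 := by
  obtain ⟨V, _, haV, hV⟩ := exists_finite_subcomodule k A a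
  have hinj : Function.Injective (V.subtype.rTensor A) :=
    Module.Flat.rTensor_preserves_injective_linearMap _ V.injective_subtype
  obtain ⟨ρ, hρ⟩ : ∃ ρ : V →ₗ[k] V ⊗[k] A, V.subtype.rTensor A ∘ₗ ρ = comul ∘ₗ V.subtype := by
    let e := LinearEquiv.ofInjective _ hinj
    refine ⟨e.symm.toLinearMap ∘ₗ
      (comul (R := k) ∘ₗ V.subtype).codRestrict _ (fun v => hV v v.2), ?_⟩
    ext v
    have := e.apply_symm_apply ⟨comul (R := k) v, hV v v.2⟩
    exact congr(($this : A ⊗[k] A))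
  have hρ' : ∀ v, V.subtype.rTensor A (ρ v) = comul (R := k) (v : A) := fun v => congr($hρ v)
  have hinj2 : Function.Injective (V.subtype.rTensor (A ⊗[k] A)) :=
    Module.Flat.rTensor_preserves_injective_linearMap _ V.injective_subtype
  have hco : IsRightCoaction k A V ρ := by
    constructor
    · refine LinearMap.ext fun v => Subtype.ext ?_
      have h1 : V.subtype ∘ₗ (TensorProduct.rid k V).toLinearMap =
          (TensorProduct.rid k A).toLinearMap ∘ₗ V.subtype.rTensor k := by ext; simp
      have h2 := congr($h1 ((counit (R := k)).lTensor V (ρ v)))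
      refine h2.trans ?_
      rw [LinearMap.comp_apply, rTensor_lTensor_apply, hρ']
      simp
    · refine LinearMap.ext fun v => hinj2 ?_
      have h1 : V.subtype.rTensor (A ⊗[k] A) ∘ₗ (TensorProduct.assoc k V A A).toLinearMap =
          (TensorProduct.assoc k A A A).toLinearMap ∘ₗ
            LinearMap.rTensor A (V.subtype.rTensor A) := by ext; simp
      have h2 := congr($h1 (ρ.rTensor A (ρ v)))
      simp only [LinearMap.comp_apply] at h2 ⊢
      rw [h2, rTensor_lTensor_apply, hρ', ← LinearMap.comp_apply (LinearMap.rTensor A _),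
        ← LinearMap.rTensor_comp, hρ, LinearMap.rTensor_comp, LinearMap.comp_apply, hρ']
      exact Coalgebra.coassoc_apply _
  refine ⟨Module.finrank k V, fun m hm => ?_⟩
  have h0 : ((reducedId k A) ^ m).ofConv.lTensor V ∘ₗ ρ = 0 := by
    obtain ⟨l, rfl⟩ := Nat.exists_eq_add_of_le' hm
    rw [pow_add, lTensor_convMul_comp hco, lTensor_reducedId_pow_comp hA _ ρ hco rfl,
      LinearMap.comp_zero]
  -- Applying the counit to the first factor of `(id ⊗ f) Δ a = 0` gives `f a = 0`.
  have h3 := congr($h0 ⟨a, haV⟩)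
  have h4 := congr((counit (R := k)).rTensor A (V.subtype.rTensor A $h3))
  rw [LinearMap.comp_apply, rTensor_lTensor_apply, hρ', rTensor_lTensor_apply] at h4
  simpa using congr(TensorProduct.lid k A $h4)

end LocallyFinite

end UnipotentHopf

/-! ### Convolution powers of the identity and the projection to primitive elements -/

namespace UnipotentHopf

open TensorProduct WithConv Coalgebra

/-- Over a `k`-algebra with `k` of characteristic zero, a polynomial is determined by its values at
the natural numbers. -/
lemma polynomial_ext_of_natCast (k : Type*) {B : Type*} [Field k] [CharZero k] [CommRing B]
    [Algebra k B] {p q : Polynomial B} (h : ∀ s : ℕ, p.eval (s : B) = q.eval (s : B)) : p = q := by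
  rw [← sub_eq_zero]
  ext i
  rw [Polynomial.coeff_zero, ← Module.forall_dual_apply_eq_zero_iff k]
  intro l
  -- Testing the coefficients against a linear functional `l` reduces to a polynomial over `k` with
  -- infinitely many roots.
  let r : Polynomial k := ∑ j ∈ (p - q).support, Polynomial.monomial j (l ((p - q).coeff j))
  have hr : ∀ j, r.coeff j = l ((p - q).coeff j) := by
    intro j
    simp only [r, Polynomial.finsetSum_coeff, Polynomial.coeff_monomial, Finset.sum_ite_eq']
    split_ifs with h'
    · rfl
    · rw [Polynomial.notMem_support_iff.mp h', map_zero]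
  have h0 : r = 0 := by
    refine Polynomial.eq_of_infinite_eval_eq _ _
      ((Set.infinite_range_of_injective (Nat.cast_injective (R := k))).mono ?_)
    rintro _ ⟨s, rfl⟩
    have h1 : (p - q).eval (s : B) = 0 := by simp [h]
    rw [Polynomial.eval_eq_sum, Polynomial.sum_def] at h1
    have h2 := congr(l $h1)
    simp only [map_sum, map_zero] at h2
    simp only [Set.mem_ofPred_eq, r, Polynomial.eval_finsetSum, Polynomial.eval_monomial,
      Polynomial.eval_zero]
    rw [← h2]
    refine Finset.sum_congr rfl fun j _ => ?_
    have : (p - q).coeff j * (s : B) ^ j = (s : k) ^ j • (p - q).coeff j := by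
      rw [Algebra.smul_def, mul_comm]; simp
    rw [this, map_smul, smul_eq_mul, mul_comm]
  rw [← hr, h0, Polynomial.coeff_zero]

variable {k A : Type u} [Field k] [CommRing A] [HopfAlgebra k A]

/-- An element `x` of a bialgebra is primitive if `Δ x = x ⊗ 1 + 1 ⊗ x`. -/
def IsPrimitive (k : Type u) {A : Type u} [Field k] [CommRing A] [HopfAlgebra k A] (x : A) : Prop :=
  comul (R := k) x = x ⊗ₜ 1 + 1 ⊗ₜ x

/-- The `s`-th power of the identity for the convolution product. -/
def adams (k A : Type u) [Field k] [CommRing A] [HopfAlgebra k A] [IsCocomm k A] (s : ℕ) :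
    A →ₐc[k] A :=
  (toConv (BialgHom.id k A) ^ s).ofConv

variable [IsCocomm k A]

lemma adams_zero (a : A) : adams k A 0 a = algebraMap k A (counit a) := by
  simp [adams]

lemma adams_toLinearMap (s : ℕ) :
    toConv ((adams k A s : A →ₗc[k] A) : A →ₗ[k] A) = toConv (LinearMap.id : A →ₗ[k] A) ^ s :=
  BialgHom.toLinearMap_convPow _ _

lemma adams_one (a : A) : adams k A 1 a = a := by
  simp [adams]

lemma adams_add (s t : ℕ) (a : A) : adams k A (s + t) a =
    LinearMap.mul' k A (TensorProduct.map ((adams k A s : A →ₗc[k] A) : A →ₗ[k] A)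
      ((adams k A t : A →ₗc[k] A) : A →ₗ[k] A) (comul a)) := by
  have h := adams_toLinearMap (k := k) (A := A) (s + t)
  rw [pow_add, ← adams_toLinearMap, ← adams_toLinearMap, LinearMap.convMul_def] at h
  exact congr(($h).ofConv a)

/-- The binomial theorem for `id = reducedId + 1` in the convolution ring. -/
lemma adams_eq_sum (s : ℕ) (a : A) : adams k A s a =
    ∑ m ∈ Finset.range (s + 1), s.choose m • (reducedId k A ^ m).ofConv a := by
  have h := adams_toLinearMap (k := k) (A := A) s
  have h1 : toConv (LinearMap.id : A →ₗ[k] A) = reducedId k A + 1 := by simp [reducedId]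
  rw [h1, add_pow] at h
  have h2 := congr(($h).ofConv a)
  refine h2.trans ?_
  simp only [one_pow, mul_one]
  rw [ofConv_sum, LinearMap.sum_apply]
  refine Finset.sum_congr rfl fun m _ => ?_
  rw [mul_comm, ← nsmul_eq_mul]
  rfl

variable [CharZero k]

/-- In the binomial expansion only the terms below the nilpotency exponent survive, and in
characteristic zero each `s.choose m` is a polynomial in `s`. -/
lemma exists_adams_polynomial (hA : IsUnipotentHopfAlgebra k A) (a : A) :
    ∃ p : Polynomial A, ∀ s : ℕ, p.eval (s : A) = adams k A s a := by
  obtain ⟨n, hn⟩ := isUnipotent_exists_pow_eq_zero hA a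
  let q : ℕ → Polynomial k := fun m => Polynomial.C ((m.factorial : k)⁻¹) * descPochhammer k m
  have hq : ∀ m s : ℕ, (q m).eval (s : k) = s.choose m := by
    intro m s
    simp only [q, Polynomial.eval_mul, Polynomial.eval_C, descPochhammer_eval_eq_descFactorial,
      Nat.descFactorial_eq_factorial_mul_choose]
    have : (m.factorial : k) ≠ 0 := by exact_mod_cast m.factorial_ne_zero
    push_cast
    field_simp
  refine ⟨∑ m ∈ Finset.range n, (q m).map (algebraMap k A) *
    Polynomial.C ((reducedId k A ^ m).ofConv a), fun s => ?_⟩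
  have h1 : ∀ m, ((q m).map (algebraMap k A)).eval (s : A) = s.choose m := by
    intro m
    rw [show (s : A) = algebraMap k A s by simp, Polynomial.eval_map_algebraMap,
      Polynomial.aeval_algebraMap_apply, Polynomial.coe_aeval_eq_eval, hq, map_natCast]
  rw [adams_eq_sum]
  simp only [Polynomial.eval_finsetSum, Polynomial.eval_mul, Polynomial.eval_C, h1, ← nsmul_eq_mul]
  rcases le_total n (s + 1) with h | h
  · refine Finset.sum_subset (Finset.range_mono h) fun m _ hm => ?_
    rw [hn m (by simpa using hm), smul_zero]
  · refine (Finset.sum_subset (Finset.range_mono h) fun m _ hm => ?_).symm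
    rw [Nat.choose_eq_zero_of_lt (by simpa using hm), zero_smul]

/-- The algebra homomorphism `A → A[X]` interpolating the convolution powers of the identity. -/
def adamsPolynomial (hA : IsUnipotentHopfAlgebra k A) : A →ₐ[k] Polynomial A where
  toFun a := (exists_adams_polynomial hA a).choose
  map_one' := polynomial_ext_of_natCast k fun s => by
    rw [(exists_adams_polynomial hA 1).choose_spec, map_one, Polynomial.eval_one]
  map_zero' := polynomial_ext_of_natCast k fun s => by
    rw [(exists_adams_polynomial hA 0).choose_spec, map_zero, Polynomial.eval_zero]
  map_mul' a b := polynomial_ext_of_natCast k fun s => by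
    rw [Polynomial.eval_mul, (exists_adams_polynomial hA a).choose_spec,
      (exists_adams_polynomial hA b).choose_spec, (exists_adams_polynomial hA (a * b)).choose_spec,
      map_mul]
  map_add' a b := polynomial_ext_of_natCast k fun s => by
    rw [Polynomial.eval_add, (exists_adams_polynomial hA a).choose_spec,
      (exists_adams_polynomial hA b).choose_spec, (exists_adams_polynomial hA (a + b)).choose_spec,
      map_add]
  commutes' r := polynomial_ext_of_natCast k fun s => by
    rw [(exists_adams_polynomial hA _).choose_spec, Polynomial.algebraMap_apply, Polynomial.eval_C]
    exact AlgHomClass.commutes (adams k A s) r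

variable (hA : IsUnipotentHopfAlgebra k A)

lemma eval_adamsPolynomial (a : A) (s : ℕ) :
    (adamsPolynomial hA a).eval (s : A) = adams k A s a :=
  (exists_adams_polynomial hA a).choose_spec s

lemma adamsPolynomial_coeff_zero (a : A) :
    (adamsPolynomial hA a).coeff 0 = algebraMap k A (counit a) := by
  rw [Polynomial.coeff_zero_eq_eval_zero]
  have := eval_adamsPolynomial hA a 0
  rwa [Nat.cast_zero, adams_zero] at this

/-- The linear coefficient of `adamsPolynomial`: the projection onto the primitive elements. -/
def primitivePart : A →ₗ[k] A :=
  (Polynomial.lcoeff A 1).restrictScalars k ∘ₗ (adamsPolynomial hA).toLinearMap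

lemma primitivePart_apply (a : A) : primitivePart hA a = (adamsPolynomial hA a).coeff 1 := rfl

/-- The linear coefficient of a product of polynomials whose constant terms are the counits:
`primitivePart` is a derivation at the neutral element. -/
lemma primitivePart_mul (a b : A) : primitivePart hA (a * b) =
    counit (R := k) a • primitivePart hA b + counit (R := k) b • primitivePart hA a := by
  simp only [primitivePart_apply, map_mul, Polynomial.mul_coeff_one, adamsPolynomial_coeff_zero,
    Algebra.smul_def]
  ring

lemma primitivePart_one : primitivePart hA 1 = 0 := by
  simp [primitivePart_apply, Polynomial.coeff_one]

/-- By cocommutativity each `adams k A s` is a coalgebra map, so `Δ ψₛ = (ψₛ ⊗ ψₛ) Δ`. Both sides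
are polynomial in `s`; comparing linear coefficients, with counits as constant terms, gives
primitivity. -/
lemma isPrimitive_primitivePart (a : A) : IsPrimitive k (primitivePart hA a) := by
  let F : A ⊗[k] A →ₐ[k] Polynomial (A ⊗[k] A) := Algebra.TensorProduct.lift
    ((Polynomial.mapAlgHom (Algebra.TensorProduct.includeLeft : A →ₐ[k] A ⊗[k] A)).comp
      (adamsPolynomial hA))
    ((Polynomial.mapAlgHom (Algebra.TensorProduct.includeRight : A →ₐ[k] A ⊗[k] A)).comp
      (adamsPolynomial hA)) (fun _ _ => .all _ _)
  have hF : ∀ x y : A, F (x ⊗ₜ y) =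
      (adamsPolynomial hA x).map (Algebra.TensorProduct.includeLeft : A →ₐ[k] A ⊗[k] A).toRingHom *
      (adamsPolynomial hA y).map (Algebra.TensorProduct.includeRight : A →ₐ[k] A ⊗[k] A).toRingHom :=
    fun x y => by simp [F]
  have h1 : (adamsPolynomial hA a).map (Bialgebra.comulAlgHom k A).toRingHom = F (comul a) := by
    refine polynomial_ext_of_natCast k fun s => ?_
    have h2 := Polynomial.eval_natCast_map (Bialgebra.comulAlgHom k A).toRingHom
      (adamsPolynomial hA a) s
    rw [h2, eval_adamsPolynomial]
    have h3 : comul (R := k) (adams k A s a) = TensorProduct.map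
        ((adams k A s : A →ₗc[k] A) : A →ₗ[k] A) ((adams k A s : A →ₗc[k] A) : A →ₗ[k] A)
        (comul a) := (CoalgHomClass.map_comp_comul_apply (adams k A s) a).symm
    refine Eq.trans h3 ?_
    generalize comul (R := k) a = z
    induction z with
    | zero => simp
    | add x y hx hy => simp only [map_add, hx, hy, Polynomial.eval_add]
    | tmul x y =>
      rw [hF, Polynomial.eval_mul, Polynomial.eval_natCast_map, Polynomial.eval_natCast_map,
        eval_adamsPolynomial, eval_adamsPolynomial]
      simp
  have h4 := congr(($h1).coeff 1)
  rw [Polynomial.coeff_map] at h4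
  refine Eq.trans h4 ?_
  have h5 : ∀ z : A ⊗[k] A, (F z).coeff 1 =
      primitivePart hA (TensorProduct.rid k A ((counit (R := k)).lTensor A z)) ⊗ₜ 1 +
        1 ⊗ₜ primitivePart hA (TensorProduct.lid k A ((counit (R := k)).rTensor A z)) := by
    intro z
    induction z with
    | zero => simp
    | add x y hx hy => simp only [map_add, Polynomial.coeff_add, hx, hy, add_tmul, tmul_add]; abel
    | tmul x y =>
      rw [hF, Polynomial.mul_coeff_one]
      simp only [Polynomial.coeff_map, adamsPolynomial_coeff_zero, ← primitivePart_apply]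
      simp [Algebra.algebraMap_eq_smul_one, smul_tmul, add_comm]
  rw [h5]
  simp

/-- Differentiating `ψ_{s+t} = ψₛ * ψₜ` in `t` at 0 gives the differential equation `ψ' = ψ *
primitivePart`, here read off coefficient by coefficient. -/
lemma derivative_adamsPolynomial (a : A) (i : ℕ) :
    ((i + 1 : ℕ) : A) * (adamsPolynomial hA a).coeff (i + 1) = LinearMap.mul' k A
      (TensorProduct.map ((Polynomial.lcoeff A i).restrictScalars k ∘ₗ
        (adamsPolynomial hA).toLinearMap) (primitivePart hA) (comul a)) := by
  let G : A ⊗[k] A →ₗ[k] Polynomial A := LinearMap.mul' k _ ∘ₗ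
    TensorProduct.map (adamsPolynomial hA).toLinearMap
      (Polynomial.CAlgHom.toLinearMap ∘ₗ primitivePart hA)
  have hG : ∀ x y, G (x ⊗ₜ y) = adamsPolynomial hA x * Polynomial.C (primitivePart hA y) :=
    fun x y => by simp [G]
  have h1 : Polynomial.derivative (adamsPolynomial hA a) = G (comul a) := by
    refine polynomial_ext_of_natCast k fun s => ?_
    let H : A ⊗[k] A →ₗ[k] Polynomial A := LinearMap.mul' k _ ∘ₗ
      TensorProduct.map (Polynomial.CAlgHom.toLinearMap ∘ₗ ((adams k A s : A →ₗc[k] A) : A →ₗ[k] A))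
        (adamsPolynomial hA).toLinearMap
    have hH : ∀ x y, H (x ⊗ₜ y) = Polynomial.C (adams k A s x) * adamsPolynomial hA y :=
      fun x y => by simp [H]
    have h2 : (adamsPolynomial hA a).comp (Polynomial.X + Polynomial.C (s : A)) = H (comul a) := by
      refine polynomial_ext_of_natCast k fun t => ?_
      rw [Polynomial.eval_comp]
      simp only [Polynomial.eval_add, Polynomial.eval_X, Polynomial.eval_C]
      rw [add_comm, ← Nat.cast_add, eval_adamsPolynomial, adams_add]
      generalize comul (R := k) a = z
      induction z with
      | zero => simp
      | add x y hx hy => simp only [map_add, hx, hy, Polynomial.eval_add]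
      | tmul x y =>
        rw [hH]
        simp [eval_adamsPolynomial]
    have h3 := congr((Polynomial.derivative $h2).eval 0)
    rw [Polynomial.derivative_comp] at h3
    simp only [Polynomial.derivative_add, Polynomial.derivative_X, Polynomial.derivative_C,
      add_zero, one_mul, Polynomial.eval_comp, Polynomial.eval_add, Polynomial.eval_X,
      Polynomial.eval_C, zero_add] at h3
    rw [h3]
    generalize comul (R := k) a = z
    induction z with
    | zero => simp
    | add x y hx hy => simp only [map_add, hx, hy, Polynomial.eval_add]
    | tmul x y =>
      rw [hG, hH, Polynomial.derivative_C_mul, Polynomial.eval_mul, Polynomial.eval_mul,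
        Polynomial.eval_C, Polynomial.eval_C, eval_adamsPolynomial,
        ← Polynomial.coeff_zero_eq_eval_zero, Polynomial.coeff_derivative, primitivePart_apply]
      simp
  have h2 := congr(($h1).coeff i)
  rw [Polynomial.coeff_derivative, mul_comm] at h2
  push_cast
  rw [h2]
  generalize comul (R := k) a = z
  induction z with
  | zero => simp
  | add x y hx hy => simp only [map_add, hx, hy, Polynomial.coeff_add]
  | tmul x y => rw [hG]; simp

/-- The differential equation is a recursion: after division by `i + 1`, each coefficient is a sum
of products of earlier coefficients with primitive parts. -/
lemma coeff_adamsPolynomial_mem (i : ℕ) (a : A) :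
    (adamsPolynomial hA a).coeff i ∈ Algebra.adjoin k (Set.range (primitivePart hA)) := by
  induction i generalizing a with
  | zero => rw [adamsPolynomial_coeff_zero]; exact Subalgebra.algebraMap_mem _ _
  | succ i ih =>
    have h1 := derivative_adamsPolynomial hA a i
    have h2 : (adamsPolynomial hA a).coeff (i + 1) = (((i + 1 : ℕ) : k)⁻¹) •
        (((i + 1 : ℕ) : A) * (adamsPolynomial hA a).coeff (i + 1)) := by
      rw [← nsmul_eq_mul, ← Nat.cast_smul_eq_nsmul k, smul_smul, inv_mul_cancel₀, one_smul]
      exact_mod_cast i.succ_ne_zero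
    rw [h2, h1]
    refine Subalgebra.smul_mem _ ?_ _
    generalize comul (R := k) a = z
    induction z with
    | zero => simp
    | add x y hx hy => simp only [map_add]; exact add_mem hx hy
    | tmul x y => exact mul_mem (ih x) (Algebra.subset_adjoin ⟨y, rfl⟩)

/-- Since `ψ₁ = id`, an element is the sum of the coefficients of its polynomial. -/
lemma adjoin_range_primitivePart : Algebra.adjoin k (Set.range (primitivePart hA)) = ⊤ := by
  refine top_le_iff.mp fun a _ => ?_
  rw [← adams_one (k := k) a, ← eval_adamsPolynomial hA, Polynomial.eval_eq_sum, Polynomial.sum_def]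
  refine sum_mem fun i _ => ?_
  simpa using coeff_adamsPolynomial_mem hA i a

end UnipotentHopf

/-! ### Algebraic independence of elements dual to derivations -/

lemma MvPolynomial.eq_C_of_pderiv_eq_zero {σ R : Type*} [CommRing R] [IsDomain R] [CharZero R]
    {p : MvPolynomial σ R} (h : ∀ i, MvPolynomial.pderiv i p = 0) :
    p = MvPolynomial.C (p.coeff 0) := by
  classical
  ext m
  rw [MvPolynomial.coeff_C]
  split_ifs with h0
  · rw [h0]
  · obtain ⟨i, hi⟩ : ∃ i, m i ≠ 0 := by
      by_contra! hm
      exact h0 (Finsupp.ext hm).symm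
    have h1 := congr(MvPolynomial.coeff (m - Finsupp.single i 1) $(h i))
    rw [MvPolynomial.coeff_pderiv, MvPolynomial.coeff_zero, mul_eq_zero] at h1
    have h2 : m - Finsupp.single i 1 + Finsupp.single i 1 = m :=
      tsub_add_cancel_of_le (Finsupp.single_le_iff.mpr (Nat.one_le_iff_ne_zero.mpr hi))
    rw [h2] at h1
    refine h1.resolve_right ?_
    exact Nat.cast_add_one_ne_zero _

lemma MvPolynomial.totalDegree_pderiv_lt {σ R : Type*} [CommRing R] {p : MvPolynomial σ R} {i : σ}
    (h : MvPolynomial.pderiv i p ≠ 0) : (MvPolynomial.pderiv i p).totalDegree < p.totalDegree := by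
  have h1 : ∀ m ∈ (MvPolynomial.pderiv i p).support, (m.sum fun _ e => e) < p.totalDegree := by
    intro m hm
    rw [MvPolynomial.mem_support_iff, MvPolynomial.coeff_pderiv] at hm
    have h2 := MvPolynomial.le_totalDegree (MvPolynomial.mem_support_iff.mpr (left_ne_zero_of_mul hm))
    rw [Finsupp.sum_add_index' (fun _ => rfl) (fun _ _ _ => rfl),
      Finsupp.sum_single_index rfl] at h2
    omega
  obtain ⟨m, hm⟩ := MvPolynomial.support_nonempty.mpr h
  exact (Finset.sup_lt_iff (bot_le.trans_lt (h1 m hm))).mpr h1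

/-- Elements which are dual to derivations of a nontrivial algebra in characteristic zero are
algebraically independent. -/
lemma algebraicIndependent_of_derivation {k A : Type*} [Field k] [CharZero k] [CommRing A]
    [Nontrivial A] [Algebra k A] {n : ℕ} (x : Fin n → A) (D : Fin n → Derivation k A A)
    (hD : ∀ i j, D i (x j) = if i = j then 1 else 0) : AlgebraicIndependent k x := by
  classical
  rw [algebraicIndependent_iff]
  intro p
  induction hN : p.totalDegree using Nat.strong_induction_on generalizing p with
  | _ N ih =>
  intro hp
  -- Each `D i` acts on polynomials in the `x j` as a partial derivative, so the partials of a
  -- relation are relations of lower degree and vanish by induction. The relation is then a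
  -- constant.
  have hDp : ∀ (i : Fin n) (q : MvPolynomial (Fin n) k),
      D i (MvPolynomial.aeval x q) = MvPolynomial.aeval x (MvPolynomial.pderiv i q) := by
    intro i q
    induction q using MvPolynomial.induction_on with
    | C a => simp
    | add p q hp hq => simp [hp, hq]
    | mul_X p j hp =>
      rw [map_mul, Derivation.leibniz, hp, MvPolynomial.aeval_X, hD, Derivation.leibniz,
        MvPolynomial.pderiv_X]
      by_cases hij : j = i
      · subst hij; simp
      · simp [hij, Ne.symm hij, smul_eq_mul]
  have h1 : ∀ i, MvPolynomial.pderiv i p = 0 := by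
    intro i
    by_cases h0 : MvPolynomial.pderiv i p = 0
    · exact h0
    refine ih _ ?_ _ rfl ?_
    · rw [← hN]
      exact MvPolynomial.totalDegree_pderiv_lt h0
    · rw [← hDp, hp, map_zero]
  rw [MvPolynomial.eq_C_of_pderiv_eq_zero h1] at hp ⊢
  rw [MvPolynomial.aeval_C, map_eq_zero_iff _ (algebraMap k A).injective] at hp
  rw [hp, map_zero]

/-! ### Additive coordinates on a vector group -/

namespace UnipotentHopf

open TensorProduct WithConv Coalgebra

variable {k A : Type u} [Field k] [CommRing A] [HopfAlgebra k A]

lemma IsPrimitive.counit_eq_zero {x : A} (hx : IsPrimitive k x) : counit (R := k) x = 0 := by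
  have h := Coalgebra.rTensor_counit_comul (R := k) x
  rw [hx] at h
  have h2 := congr(counit (R := k) (TensorProduct.lid k A $h))
  simpa using h2

section
variable [IsCocomm k A] [CharZero k] (hA : IsUnipotentHopfAlgebra k A)

lemma primitivePart_of_isPrimitive {x : A} (hx : IsPrimitive k x) : primitivePart hA x = x := by
  have h1 : ∀ s : ℕ, adams k A s x = s • x := by
    intro s
    induction s with
    | zero => rw [adams_zero, hx.counit_eq_zero]; simp
    | succ s ih =>
      rw [adams_add, hx]
      simp [ih, adams_one, add_mul]
  have h2 : adamsPolynomial hA x = Polynomial.X * Polynomial.C x :=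
    polynomial_ext_of_natCast k fun s => by
      rw [eval_adamsPolynomial, h1, Polynomial.eval_mul, Polynomial.eval_X, Polynomial.eval_C,
        nsmul_eq_mul]
  rw [primitivePart_apply, h2]
  simp

/-- A derivation at the neutral element is determined by its values on algebra generators, which
therefore span the range. -/
lemma finite_range_primitivePart [Algebra.FiniteType k A] :
    Module.Finite k (LinearMap.range (primitivePart hA)) := by
  obtain ⟨s, hs⟩ := (inferInstance : Algebra.FiniteType k A)
  have h : LinearMap.range (primitivePart hA) =
      Submodule.span k (primitivePart hA '' (s : Set A)) := by
    refine le_antisymm ?_ (Submodule.span_le.mpr (by rintro _ ⟨x, _, rfl⟩; exact ⟨x, rfl⟩))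
    rintro _ ⟨a, rfl⟩
    have ha : a ∈ Algebra.adjoin k (s : Set A) := hs ▸ Algebra.mem_top
    induction ha using Algebra.adjoin_induction with
    | mem x hx => exact Submodule.subset_span ⟨x, hx, rfl⟩
    | algebraMap r =>
      rw [Algebra.algebraMap_eq_smul_one, map_smul, primitivePart_one, smul_zero]
      exact zero_mem _
    | add x y _ _ hx hy => rw [map_add]; exact add_mem hx hy
    | mul x y _ _ hx hy =>
      rw [primitivePart_mul]
      exact add_mem (Submodule.smul_mem _ _ hy) (Submodule.smul_mem _ _ hx)
  rw [h]
  exact Module.Finite.span_of_finite k ((Finset.finite_toSet s).image _)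

end

/-- The derivation `(id ⊗ δ) ∘ Δ` attached to a derivation `δ` at the counit. -/
def invariantDerivation (δ : A →ₗ[k] k)
    (hδ : ∀ a b, δ (a * b) = counit (R := k) a * δ b + counit (R := k) b * δ a) :
    Derivation k A A :=
  Derivation.mk' ((TensorProduct.rid k A).toLinearMap ∘ₗ δ.lTensor A ∘ₗ comul (R := k) (A := A)) (by
    let F := (TensorProduct.rid k A).toLinearMap ∘ₗ δ.lTensor A
    let G := (TensorProduct.rid k A).toLinearMap ∘ₗ (counit (R := k) (A := A)).lTensor A
    have h : ∀ z w : A ⊗[k] A, F (z * w) = G z * F w + G w * F z := by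
      intro z w
      induction z with
      | zero => simp
      | add x y hx hy => rw [add_mul, map_add, hx, hy, map_add, map_add]; ring
      | tmul x y =>
        induction w with
        | zero => simp
        | add x y hx hy => rw [mul_add, map_add, hx, hy, map_add, map_add]; ring
        | tmul x' y' => simp [F, G, hδ, Algebra.smul_def]; ring
    intro a b
    have h1 := h (comul a) (comul b)
    rw [← Bialgebra.comul_mul] at h1
    simp only [G, LinearMap.comp_apply, Coalgebra.lTensor_counit_comul] at h1
    simpa [F] using h1)

lemma invariantDerivation_of_isPrimitive (δ : A →ₗ[k] k)
    (hδ : ∀ a b, δ (a * b) = counit (R := k) a * δ b + counit (R := k) b * δ a) {x : A}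
    (hx : IsPrimitive k x) : invariantDerivation δ hδ x = algebraMap k A (δ x) := by
  have h1 : δ 1 = 0 := by simpa using hδ 1 1
  change TensorProduct.rid k A (δ.lTensor A (comul x)) = _
  rw [hx]
  simp [h1, Algebra.algebraMap_eq_smul_one]

/-- In characteristic zero, a vector group is isomorphic to `𝔾ₐⁿ`. -/
theorem exists_primitive_coordinates [CharZero k] (hA : IsVectorGroup k A) :
    ∃ (n : ℕ) (x : Fin n → A), (∀ i, IsPrimitive k (x i)) ∧
      Function.Bijective (MvPolynomial.aeval (R := k) x) := by
  have := hA.finiteType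
  have := hA.cocomm
  have hu := hA.unipotent
  have : Nontrivial A := (Bialgebra.counitAlgHom k A).toRingHom.domain_nontrivial
  have := finite_range_primitivePart hu
  let b := Module.finBasis k (LinearMap.range (primitivePart hu))
  let x : Fin _ → A := fun i => b i
  have hx : ∀ i, IsPrimitive k (x i) := fun i => by
    obtain ⟨a, ha⟩ := (b i).2
    change IsPrimitive k ((b i : A))
    rw [← ha]
    exact isPrimitive_primitivePart hu a
  -- The coordinates of `primitivePart` are tangent vectors at the neutral element; the invariant
  -- derivations they define are dual to the `x j`.
  let δ : Fin _ → A →ₗ[k] k := fun i => b.coord i ∘ₗ (primitivePart hu).rangeRestrict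
  have hδ : ∀ i a c, δ i (a * c) = counit (R := k) a * δ i c + counit (R := k) c * δ i a := by
    intro i a c
    have : (primitivePart hu).rangeRestrict (a * c) =
        counit (R := k) a • (primitivePart hu).rangeRestrict c +
        counit (R := k) c • (primitivePart hu).rangeRestrict a :=
      Subtype.ext (primitivePart_mul hu a c)
    simp only [δ, LinearMap.comp_apply, this, map_add, map_smul, smul_eq_mul]
  refine ⟨_, x, hx, ?_, ?_⟩
  · refine algebraicIndependent_of_derivation x (fun i => invariantDerivation (δ i) (hδ i)) ?_
    intro i j
    rw [invariantDerivation_of_isPrimitive _ _ (hx j)]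
    have h1 : (primitivePart hu).rangeRestrict (x j) = b j :=
      Subtype.ext (primitivePart_of_isPrimitive hu (hx j))
    simp only [δ, LinearMap.comp_apply, h1, Module.Basis.coord_apply, Module.Basis.repr_self]
    rw [Finsupp.single_apply]
    simp only [eq_comm (a := j)]
    split_ifs <;> simp
  · rw [← AlgHom.range_eq_top, ← Algebra.adjoin_range_eq_range_aeval, ← top_le_iff,
      ← adjoin_range_primitivePart hu, Algebra.adjoin_le_iff]
    rintro _ ⟨a, rfl⟩
    have h1 := b.sum_repr ((primitivePart hu).rangeRestrict a)
    have h2 : primitivePart hu a = ∑ i, b.repr ((primitivePart hu).rangeRestrict a) i • x i := by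
      have := congr((LinearMap.range (primitivePart hu)).subtype $h1)
      rw [map_sum] at this
      exact this.symm
    rw [h2]
    exact sum_mem fun i _ => Subalgebra.smul_mem _ (Algebra.subset_adjoin (Set.mem_range_self i)) _

end UnipotentHopf

/-! ### Dual numbers and derivations -/

section DualNumbers

open TrivSqZeroExt DualNumber

/-- The ring homomorphism on dual numbers induced by a ring homomorphism. -/
def DualNumber.mapRingHom {R S : Type*} [CommRing R] [CommRing S] (f : R →+* S) :
    DualNumber R →+* DualNumber S where
  toFun x := inl (f x.fst) + inr (f x.snd)
  map_one' := by ext <;> simp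
  map_zero' := by ext <;> simp
  map_add' x y := by ext <;> simp
  map_mul' x y := by ext <;> simp

@[simp] lemma DualNumber.fst_mapRingHom {R S : Type*} [CommRing R] [CommRing S] (f : R →+* S)
    (x : DualNumber R) : (DualNumber.mapRingHom f x).fst = f x.fst := by
  simp [DualNumber.mapRingHom]

@[simp] lemma DualNumber.snd_mapRingHom {R S : Type*} [CommRing R] [CommRing S] (f : R →+* S)
    (x : DualNumber R) : (DualNumber.mapRingHom f x).snd = f x.snd := by
  simp [DualNumber.mapRingHom]

/-- The derivation attached to a section of `R[ε] → R` over `k`. -/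
def DualNumber.derivation {k R : Type*} [CommRing k] [CommRing R] [Algebra k R]
    (θ : R →+* DualNumber R) (h : ∀ r, (θ r).fst = r)
    (hk : ∀ c : k, θ (algebraMap k R c) = inl (algebraMap k R c)) : Derivation k R R :=
  Derivation.mk'
    { toFun := fun r => (θ r).snd
      map_add' := fun a b => by simp
      map_smul' := fun c r => by
        rw [Algebra.smul_def, map_mul, hk]
        simp [h, Algebra.smul_def] }
    (fun a b => by simp [h]; ring)

@[simp] lemma DualNumber.derivation_apply {k R : Type*} [CommRing k] [CommRing R] [Algebra k R]
    (θ : R →+* DualNumber R) (h : ∀ r, (θ r).fst = r)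
    (hk : ∀ c : k, θ (algebraMap k R c) = inl (algebraMap k R c)) (r : R) :
    DualNumber.derivation θ h hk r = (θ r).snd := rfl

end DualNumbers

lemma Derivation.finset_sum_apply {R A M ι : Type*} [CommRing R] [CommRing A] [Algebra R A]
    [AddCommGroup M] [Module A M] [Module R M] (s : Finset ι) (d : ι → Derivation R A M) (a : A) :
    (∑ i ∈ s, d i) a = ∑ i ∈ s, d i a := by
  classical
  induction s using Finset.induction_on with
  | empty => simp
  | insert i s hi h => rw [Finset.sum_insert hi, Finset.sum_insert hi, Derivation.add_apply, h]

/-! ### Constant vector fields on rational function fields -/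

section FractionField

open TrivSqZeroExt MvPolynomial

variable {K : Type*} [Field K] {n : ℕ}

/-- The field of rational functions in `n` variables over `K`. -/
abbrev RatField (n : ℕ) (K : Type*) [Field K] : Type _ := FractionRing (MvPolynomial (Fin n) K)

/-- The translation `xᵢ ↦ xᵢ + cᵢ ε` on polynomials. -/
def polyShift (c : Fin n → K) : MvPolynomial (Fin n) K →+* DualNumber (RatField n K) :=
  eval₂Hom ((inlHom (RatField n K) (RatField n K)).comp (algebraMap K (RatField n K)))
    (fun i => inl (algebraMap (MvPolynomial (Fin n) K) (RatField n K) (X i)) +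
      inr (algebraMap K (RatField n K) (c i)))

lemma polyShift_C (c : Fin n → K) (a : K) :
    polyShift c (C a) = inl (algebraMap K (RatField n K) a) := by
  simp [polyShift]

lemma polyShift_X (c : Fin n → K) (i : Fin n) :
    polyShift c (X i) = inl (algebraMap (MvPolynomial (Fin n) K) (RatField n K) (X i)) +
      inr (algebraMap K (RatField n K) (c i)) := by
  simp [polyShift]

lemma fst_polyShift (c : Fin n → K) (f : MvPolynomial (Fin n) K) :
    (polyShift c f).fst = algebraMap _ (RatField n K) f := by
  induction f using MvPolynomial.induction_on with
  | C a => rw [polyShift_C, fst_inl, ← MvPolynomial.algebraMap_eq, ← IsScalarTower.algebraMap_apply]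
  | add p q hp hq => rw [map_add, fst_add, hp, hq, map_add]
  | mul_X p j hp => rw [map_mul, fst_mul, hp, polyShift_X, map_mul]; simp

/-- The translation `xᵢ ↦ xᵢ + cᵢ ε` on the field of rational functions. -/
def ratShift (c : Fin n → K) : RatField n K →+* DualNumber (RatField n K) :=
  IsLocalization.lift (M := nonZeroDivisors (MvPolynomial (Fin n) K)) (g := polyShift c)
    (fun y => by
      rw [isUnit_iff_isUnit_fst, fst_polyShift]
      exact IsLocalization.map_units _ y)

lemma ratShift_poly (c : Fin n → K) (f : MvPolynomial (Fin n) K) :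
    ratShift c (algebraMap _ _ f) = polyShift c f :=
  IsLocalization.lift_eq _ _

lemma ratShift_algebraMap (c : Fin n → K) (a : K) :
    ratShift c (algebraMap K _ a) = inl (algebraMap K _ a) := by
  rw [IsScalarTower.algebraMap_apply K (MvPolynomial (Fin n) K), MvPolynomial.algebraMap_eq,
    ratShift_poly, polyShift_C, ← MvPolynomial.algebraMap_eq, ← IsScalarTower.algebraMap_apply]

lemma fst_ratShift (c : Fin n → K) (m : RatField n K) : (ratShift c m).fst = m := by
  have h : ((fstHom K (RatField n K) (RatField n K)) : DualNumber (RatField n K) →+* _).comp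
      (ratShift c) = RingHom.id _ := by
    refine IsLocalization.ringHom_ext (nonZeroDivisors (MvPolynomial (Fin n) K)) ?_
    refine RingHom.ext fun f => ?_
    simp only [RingHom.comp_apply, ratShift_poly]
    exact fst_polyShift c f
  exact congr($h m)

/-- The derivation `∑ cᵢ ∂ᵢ` of the field of rational functions. -/
def ratDeriv (c : Fin n → K) : Derivation K (RatField n K)
    (RatField n K) :=
  DualNumber.derivation (ratShift c) (fst_ratShift c) (ratShift_algebraMap c)

lemma ratDeriv_apply (c : Fin n → K) (m : RatField n K) :
    ratDeriv c m = (ratShift c m).snd := rfl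

@[simp] lemma ratDeriv_X (c : Fin n → K) (i : Fin n) :
    ratDeriv c (algebraMap _ _ (X i : MvPolynomial (Fin n) K)) = algebraMap K _ (c i) := by
  rw [ratDeriv_apply, ratShift_poly, polyShift_X, snd_add, snd_inl, snd_inr, zero_add]

lemma ratDerivation_ext {d₁ d₂ : Derivation K (RatField n K)
    (RatField n K)}
    (h : ∀ i, d₁ (algebraMap _ _ (X i : MvPolynomial (Fin n) K)) =
      d₂ (algebraMap _ _ (X i : MvPolynomial (Fin n) K))) : d₁ = d₂ := by
  have h1 : d₁.compAlgebraMap (MvPolynomial (Fin n) K) =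
      d₂.compAlgebraMap (MvPolynomial (Fin n) K) := MvPolynomial.derivation_ext h
  have h2 : ∀ f : MvPolynomial (Fin n) K, d₁ (algebraMap _ _ f) = d₂ (algebraMap _ _ f) :=
    fun f => congr($h1 f)
  ext m
  obtain ⟨f, g, hg, rfl⟩ := IsFractionRing.div_surjective (A := MvPolynomial (Fin n) K) m
  have hg0 : algebraMap _ (RatField n K) g ≠ 0 :=
    IsFractionRing.to_map_ne_zero_of_mem_nonZeroDivisors hg
  have h3 : ∀ d : Derivation K (RatField n K)
      (RatField n K), algebraMap _ _ g * d (algebraMap _ _ f / algebraMap _ _ g) =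
      d (algebraMap _ _ f) - algebraMap _ _ f / algebraMap _ _ g * d (algebraMap _ _ g) := by
    intro d
    have h4 := d.leibniz (algebraMap _ _ f / algebraMap _ _ g) (algebraMap _ _ g)
    rw [div_mul_cancel₀ _ hg0] at h4
    rw [h4]
    simp only [smul_eq_mul]
    ring
  refine mul_left_cancel₀ hg0 ?_
  rw [h3, h3, h2, h2]

/-- The commutator is a derivation that kills the variables, whose derivatives are constants. -/
lemma ratDeriv_comm (c c' : Fin n → K) (m : RatField n K) :
    ratDeriv c (ratDeriv c' m) = ratDeriv c' (ratDeriv c m) := by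
  have h : ⁅ratDeriv c, ratDeriv c'⁆ = 0 := by
    refine ratDerivation_ext fun i => ?_
    simp [Derivation.commutator_apply]
  have := congr($h m)
  rwa [Derivation.commutator_apply, Derivation.zero_apply, sub_eq_zero] at this

lemma ratDeriv_eq_sum (c : Fin n → K) :
    ratDeriv c = ∑ i, algebraMap K (RatField n K) (c i) •
      ratDeriv (Pi.single i (1 : K)) := by
  refine ratDerivation_ext fun j => ?_
  rw [Derivation.finset_sum_apply]
  simp [Pi.single_apply]
  exact Algebra.algebraMap_eq_smul_one _

lemma ratDeriv_single_algebraMap (i : Fin n) (f : MvPolynomial (Fin n) K) :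
    ratDeriv (Pi.single i (1 : K)) (algebraMap _ _ f) = algebraMap _ _ (pderiv i f) := by
  induction f using MvPolynomial.induction_on with
  | C a =>
    rw [pderiv_C, map_zero, ← MvPolynomial.algebraMap_eq, ← IsScalarTower.algebraMap_apply]
    exact Derivation.map_algebraMap _ a
  | add p q hp hq => simp [hp, hq]
  | mul_X p j hp =>
    rw [map_mul, Derivation.leibniz, hp, ratDeriv_X, Derivation.leibniz, pderiv_X]
    by_cases hij : j = i
    · subst hij; rw [Pi.single_eq_same, Pi.single_eq_same]; simp
    · rw [Pi.single_eq_of_ne hij, Pi.single_eq_of_ne hij]; simp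

/-- For a reduced fraction `f / g` the hypothesis reads `g ∂ᵢf = f ∂ᵢg`. Coprimality gives `g ∣ ∂ᵢg`
and `f ∣ ∂ᵢf`, and comparing degrees makes all partials zero. -/
lemma eq_algebraMap_of_ratDeriv_eq_zero [CharZero K] (m : RatField n K)
    (h : ∀ i, ratDeriv (Pi.single i (1 : K)) m = 0) : ∃ a : K, m = algebraMap K _ a := by
  obtain ⟨f, g, hfg, hm⟩ := IsFractionRing.exists_reduced_fraction (A := MvPolynomial (Fin n) K) m
  rw [IsFractionRing.mk'_eq_div] at hm
  have hg0 : (g : MvPolynomial (Fin n) K) ≠ 0 := nonZeroDivisors.ne_zero g.2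
  have hg0' : algebraMap _ (RatField n K) (g : MvPolynomial (Fin n) K) ≠ 0 :=
    IsFractionRing.to_map_ne_zero_of_mem_nonZeroDivisors g.2
  have key : ∀ i, g.1 * pderiv i f = f * pderiv i g.1 := by
    intro i
    have h1 : m * algebraMap _ _ (g : MvPolynomial (Fin n) K) = algebraMap _ _ f := by
      rw [← hm, div_mul_cancel₀ _ hg0']
    have h2 := congr(ratDeriv (Pi.single i (1 : K)) $h1)
    rw [Derivation.leibniz, h, ratDeriv_single_algebraMap, ratDeriv_single_algebraMap, smul_zero,
      add_zero, smul_eq_mul] at h2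
    refine IsFractionRing.injective _ (RatField n K) ?_
    rw [map_mul, map_mul, ← h2, ← h1]
    ring
  have dvd_const : ∀ p : MvPolynomial (Fin n) K, (∀ i, p ∣ pderiv i p) → ∃ a, p = C a := by
    intro p hp
    refine ⟨_, eq_C_of_pderiv_eq_zero fun i => ?_⟩
    by_contra h0
    obtain ⟨q, hq⟩ := hp i
    have h1 := totalDegree_pderiv_lt h0
    have hp0 : p ≠ 0 := by rintro rfl; simp at h0
    have hq0 : q ≠ 0 := by rintro rfl; simp [hq] at h0
    rw [hq, totalDegree_mul_of_isDomain hp0 hq0] at h1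
    omega
  obtain ⟨b, hb⟩ := dvd_const g fun i => hfg.symm.dvd_of_dvd_mul_left ⟨_, (key i).symm⟩
  obtain ⟨a, ha⟩ := dvd_const f fun i => hfg.dvd_of_dvd_mul_left ⟨_, key i⟩
  refine ⟨a / b, ?_⟩
  rw [← hm, ha, hb, map_div₀, ← MvPolynomial.algebraMap_eq, ← IsScalarTower.algebraMap_apply,
    ← IsScalarTower.algebraMap_apply]

end FractionField

/-! ### Constant relations and rigidity of derivations -/

section ConstantsMinimal

/-- A nonzero subspace of `Lⁿ` which is stable under a family of coordinatewise derivations contains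
a nonzero vector whose coordinates are constants. -/
lemma exists_constant_vector {L ι κ : Type*} [Field L] [Fintype ι] (W : Submodule L (ι → L))
    (hW : W ≠ ⊥) (D : κ → L → L) (hD1 : ∀ j, D j 1 = 0) (hD0 : ∀ j, D j 0 = 0)
    (hstab : ∀ j, ∀ w ∈ W, (fun i => D j (w i)) ∈ W) :
    ∃ w ∈ W, w ≠ 0 ∧ ∀ j i, D j (w i) = 0 := by
  classical
  have hex : ∃ m, ∃ w ∈ W, w ≠ 0 ∧ (Finset.univ.filter fun i => w i ≠ 0).card = m := by
    obtain ⟨w, hw, hw0⟩ := Submodule.exists_mem_ne_zero_of_ne_bot hW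
    exact ⟨_, w, hw, hw0, rfl⟩
  obtain ⟨w, hw, hw0, hcard⟩ := Nat.find_spec hex
  have hmin : ∀ v ∈ W, (Finset.univ.filter fun i => v i ≠ 0).card <
      (Finset.univ.filter fun i => w i ≠ 0).card → v = 0 := by
    intro v hv hlt
    by_contra hv0
    rw [hcard] at hlt
    exact Nat.find_min hex hlt ⟨v, hv, hv0, rfl⟩
  obtain ⟨i₀, hi₀⟩ : ∃ i, w i ≠ 0 := Function.ne_iff.mp hw0
  -- `w` has minimal support among nonzero vectors. Once a coordinate is normalized to 1, a
  -- derivation kills it, so the derived vector has smaller support and is zero.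
  let v := (w i₀)⁻¹ • w
  have hv : v ∈ W := W.smul_mem _ hw
  have hvi : ∀ i, v i = 0 ↔ w i = 0 := fun i => by simp [v, hi₀]
  refine ⟨v, hv, ?_, fun j => ?_⟩
  · intro h
    exact hi₀ ((hvi i₀).mp congr($h i₀))
  · have h1 : (fun i => D j (v i)) = 0 := by
      refine hmin _ (hstab j v hv) (Finset.card_lt_card ?_)
      refine Finset.ssubset_iff_subset_ne.mpr ⟨fun i => ?_, fun h => ?_⟩
      · simp only [Finset.mem_filter, Finset.mem_univ, true_and]
        intro hi hwi
        exact hi (by rw [(hvi i).mpr hwi, hD0])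
      · have : i₀ ∈ Finset.univ.filter fun i => w i ≠ 0 := by simpa using hi₀
        rw [← h] at this
        simp [v, hi₀, hD1] at this
    exact fun i => congr($h1 i)

/-- A derivation of a field of characteristic zero which vanishes on a transcendence basis
vanishes. -/
lemma Derivation.eq_zero_of_isTranscendenceBasis {k L ι : Type*} [Field k] [CharZero k] [Field L]
    [Algebra k L] {s : ι → L} (hs : IsTranscendenceBasis k s) (d : Derivation k L L)
    (hd : ∀ i, d (s i) = 0) : d = 0 := by
  let F := IntermediateField.adjoin k (Set.range s)
  have hF : ∀ x ∈ F, d x = 0 := by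
    intro x hx
    induction hx using IntermediateField.adjoin_induction with
    | mem x hx => obtain ⟨i, rfl⟩ := hx; exact hd i
    | algebraMap x => exact d.map_algebraMap x
    | add x y _ _ hx hy => rw [map_add, hx, hy, add_zero]
    | inv x _ hx => rw [Derivation.leibniz_inv, hx, smul_zero]
    | mul x y _ _ hx hy => rw [Derivation.leibniz, hx, hy, smul_zero, smul_zero, add_zero]
  let d' : Derivation F L L := Derivation.mk'
    { toFun := d
      map_add' := map_add d
      map_smul' := fun c x => by
        rw [Algebra.smul_def, Derivation.leibniz]
        change c.1 • d x + x • d c.1 = _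
        rw [hF c.1 c.2, smul_zero, add_zero]; rfl } (fun a b => d.leibniz a b)
  have halg : Algebra.IsAlgebraic F L := hs.isAlgebraic_field
  have : CharZero F := charZero_of_injective_algebraMap (algebraMap k F).injective
  ext x
  have hx : IsIntegral F x := (halg.isAlgebraic x).isIntegral
  -- Derive `minpoly x = 0`: the derivative of the minimal polynomial is nonzero at `x` by
  -- separability, so `d x = 0`.
  have h1 := d'.map_aeval (minpoly F x) x
  rw [minpoly.aeval, map_zero] at h1
  have h2 : Polynomial.aeval x (Polynomial.derivative (minpoly F x)) ≠ 0 :=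
    (minpoly.irreducible hx).separable.aeval_derivative_ne_zero (minpoly.aeval F x)
  exact ((smul_eq_zero_iff_right h2).mp h1.symm)

end ConstantsMinimal

/-! ### Pairs of embeddings of a field and its tensor square -/

section TensorSquare

open TensorProduct

variable {k K : Type u} [Field k] [Field K] [Algebra k K]

/-- The map is the base change of the injection `k[X] → K` along the flat extension `k → K`. -/
lemma aeval_includeRight_injective {ι : Type*} {a : ι → K} (ha : AlgebraicIndependent k a) :
    Function.Injective (MvPolynomial.aeval (R := K)
      (fun i => (1 : K) ⊗ₜ[k] a i : ι → K ⊗[k] K)) := by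
  let e := MvPolynomial.algebraTensorAlgEquiv (σ := ι) k K
  let φ : K ⊗[k] MvPolynomial ι k →ₐ[K] K ⊗[k] K :=
    Algebra.TensorProduct.map (AlgHom.id K K) (MvPolynomial.aeval a)
  have hφ : Function.Injective φ :=
    Module.Flat.lTensor_preserves_injective_linearMap (M := K)
      (MvPolynomial.aeval (R := k) a).toLinearMap ha
  have h : MvPolynomial.aeval (R := K) (fun i => (1 : K) ⊗ₜ[k] a i : ι → K ⊗[k] K) =
      φ.comp e.symm.toAlgHom := by
    ext i
    simp [φ, e]
  rw [h]
  exact hφ.comp e.symm.injective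

/-- Every non-nilpotent element of `K ⊗ K` survives in some pair of embeddings into a field. -/
lemma exists_embeddings_of_not_isNilpotent {z : K ⊗[k] K} (hz : ¬ IsNilpotent z) :
    ∃ (Ω : Type u) (_ : Field Ω) (φ : K ⊗[k] K →+* Ω), φ z ≠ 0 := by
  rw [nilpotent_iff_mem_prime] at hz
  push Not at hz
  obtain ⟨p, hp, hzp⟩ := hz
  refine ⟨FractionRing (K ⊗[k] K ⧸ p), inferInstance,
    (algebraMap _ _).comp (Ideal.Quotient.mk p), ?_⟩
  rw [RingHom.comp_apply, Ne, map_eq_zero_iff _ (IsFractionRing.injective _ _),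
    Ideal.Quotient.eq_zero_iff_mem]
  exact hzp

/-- If `a` is algebraic, `k(a) ⊗ k(a)` is reduced by separability, so `1 ⊗ a = a ⊗ 1` and `a` is a
multiple of 1. If `a` is transcendental, the element is the image of `X - a` under an injection of
`K[X]`, hence not nilpotent. -/
lemma mem_range_of_isNilpotent_tmul_sub [CharZero k] {a : K}
    (h : IsNilpotent ((1 : K) ⊗ₜ[k] a - a ⊗ₜ[k] (1 : K))) : a ∈ Set.range (algebraMap k K) := by
  by_cases ha : IsAlgebraic k a
  · let F := IntermediateField.adjoin k {a}
    have hsep : Algebra.IsSeparable k F := by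
      have : Algebra.IsAlgebraic k F := IntermediateField.isAlgebraic_adjoin_simple ha.isIntegral
      infer_instance
    have : FiniteDimensional k F := IntermediateField.adjoin.finiteDimensional ha.isIntegral
    have : Algebra.FormallyUnramified k F := .of_isSeparable k F
    have : Algebra.EssFiniteType k F := inferInstance
    have : IsReduced (F ⊗[k] F) := Algebra.FormallyUnramified.isReduced_of_field F (F ⊗[k] F)
    let g : F := IntermediateField.AdjoinSimple.gen k a
    have hinj : Function.Injective (Algebra.TensorProduct.map F.val F.val) := by
      have h1 : Function.Injective (F.val.toLinearMap.rTensor F) :=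
        Module.Flat.rTensor_preserves_injective_linearMap _ F.val.injective
      have h2 : Function.Injective (F.val.toLinearMap.lTensor K) :=
        Module.Flat.lTensor_preserves_injective_linearMap _ F.val.injective
      have h3 := h2.comp h1
      rw [← LinearMap.coe_comp, LinearMap.lTensor_comp_rTensor] at h3
      exact h3
    have h1 : (1 : F) ⊗ₜ[k] g - g ⊗ₜ[k] (1 : F) = 0 := by
      refine IsNilpotent.eq_zero ((IsNilpotent.map_iff hinj).mp ?_)
      simpa [g] using h
    -- Apply to `1 ⊗ g = g ⊗ 1`, on the first factor, a functional that kills 1: it must kill `g` as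
    -- well.
    let W : Submodule k F := k ∙ (1 : F)
    have h2 : W.mkQ g = 0 := by
      rw [← Module.forall_dual_apply_eq_zero_iff k]
      intro f
      have h3 := congr(TensorProduct.lid k F ((f ∘ₗ W.mkQ).rTensor F $h1))
      have h4 : W.mkQ 1 = 0 := by
        rw [Submodule.mkQ_apply, Submodule.Quotient.mk_eq_zero]
        exact Submodule.mem_span_singleton_self _
      simp only [map_sub, LinearMap.rTensor_tmul, LinearMap.comp_apply, h4, map_zero,
        TensorProduct.lid_tmul, zero_smul, zero_sub, neg_eq_zero, smul_eq_zero, one_ne_zero,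
        or_false] at h3
      exact h3
    rw [Submodule.mkQ_apply, Submodule.Quotient.mk_eq_zero, Submodule.mem_span_singleton] at h2
    obtain ⟨c, hc⟩ := h2
    refine ⟨c, ?_⟩
    have h3 := congr(($hc : K))
    simpa [g, Algebra.algebraMap_eq_smul_one] using h3
  · exfalso
    have h1 : AlgebraicIndependent k (fun _ : Unit => a) :=
      (algebraicIndependent_unique_type_iff).mpr ha
    have h2 := aeval_includeRight_injective h1
    have h3 : IsNilpotent (MvPolynomial.X () - MvPolynomial.C a : MvPolynomial Unit K) := by
      refine (IsNilpotent.map_iff h2).mp ?_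
      simpa using h
    have h4 := h3.eq_zero
    have h5 := congr(MvPolynomial.coeff (Finsupp.single () 1) $h4)
    have h6 : (0 : Unit →₀ ℕ) ≠ Finsupp.single () 1 := by
      intro h; simpa using congr($h ())
    simp [h6] at h5

end TensorSquare

/-! ### Consequences of generic transitivity of the orbit map -/

section GenericTransitivity

open TensorProduct MvPolynomial

variable {k K : Type u} [Field k] [Field K] [Algebra k K] {n : ℕ}

/-- The homomorphism `ρ : K → K(x₁, …, xₙ)`, thought of as the generic orbit map `x ↦ x · η` of an
action of an affine space on a variety with generic point `η`, is transitive: every pair of points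
over `η` is reached by specializing `x`. -/
def IsGenericallyTransitive (k : Type u) {K : Type u} [Field k] [Field K] [Algebra k K] {n : ℕ}
    (ρ : K →+* RatField n K) : Prop :=
  ∀ (Ω : Type u) [Field Ω] (i₁ i₂ : K →+* Ω),
    i₁.comp (algebraMap k K) = i₂.comp (algebraMap k K) →
    ∃ (Ω' : Type u) (_ : Field Ω') (j : Ω →+* Ω') (O : Type u) (_ : CommRing O)
      (incl : O →+* RatField n K) (ev : O →+* Ω') (ρ' σ : K →+* O),
      Function.Injective incl ∧ (∀ a, incl (σ a) = algebraMap K _ a) ∧ (∀ a, incl (ρ' a) = ρ a) ∧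
      (∀ a, ev (σ a) = j (i₂ a)) ∧ ∀ a, ev (ρ' a) = j (i₁ a)

namespace IsGenericallyTransitive

variable {ρ : K →+* RatField n K} (hρ : IsGenericallyTransitive k ρ)

include hρ

/-- A relation `p` over `K` among the `ρ (a i)` specializes, by transitivity, to a relation for
every pair of embeddings of `K`. So the image of `p` in `K ⊗ K` is nilpotent, and
`aeval_includeRight_injective` gives `p = 0`. -/
lemma algebraicIndependent {ι : Type*} {a : ι → K} (ha : AlgebraicIndependent k a) :
    AlgebraicIndependent K (fun i => ρ (a i)) := by
  rw [algebraicIndependent_iff]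
  intro p hp
  by_contra hp0
  set φ := MvPolynomial.aeval (R := K) (fun i => (1 : K) ⊗ₜ[k] a i : ι → K ⊗[k] K) with hφ
  have h1 : ¬ IsNilpotent (φ p) := by
    rw [IsNilpotent.map_iff (aeval_includeRight_injective ha)]
    exact fun h => hp0 h.eq_zero
  obtain ⟨Ω, _, ψ, hψ⟩ := exists_embeddings_of_not_isNilpotent h1
  -- The right factor carries the arguments `a i`, the left factor the coefficients of `p`.
  obtain ⟨Ω', _, j, O, _, incl, ev, ρ', σ, hincl, h2, h3, h4, h5⟩ := hρ Ω
    (ψ.comp (Algebra.TensorProduct.includeRight : K →ₐ[k] K ⊗[k] K).toRingHom)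
    (ψ.comp (Algebra.TensorProduct.includeLeft : K →ₐ[k] K ⊗[k] K).toRingHom) (by
      ext c
      simp)
  have h6 : eval₂ σ (fun i => ρ' (a i)) p = 0 := by
    refine hincl ?_
    rw [map_zero, ← hp, ← coe_eval₂Hom, map_eval₂Hom, aeval_def, coe_eval₂Hom]
    congr 1
    · exact RingHom.ext h2
    · exact funext fun i => h3 _
  have h7 := congr(ev $h6)
  rw [map_zero, ← coe_eval₂Hom, map_eval₂Hom] at h7
  have h8 : j (ψ (φ p)) = 0 := by
    rw [← h7, hφ, aeval_def, ← coe_eval₂Hom, map_eval₂Hom, map_eval₂Hom]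
    congr 2
    · refine RingHom.ext fun x => ?_
      simp [h4]
    · exact funext fun i => by simp [h5]
  exact hψ ((map_eq_zero j).mp h8)

lemma card_le {ι : Type*} {a : ι → K} (ha : AlgebraicIndependent k a) :
    Cardinal.mk ι ≤ n := by
  have h1 := (hρ.algebraicIndependent ha).lift_cardinalMk_le_trdeg
  have h2 := trdeg_add_eq K (MvPolynomial (Fin n) K) (A := RatField n K)
  have : Algebra.IsAlgebraic (MvPolynomial (Fin n) K) (RatField n K) :=
    IsLocalization.isAlgebraic _ (nonZeroDivisors (MvPolynomial (Fin n) K))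
  rw [MvPolynomial.trdeg_of_isDomain, trdeg_eq_zero] at h2
  rw [← h2] at h1
  simpa using h1

/-- If `a` is constant along the generic orbit, with value `m`, then `i₁ a = i₂ m` for all pairs of
embeddings over `k`. The pair of identities gives `a = m`; the two factors of `K ⊗ K` then make `1 ⊗
a - a ⊗ 1` nilpotent. -/
lemma mem_range_of_eq_algebraMap [CharZero k] {a m : K} (h : ρ a = algebraMap K _ m) :
    a ∈ Set.range (algebraMap k K) := by
  have key : ∀ (Ω : Type u) [Field Ω] (i₁ i₂ : K →+* Ω),
      i₁.comp (algebraMap k K) = i₂.comp (algebraMap k K) → i₁ a = i₂ m := by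
    intro Ω _ i₁ i₂ hi
    obtain ⟨Ω', _, j, O, _, incl, ev, ρ', σ, hincl, h2, h3, h4, h5⟩ := hρ Ω i₁ i₂ hi
    have h6 : ρ' a = σ m := hincl (by rw [h2, h3, h])
    refine j.injective ?_
    rw [← h5, ← h4, h6]
  have ham : a = m := key K (RingHom.id K) (RingHom.id K) rfl
  subst ham
  refine mem_range_of_isNilpotent_tmul_sub ?_
  by_contra hnil
  obtain ⟨Ω, _, ψ, hψ⟩ := exists_embeddings_of_not_isNilpotent hnil
  refine hψ ?_
  rw [map_sub, sub_eq_zero]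
  exact key Ω
    (ψ.comp (Algebra.TensorProduct.includeRight : K →ₐ[k] K ⊗[k] K).toRingHom)
    (ψ.comp (Algebra.TensorProduct.includeLeft : K →ₐ[k] K ⊗[k] K).toRingHom) (by
      ext c
      simp)

/-- An action which is generically transitive and preserves a subfield `L` over which `K` is not
algebraic has a one-parameter subgroup acting trivially on `L`. -/
theorem exists_eq_zero_on_intermediateField [CharZero k]
    (hρk : ∀ c : k, ρ (algebraMap k K c) = algebraMap K _ (algebraMap k K c))
    (D : (Fin n → k) → Derivation k K K)
    (hD : ∀ c a, ρ (D c a) = ratDeriv (fun i => algebraMap k K (c i)) (ρ a))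
    (L : IntermediateField k K) (hL : ∀ c, ∀ a ∈ L, D c a ∈ L) (t : K) (ht : Transcendental L t) :
    ∃ c : Fin n → k, c ≠ 0 ∧ ∀ a ∈ L, D c a = 0 := by
  have : CharZero K := charZero_of_injective_algebraMap (algebraMap k K).injective
  have hsingle : ∀ i : Fin n, (fun j => algebraMap k K ((Pi.single i 1 : Fin n → k) j)) =
      Pi.single i 1 := fun i => by
    ext j
    by_cases h : j = i
    · subst h; simp
    · simp [h]
  let d : Fin n → Derivation k L L := fun i => Derivation.mk'
    { toFun := fun a => ⟨D (Pi.single i 1) a, hL _ a a.2⟩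
      map_add' := fun a b => Subtype.ext (by simp)
      map_smul' := fun c a => Subtype.ext (by simp) }
    (fun a b => Subtype.ext (by simp))
  have hd : ∀ i a, ((d i a : L) : K) = D (Pi.single i 1) a := fun i a => rfl
  have hcomm : ∀ i j a, d i (d j a) = d j (d i a) := by
    intro i j a
    refine Subtype.ext (ρ.injective ?_)
    simp only [hd, hD, ratDeriv_comm]
  -- The `L`-linear relations between the restrictions to `L` of the basic vector fields.
  let W : Submodule L (Fin n → L) :=
    { carrier := {w | ∀ a : L, ∑ i, w i * d i a = 0}
      add_mem' := fun {v w} hv hw a => by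
        simp only [Pi.add_apply, add_mul, Finset.sum_add_distrib, hv a, hw a, add_zero]
      zero_mem' := fun a => by simp
      smul_mem' := fun x w hw a => by
        simp only [Pi.smul_apply, smul_eq_mul, mul_assoc, ← Finset.mul_sum, hw a, mul_zero] }
  have hmemW : ∀ w, w ∈ W ↔ ∀ a : L, ∑ i, w i * d i a = 0 := fun w => Iff.rfl
  have hW : W ≠ ⊥ := by
    -- A transcendence basis of `L` together with `t` is independent in `K`, so the basis has fewer
    -- than `n` elements. A derivation of `L` is determined by its values there, so the `n` fields
    -- are dependent.
    obtain ⟨ι, s, hs⟩ := exists_isTranscendenceBasis' k L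
    have h1 : AlgebraicIndependent L (fun _ : Unit => t) :=
      algebraicIndependent_unique_type_iff.mpr ht
    have h2 := hρ.card_le (hs.1.sumElim_comp h1)
    have : Finite ι := by
      have h3 : Finite (Unit ⊕ ι) :=
        Cardinal.lt_aleph0_iff_finite.mp (h2.trans_lt Cardinal.natCast_lt_aleph0)
      exact Finite.of_injective (Sum.inr : ι → Unit ⊕ ι) Sum.inr_injective
    have := Fintype.ofFinite ι
    have h4 : Fintype.card ι < n := by
      rw [Cardinal.mk_fintype, Nat.cast_le] at h2
      simp at h2
      omega
    let F : (Fin n → L) →ₗ[L] (ι → L) :=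
      LinearMap.pi fun j => ∑ i, (d i (s j)) • LinearMap.proj i
    have hF : LinearMap.ker F ≠ ⊥ := LinearMap.ker_ne_bot_of_finrank_lt (by simpa using h4)
    obtain ⟨w, hw, hw0⟩ := Submodule.exists_mem_ne_zero_of_ne_bot hF
    refine (Submodule.ne_bot_iff W).mpr ⟨w, ?_, hw0⟩
    have h5 := Derivation.eq_zero_of_isTranscendenceBasis hs (∑ i, w i • d i) (fun j => by
      have h6 := congr($(LinearMap.mem_ker.mp hw) j)
      simp only [F, LinearMap.pi_apply, LinearMap.sum_apply, LinearMap.smul_apply,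
        LinearMap.proj_apply, smul_eq_mul, Pi.zero_apply] at h6
      rw [Derivation.finset_sum_apply, ← h6]
      exact Finset.sum_congr rfl fun i _ => by
        rw [Derivation.smul_apply, smul_eq_mul, mul_comm])
    intro a
    have h6 := congr($h5 a)
    rw [Derivation.finset_sum_apply] at h6
    exact h6
  -- Applying `d j` to a relation and using that the `d i` commute shows that the derived
  -- coefficient vector is again a relation.
  obtain ⟨w, hw, hw0, hconst⟩ := exists_constant_vector W hW (fun j => d j)
    (fun j => (d j).map_one_eq_zero) (fun j => map_zero _) (fun j w hw a => by
      have h1 := congr(d j $(hw a))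
      rw [map_zero, map_sum] at h1
      simp only [Derivation.leibniz, Finset.sum_add_distrib, smul_eq_mul] at h1
      rw [Finset.sum_congr rfl (fun i _ => by rw [hcomm j i a]), hw (d j a), zero_add] at h1
      rw [← h1]
      exact Finset.sum_congr rfl fun i _ => mul_comm _ _)
  -- Coefficients killed by all the fields are sent by `ρ` to functions with zero partials, that is
  -- into `K`; such elements lie in `k` by transitivity.
  have h1 : ∀ i, ∃ c : k, algebraMap k K c = w i := by
    intro i
    obtain ⟨m, hm⟩ := eq_algebraMap_of_ratDeriv_eq_zero (ρ (w i)) (fun j => by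
      have h2 := hD (Pi.single j 1) (w i)
      rw [hsingle, ← hd, hconst] at h2
      simpa using h2.symm)
    exact hρ.mem_range_of_eq_algebraMap hm
  choose c hc using h1
  refine ⟨c, ?_, fun a ha => ?_⟩
  · rintro rfl
    refine hw0 (funext fun i => Subtype.ext ?_)
    rw [← hc]; simp
  · refine ρ.injective ?_
    have h2 := congr(ρ (($(hw ⟨a, ha⟩) : L) : K))
    rw [hD, map_zero, ratDeriv_eq_sum, Derivation.finset_sum_apply]
    rw [ZeroMemClass.coe_zero, map_zero] at h2
    rw [← h2, AddSubmonoidClass.coe_finsetSum, map_sum]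
    refine Finset.sum_congr rfl fun i _ => ?_
    rw [Derivation.smul_apply, MulMemClass.coe_mul, map_mul, ← hc, hρk, hd, hD, hsingle]
    rfl

end IsGenericallyTransitive

end GenericTransitivity

/-! ### Vector fields on projective space over a ring -/

section ProjectiveCharts

open MvPolynomial

lemma MvPolynomial.pderiv_comm {R σ : Type*} [CommRing R] (i j : σ) (F : MvPolynomial σ R) :
    pderiv i (pderiv j F) = pderiv j (pderiv i F) := by
  classical
  have h : ⁅(pderiv i : Derivation R (MvPolynomial σ R) (MvPolynomial σ R)),
      (pderiv j : Derivation R (MvPolynomial σ R) (MvPolynomial σ R))⁆ = 0 := by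
    refine derivation_ext fun l => ?_
    rw [Derivation.commutator_apply]
    simp only [pderiv_X, Pi.single_apply]
    split_ifs <;> simp
  have := congr($h F)
  rwa [Derivation.commutator_apply, Derivation.zero_apply, sub_eq_zero] at this

variable {R K ι : Type*} [CommRing R] [Field K] [Algebra R K]

variable (R) in
/-- The elements `yᵢ` are homogeneous coordinates over `R`: they satisfy no nontrivial homogeneous
relation. -/
def IsHomogeneouslyIndependent (y : ι → K) : Prop :=
  ∀ (N : ℕ) (F : MvPolynomial ι R), F.IsHomogeneous N → aeval y F = 0 → F = 0

variable (R) in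
/-- The ring of functions on the standard chart `yᵢ ≠ 0` of projective space. -/
def chartRing (y : ι → K) (i : ι) : Set K :=
  {s | ∃ (N : ℕ) (F : MvPolynomial ι R), F.IsHomogeneous N ∧ s * y i ^ N = aeval y F}

namespace IsHomogeneouslyIndependent

variable {y : ι → K} (hy : IsHomogeneouslyIndependent R y)

include hy

lemma eq_of_aeval_eq {N : ℕ} {F G : MvPolynomial ι R} (hF : F.IsHomogeneous N)
    (hG : G.IsHomogeneous N) (h : aeval y F = aeval y G) : F = G :=
  sub_eq_zero.mp (hy N _ (hF.sub hG) (by rw [map_sub, h, sub_self]))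

lemma ne_zero [Nontrivial R] (i : ι) : y i ≠ 0 := by
  intro h
  exact X_ne_zero (R := R) i (hy 1 _ (isHomogeneous_X R i) (by simpa using h))

/-- Cancellation of poles: independence lifts the identity to polynomials, where `X i` is prime and
does not divide `X j ^ M`, so `X i ^ N` divides `F`. -/
lemma exists_of_mul_pow_eq [IsDomain R] {i j : ι} (hij : i ≠ j) {N M d : ℕ}
    {F G : MvPolynomial ι R} (hF : F.IsHomogeneous (N + d)) (hG : G.IsHomogeneous (M + d))
    (h : aeval y F * y j ^ M = aeval y G * y i ^ N) :
    ∃ Q : MvPolynomial ι R, Q.IsHomogeneous d ∧ aeval y F = aeval y Q * y i ^ N := by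
  have h1 : F * X j ^ M = G * X i ^ N := by
    refine hy.eq_of_aeval_eq (N := N + d + M) (hF.mul (isHomogeneous_X_pow j M)) ?_ (by simpa using h)
    have := hG.mul (isHomogeneous_X_pow i N)
    rwa [show M + d + N = N + d + M by omega] at this
  have h2 : ¬ (X i : MvPolynomial ι R) ∣ X j ^ M := by
    intro h2
    have h3 := (X_prime (R := R) (i := i)).dvd_of_dvd_pow h2
    exact hij (by simpa [X_dvd_X] using h3)
  obtain ⟨Q, hQ⟩ := (X_prime (R := R) (i := i)).pow_dvd_of_dvd_mul_right N h2 ⟨G, by rw [h1, mul_comm]⟩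
  refine ⟨Q, ?_, by rw [hQ, map_mul, map_pow, aeval_X, mul_comm]⟩
  intro m hm
  have h3 : coeff (m + Finsupp.single i N) F ≠ 0 := by
    rw [hQ, mul_comm, X_pow_eq_monomial, coeff_mul_monomial, mul_one]
    exact hm
  have h4 := hF h3
  rw [map_add, Finsupp.weight_single] at h4
  simp only [Pi.one_apply, smul_eq_mul, mul_one] at h4
  omega

/-- The global functions on projective space are constants; two different charts suffice, as the
locus they miss has codimension two. -/
lemma mem_range_algebraMap [IsDomain R] {i j : ι} (hij : i ≠ j) {s : K} (hi : s ∈ chartRing R y i)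
    (hj : s ∈ chartRing R y j) : s ∈ Set.range (algebraMap R K) := by
  obtain ⟨N, F, hF, h1⟩ := hi
  obtain ⟨M, G, hG, h2⟩ := hj
  obtain ⟨Q, hQ, h3⟩ := hy.exists_of_mul_pow_eq hij (d := 0) hF hG (by
    rw [← h1, ← h2]; ring)
  have h4 := totalDegree_eq_zero_iff_eq_C.mp (Nat.le_zero.mp hQ.totalDegree_le)
  rw [h4] at h3
  rw [h3] at h1
  refine ⟨coeff 0 Q, mul_right_cancel₀ (pow_ne_zero N (hy.ne_zero i)) ?_⟩
  rw [h1]; simp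

/-- The expression equals `yᵢ² D(yⱼ/yᵢ)` and also `-yⱼ² D(yᵢ/yⱼ)`. The first can have poles only
along `yᵢ = 0`, the second only along `yⱼ = 0`, so it is a quadratic form. -/
lemma exists_quadratic [IsDomain R] (D : Derivation ℤ K K)
    (hD : ∀ i, ∀ s ∈ chartRing R y i, D s ∈ chartRing R y i) (j i : ι) :
    ∃ Q : MvPolynomial ι R, Q.IsHomogeneous 2 ∧ aeval y Q = y i * D (y j) - y j * D (y i) := by
  by_cases hij : i = j
  · subst hij
    exact ⟨0, isHomogeneous_zero _ _ _, by simp⟩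
  have hdiv : ∀ a b : ι, D (y a / y b) * y b ^ 2 = y b * D (y a) - y a * D (y b) := by
    intro a b
    have h := D.leibniz_div (y a) (y b)
    rw [h, smul_eq_mul, smul_eq_mul, smul_eq_mul]
    field_simp [hy.ne_zero b]
  have hmem : ∀ a b : ι, D (y a / y b) ∈ chartRing R y b := fun a b =>
    hD b _ ⟨1, X a, isHomogeneous_X R a, by
      rw [pow_one, div_mul_cancel₀ _ (hy.ne_zero b), aeval_X]⟩
  obtain ⟨N, F, hF, h1⟩ := hmem j i
  obtain ⟨M, G, hG, h2⟩ := hmem i j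
  obtain ⟨Q, hQ, h3⟩ := hy.exists_of_mul_pow_eq hij (d := 2) (N := N) (M := M)
    (F := F * X i ^ 2) (G := -(G * X j ^ 2)) (hF.mul (isHomogeneous_X_pow i 2))
    (hG.mul (isHomogeneous_X_pow j 2)).neg (by
      have h4 : D (y i / y j) * y j ^ 2 = - (D (y j / y i) * y i ^ 2) := by
        rw [hdiv, hdiv]; ring
      simp only [map_mul, map_neg, map_pow, aeval_X, ← h1, ← h2]
      linear_combination (y j ^ M * y i ^ N) * h4)
  refine ⟨Q, hQ, ?_⟩
  refine mul_right_cancel₀ (pow_ne_zero N (hy.ne_zero i)) ?_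
  rw [← h3, ← hdiv, map_mul, ← h1, map_pow, aeval_X]
  ring

variable [Fintype ι]

omit hy in
lemma sum_pderiv_X_mul (l : ι) (G : ι → MvPolynomial ι R) :
    ∑ i, pderiv i (X l * G i) = G l + X l * ∑ i, pderiv i (G i) := by
  classical
  simp only [Derivation.leibniz, smul_eq_mul, Finset.sum_add_distrib, pderiv_X, Finset.mul_sum]
  rw [add_comm]
  congr 1
  simp [Pi.single_apply]

omit hy in
lemma sum_pderiv_mul_self {N : ℕ} {F : MvPolynomial ι R} (hF : F.IsHomogeneous N) :
    ∑ i, pderiv i (X i * F) = (Fintype.card ι + N) • F := by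
  simp only [Derivation.leibniz, smul_eq_mul, Finset.sum_add_distrib, pderiv_X_self, mul_one,
    hF.sum_X_mul_pderiv]
  simp [add_smul, add_comm]

/-- A vector field on projective space over `R` comes from a traceless matrix. -/
theorem exists_traceless [IsDomain R] [CharZero R] (hι : IsUnit (Fintype.card ι : R)) (D : Derivation ℤ K K)
    (hD : ∀ i, ∀ s ∈ chartRing R y i, D s ∈ chartRing R y i) :
    ∃ a : Matrix ι ι R, a.trace = 0 ∧ ∀ j i, y i * D (y j) - y j * D (y i) =
      y i * ∑ l, algebraMap R K (a l j) * y l - y j * ∑ l, algebraMap R K (a l i) * y l := by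
  classical
  choose Q hQ hQy using hy.exists_quadratic D hD
  obtain ⟨u, hu⟩ := hι.exists_left_inv
  have hanti : ∀ i j, Q j i = - Q i j := fun i j =>
    hy.eq_of_aeval_eq (hQ j i) (hQ i j).neg (by rw [map_neg, hQy, hQy]; ring)
  -- The Plücker-type identity for `Q j i = yᵢ D yⱼ - yⱼ D yᵢ`; taking its divergence over `l` will
  -- express `Q` through linear forms.
  have hcoc : ∀ i j l, X l * Q j i = X i * Q j l - X j * Q i l := fun i j l => by
    have h : ∀ a b c, (X a * Q b c).IsHomogeneous 3 := fun a b c =>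
      (isHomogeneous_X R a).mul (hQ b c)
    refine hy.eq_of_aeval_eq (h _ _ _) ((h _ _ _).sub (h _ _ _)) ?_
    simp only [map_sub, map_mul, aeval_X, hQy]
    ring
  let φ : ι → MvPolynomial ι R := fun j => C u * ∑ i, pderiv i (Q j i)
  have hφ : ∀ j, (φ j).IsHomogeneous 1 := fun j =>
    (IsHomogeneous.sum _ _ _ fun i _ => (hQ j i).pderiv).C_mul u
  have hφQ : ∀ j i, Q j i = X i * φ j - X j * φ i := by
    intro j i
    -- By Euler's formula the left side is `(card ι + 2) Q j i`; the right side contributes `Q j i -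
    -- Q i j = 2 Q j i` besides the divergences, which leaves `card ι` times `Q j i`.
    have h1 : ∑ l, pderiv l (X l * Q j i) = ∑ l, pderiv l (X i * Q j l) -
        ∑ l, pderiv l (X j * Q i l) := by
      rw [← Finset.sum_sub_distrib]
      exact Finset.sum_congr rfl fun l _ => by rw [hcoc i j l, map_sub]
    rw [sum_pderiv_mul_self (hQ j i), sum_pderiv_X_mul i, sum_pderiv_X_mul j, hanti j i] at h1
    have h2 : (Fintype.card ι : MvPolynomial ι R) * Q j i = X i * ∑ l, pderiv l (Q j l) -
        X j * ∑ l, pderiv l (Q i l) := by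
      have h3 := hanti i j
      rw [add_smul, nsmul_eq_mul, nsmul_eq_mul] at h1
      push_cast at h1
      rw [h3] at h1 ⊢
      linear_combination h1
    have h3 : C u * (Fintype.card ι : MvPolynomial ι R) = 1 := by
      rw [← map_natCast (C : R →+* MvPolynomial ι R), ← map_mul, hu, map_one]
    calc Q j i = C u * (Fintype.card ι : MvPolynomial ι R) * Q j i := by rw [h3, one_mul]
      _ = _ := by rw [mul_assoc, h2]; simp only [φ]; ring
  let a : Matrix ι ι R := fun l j => coeff 0 (pderiv l (φ j))
  have ha : ∀ l j, pderiv l (φ j) = C (a l j) := fun l j =>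
    totalDegree_eq_zero_iff_eq_C.mp (Nat.le_zero.mp (hφ j).pderiv.totalDegree_le)
  have haφ : ∀ j, aeval y (φ j) = ∑ l, algebraMap R K (a l j) * y l := by
    intro j
    have h1 := (hφ j).sum_X_mul_pderiv
    rw [one_smul] at h1
    rw [← h1, map_sum]
    exact Finset.sum_congr rfl fun l _ => by
      rw [ha, map_mul, aeval_X, mul_comm]; simp
  refine ⟨a, ?_, fun j i => ?_⟩
  · refine C_injective ι R ?_
    rw [Matrix.trace, map_sum, map_zero]
    simp only [Matrix.diag_apply, ← ha]
    simp only [φ, Derivation.leibniz, pderiv_C, add_zero, smul_eq_mul, mul_zero]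
    rw [← Finset.mul_sum]
    -- The trace is, up to the unit, a symmetric second derivative of the antisymmetric `Q`, hence
    -- zero.
    have h1 : ∑ j, pderiv j (∑ i, pderiv i (Q j i)) = - ∑ j, pderiv j (∑ i, pderiv i (Q j i)) := by
      simp only [map_sum]
      conv_lhs => rw [Finset.sum_comm]
      rw [← Finset.sum_neg_distrib]
      refine Finset.sum_congr rfl fun i _ => ?_
      rw [← Finset.sum_neg_distrib]
      refine Finset.sum_congr rfl fun j _ => ?_
      rw [pderiv_comm, hanti i j, map_neg, map_neg]
    rw [self_eq_neg.mp h1, mul_zero]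
  · rw [← hQy, hφQ, ← haφ, ← haφ, map_sub, map_mul (aeval y) (X i), map_mul (aeval y) (X j), aeval_X,
      aeval_X]

/-- The difference gives linear forms with `Xᵢ ψⱼ = Xⱼ ψᵢ`, whose divergence is the trace, zero.
Summing the `i`-th partials of this identity leaves `card ι • ψⱼ = 0`. -/
theorem traceless_unique [IsDomain R] (hι : IsUnit (Fintype.card ι : R)) {a b : Matrix ι ι R}
    (ha : a.trace = 0) (hb : b.trace = 0)
    (h : ∀ j i, y i * ∑ l, algebraMap R K (a l j) * y l - y j * ∑ l, algebraMap R K (a l i) * y l =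
      y i * ∑ l, algebraMap R K (b l j) * y l - y j * ∑ l, algebraMap R K (b l i) * y l) :
    a = b := by
  classical
  let ψ : ι → MvPolynomial ι R := fun j => ∑ l, C (a l j - b l j) * X l
  have hψ : ∀ j, (ψ j).IsHomogeneous 1 := fun j =>
    IsHomogeneous.sum _ _ _ fun l _ => isHomogeneous_C_mul_X _ l
  have hψy : ∀ j, aeval y (ψ j) = ∑ l, algebraMap R K (a l j) * y l -
      ∑ l, algebraMap R K (b l j) * y l := fun j => by
    simp only [ψ, map_sum, map_mul, aeval_C, aeval_X, ← Finset.sum_sub_distrib, map_sub, sub_mul]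
  have h1 : ∀ j i, X i * ψ j = X j * ψ i := fun j i => by
    refine hy.eq_of_aeval_eq ((isHomogeneous_X R i).mul (hψ j)) ((isHomogeneous_X R j).mul (hψ i)) ?_
    rw [map_mul, map_mul, hψy, hψy, aeval_X, aeval_X]
    linear_combination h j i
  have hd : ∀ i j, pderiv i (ψ j) = C (a i j - b i j) := fun i j => by
    simp only [ψ, map_sum, Derivation.leibniz, pderiv_C, pderiv_X, add_zero,
      smul_eq_mul, Pi.single_apply, mul_ite, mul_one, mul_zero]
    simp
  have h2 : ∀ j, ψ j = 0 := by
    intro j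
    have h3 : ∑ i, pderiv i (X i * ψ j) = ∑ i, pderiv i (X j * ψ i) :=
      Finset.sum_congr rfl fun i _ => by rw [h1]
    have h4 : ∑ i, pderiv i (ψ i) = 0 := by
      simp only [hd, ← map_sum, Finset.sum_sub_distrib]
      change C (a.trace - b.trace) = 0
      rw [ha, hb]; simp
    rw [sum_pderiv_mul_self (hψ j), sum_pderiv_X_mul j, h4, mul_zero, add_zero, add_smul,
      one_smul, add_eq_right, nsmul_eq_mul] at h3
    have h5 : IsUnit (Fintype.card ι : MvPolynomial ι R) := by
      simpa using hι.map (C : R →+* MvPolynomial ι R)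
    exact (h5.mul_right_eq_zero).mp h3
  ext l j
  have h3 := hd l j
  rw [h2, map_zero] at h3
  exact sub_eq_zero.mp (C_injective ι R (h3.symm.trans (map_zero C).symm))

end IsHomogeneouslyIndependent

end ProjectiveCharts

/-! ### Group actions on points with values in rings -/

section ActionOnPoints

open TensorProduct MonoidalCategory CartesianMonoidalCategory MonObj

section General

variable {C : Type*} [Category* C] [CartesianMonoidalCategory C] {G P T T' : C} [MonObj G] [ModObj G P]

/-- The action of a `T`-point of `G` on a `T`-point of `P`. -/
def pointAct (g : T ⟶ G) (p : T ⟶ P) : T ⟶ P := lift g p ≫ γ[G, P]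

lemma comp_pointAct (h : T' ⟶ T) (g : T ⟶ G) (p : T ⟶ P) :
    h ≫ pointAct g p = pointAct (h ≫ g) (h ≫ p) := by
  rw [pointAct, pointAct, ← Category.assoc, comp_lift]

lemma one_pointAct (p : T ⟶ P) : pointAct (toUnit T ≫ η[G]) p = p := by
  have h : lift (toUnit T ≫ η[G]) p = lift (toUnit T) p ≫ (η[G] ▷ P) := by simp
  have h1 : η[G] ▷ P ≫ γ[G, P] = (λ_ P).hom := ModObj.one_smul (M := G) P
  rw [pointAct, h, Category.assoc, h1]
  simp

lemma mul_pointAct (g₁ g₂ : T ⟶ G) (p : T ⟶ P) :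
    pointAct (lift g₁ g₂ ≫ μ[G]) p = pointAct g₁ (pointAct g₂ p) := by
  have h : lift (lift g₁ g₂ ≫ μ[G]) p = lift (lift g₁ g₂) p ≫ (μ[G] ▷ P) := by simp
  have h1 : μ[G] ▷ P ≫ γ[G, P] = (α_ G G P).hom ≫ G ◁ γ[G, P] ≫ γ[G, P] := ModObj.mul_smul (M := G) P
  rw [pointAct, h, Category.assoc, h1, pointAct, pointAct]
  simp [← Category.assoc]

end General

variable {k A : Type u} [Field k] [CommRing A] [HopfAlgebra k A]
  {B C : Type u} [CommRing B] [CommRing C]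

/-- `Spec B` as a scheme over `Spec k` via `β : k → B`. -/
abbrev specOver (β : k →+* B) : Over (Spec (.of k)) := Over.mk (Spec.map (CommRingCat.ofHom β))

/-- The morphism of `k`-schemes `Spec C ⟶ Spec B` of a ring homomorphism `B → C` over `k`. -/
def specOverMap {β : k →+* B} {β' : k →+* C} (f : B →+* C) (hf : f.comp β = β') :
    specOver β' ⟶ specOver β :=
  Over.homMk (Spec.map (CommRingCat.ofHom f)) (by
    simp only [Over.mk_hom, Over.mk_left]
    rw [← Spec.map_comp, ← CommRingCat.ofHom_comp, hf])

/-- The `B`-point of the group scheme `Spec A` given by a ring homomorphism `A → B` over `k`. -/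
def groupPoint (g : A →+* B) {β : k →+* B} (hg : g.comp (algebraMap k A) = β) :
    specOver β ⟶ groupScheme k A :=
  Over.homMk (Spec.map (CommRingCat.ofHom g)) (by
    change Spec.map _ ≫ Spec.map (CommRingCat.ofHom (algebraMap k A)) = Spec.map _
    rw [← Spec.map_comp, ← CommRingCat.ofHom_comp, hg])

lemma specOverMap_left {β : k →+* B} {β' : k →+* C} (f : B →+* C) (hf : f.comp β = β') :
    (specOverMap f hf).left = Spec.map (CommRingCat.ofHom f) := rfl

lemma groupPoint_left (g : A →+* B) {β : k →+* B} (hg : g.comp (algebraMap k A) = β) :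
    (groupPoint g hg).left = Spec.map (CommRingCat.ofHom g) := rfl

lemma specOverMap_groupPoint (g : A →+* B) {β : k →+* B} (hg : g.comp (algebraMap k A) = β)
    (f : B →+* C) {β' : k →+* C} (hf : f.comp β = β') :
    specOverMap f hf ≫ groupPoint g hg =
      groupPoint (f.comp g) (by rw [RingHom.comp_assoc, hg, hf]) := by
  ext
  rw [groupPoint_left, Over.comp_left, specOverMap_left, groupPoint_left]
  exact (Spec.map_comp _ _).symm

lemma groupPoint_counit {β : k →+* B} (g : A →+* B) (hg : g.comp (algebraMap k A) = β)
    (h : g = β.comp (Bialgebra.counitAlgHom k A).toRingHom) :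
    groupPoint g hg = toUnit _ ≫ η[groupScheme k A] := by
  ext
  subst h
  have h1 : η[groupScheme k A].left =
      Spec.map (CommRingCat.ofHom (Bialgebra.counitAlgHom k A).toRingHom) := rfl
  have h2 : (toUnit (specOver β)).left = Spec.map (CommRingCat.ofHom β) := rfl
  rw [Over.comp_left, h1, h2, groupPoint_left]
  exact Spec.map_comp (CommRingCat.ofHom (Bialgebra.counitAlgHom k A).toRingHom)
    (CommRingCat.ofHom β)

lemma groupPoint_mul {β : k →+* B} (g₁ g₂ : A →+* B) (hg₁ : g₁.comp (algebraMap k A) = β)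
    (hg₂ : g₂.comp (algebraMap k A) = β) (m : A ⊗[k] A →+* B)
    (h₁ : ∀ a, m (a ⊗ₜ 1) = g₁ a) (h₂ : ∀ a, m (1 ⊗ₜ a) = g₂ a) :
    lift (groupPoint g₁ hg₁) (groupPoint g₂ hg₂) ≫ μ[groupScheme k A] =
      groupPoint (m.comp (Bialgebra.comulAlgHom k A).toRingHom) (by
        rw [← hg₁]
        ext c
        simp [← h₁, Algebra.TensorProduct.algebraMap_apply]) := by
  ext
  have h3 : μ[groupScheme k A].left = (pullbackSpecIso k A A).hom ≫
      Spec.map (CommRingCat.ofHom (Bialgebra.comulAlgHom k A).toRingHom) := rfl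
  have h4 : (lift (groupPoint g₁ hg₁) (groupPoint g₂ hg₂)).left =
      Spec.map (CommRingCat.ofHom m) ≫ (pullbackSpecIso k A A).inv := by
    rw [Over.lift_left]
    refine pullback.hom_ext ?_ ?_
    · refine (pullback.lift_fst _ _ _).trans ?_
      refine Eq.trans ?_ congr(Spec.map (CommRingCat.ofHom m) ≫ $((pullbackSpecIso_inv_fst k A A).symm))
      have e : Spec.map (CommRingCat.ofHom g₁) = Spec.map (CommRingCat.ofHom m) ≫
          Spec.map (CommRingCat.ofHom Algebra.TensorProduct.includeLeftRingHom) := by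
        rw [← Spec.map_comp]
        congr 1
        ext a
        exact (h₁ a).symm
      exact e
    · refine (pullback.lift_snd _ _ _).trans ?_
      refine Eq.trans ?_ congr(Spec.map (CommRingCat.ofHom m) ≫ $((pullbackSpecIso_inv_snd k A A).symm))
      have e : Spec.map (CommRingCat.ofHom g₂) = Spec.map (CommRingCat.ofHom m) ≫
          Spec.map (CommRingCat.ofHom (Algebra.TensorProduct.includeRight : A →ₐ[k] A ⊗[k] A).toRingHom) := by
        rw [← Spec.map_comp]
        congr 1
        ext a
        exact (h₂ a).symm
      exact e
  have e : (Spec.map (CommRingCat.ofHom m) ≫ (pullbackSpecIso k A A).inv) ≫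
      (pullbackSpecIso k A A).hom ≫
      Spec.map (CommRingCat.ofHom (Bialgebra.comulAlgHom k A).toRingHom) =
      Spec.map (CommRingCat.ofHom (m.comp (Bialgebra.comulAlgHom k A).toRingHom)) := by
    rw [Category.assoc, Iso.inv_hom_id_assoc, ← Spec.map_comp]
    rfl
  rw [Over.comp_left, h3, h4]
  exact e

end ActionOnPoints

/-! ### From a vector group structure to an action of 𝔾ₐⁿ on points -/

section VectorActions

open TensorProduct MonoidalCategory CartesianMonoidalCategory MonObj

section SpecOver

variable {k : Type u} [Field k] {B C : Type u} [CommRing B] [CommRing C]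

lemma specOverMap_surjective {β : k →+* B} {β' : k →+* C} (m : specOver β' ⟶ specOver β) :
    ∃ (f : B →+* C) (hf : f.comp β = β'), specOverMap f hf = m := by
  have h1 : Spec.map (CommRingCat.ofHom (Spec.preimage m.left).hom) = m.left :=
    Spec.map_preimage m.left
  refine ⟨(Spec.preimage m.left).hom, ?_, ?_⟩
  · have h2 : m.left ≫ Spec.map (CommRingCat.ofHom β) = Spec.map (CommRingCat.ofHom β') := Over.w m
    rw [← h1, ← Spec.map_comp] at h2
    exact congr(($(Spec.map_injective h2)).hom)
  · ext
    exact h1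

lemma specOverMap_injective {β : k →+* B} {β' : k →+* C} {f g : B →+* C} {hf : f.comp β = β'}
    {hg : g.comp β = β'} (h : specOverMap f hf = specOverMap g hg) : f = g := by
  have h1 : Spec.map (CommRingCat.ofHom f) = Spec.map (CommRingCat.ofHom g) := congr(($h).left)
  exact congr(($(Spec.map_injective h1)).hom)

lemma specOverMap_comp {D : Type u} [CommRing D] {β : k →+* B} {β' : k →+* C} {β'' : k →+* D}
    (f : B →+* C) (hf : f.comp β = β') (g : C →+* D) (hg : g.comp β' = β'') :
    specOverMap g hg ≫ specOverMap f hf =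
      specOverMap (g.comp f) (by rw [RingHom.comp_assoc, hf, hg]) := by
  ext
  exact (Spec.map_comp (CommRingCat.ofHom f) (CommRingCat.ofHom g)).symm

lemma specOverMap_id (β : k →+* B) : specOverMap (RingHom.id B) (by simp) = 𝟙 (specOver β) := by
  ext
  exact Spec.map_id (.of B)

lemma groupPoint_surjective {A : Type u} [CommRing A] [HopfAlgebra k A] {β : k →+* B}
    (m : specOver β ⟶ groupScheme k A) :
    ∃ (g : A →+* B) (hg : g.comp (algebraMap k A) = β), groupPoint g hg = m := by
  have h1 : Spec.map (CommRingCat.ofHom (Spec.preimage m.left).hom) = m.left :=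
    Spec.map_preimage m.left
  refine ⟨(Spec.preimage m.left).hom, ?_, ?_⟩
  · have h2 : m.left ≫ Spec.map (CommRingCat.ofHom (algebraMap k A)) =
      Spec.map (CommRingCat.ofHom β) := Over.w m
    rw [← h1] at h2
    have h3 := (Spec.map_comp (CommRingCat.ofHom (algebraMap k A))
      (CommRingCat.ofHom (Spec.preimage m.left).hom)).trans h2
    exact congr(($(Spec.map_injective h3)).hom)
  · ext
    exact h1

/-- Morphisms of `k`-schemes agree if they agree on points with values in rings. -/
lemma over_hom_ext {Y Z : Over (Spec (.of k))} {f g : Y ⟶ Z}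
    (h : ∀ {B : Type u} [CommRing B] {β : k →+* B} (m : specOver β ⟶ Y), m ≫ f = m ≫ g) : f = g := by
  refine Over.OverMorphism.ext (Y.left.affineCover.hom_ext _ _ fun i => ?_)
  have h1 : Spec.map (CommRingCat.ofHom (Spec.preimage (Y.left.affineCover.f i ≫ Y.hom)).hom) =
      Y.left.affineCover.f i ≫ Y.hom := Spec.map_preimage _
  exact congr(($(h (Over.homMk (Y.left.affineCover.f i) h1.symm :
    specOver (Spec.preimage (Y.left.affineCover.f i ≫ Y.hom)).hom ⟶ Y))).left)

end SpecOver

variable (k : Type u) [Field k] (n : ℕ) (P : Over (Spec (.of k)))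

/-- An action of the additive group `𝔾ₐⁿ` on the `k`-scheme `P`, in terms of points with values in
rings. -/
structure VectorAction where
  /-- The action of a vector with coordinates in `B` on a `B`-valued point. -/
  act {B : Type u} [CommRing B] {β : k →+* B} (b : Fin n → B) (p : specOver β ⟶ P) : specOver β ⟶ P
  map_act {B C : Type u} [CommRing B] [CommRing C] {β : k →+* B} {β' : k →+* C} (f : B →+* C)
    (hf : f.comp β = β') (b : Fin n → B) (p : specOver β ⟶ P) :
    specOverMap f hf ≫ act b p = act (fun i => f (b i)) (specOverMap f hf ≫ p)
  zero_act {B : Type u} [CommRing B] {β : k →+* B} (p : specOver β ⟶ P) : act (fun _ => 0) p = p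
  add_act {B : Type u} [CommRing B] {β : k →+* B} (b b' : Fin n → B) (p : specOver β ⟶ P) :
    act (fun i => b i + b' i) p = act b (act b' p)

variable {k n P}

/-- The action is infinitesimally faithful: no nonzero tangent vector acts trivially. -/
def VectorAction.IsFaithful (a : VectorAction k n P) : Prop :=
  ∀ c : Fin n → k, (∀ (B : Type u) [CommRing B] (f : DualNumber k →+* B)
    (p : specOver (f.comp (TrivSqZeroExt.inlHom k k)) ⟶ P),
    a.act (fun i => f (TrivSqZeroExt.inr (c i))) p = p) → c = 0

/-- The open set `V` is an orbit: field-valued points of `V` are conjugate after a field extension.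
-/
def VectorAction.IsTransitiveOn (a : VectorAction k n P) (V : P.left.Opens) : Prop :=
  ∀ (Ω : Type u) [Field Ω] (β : k →+* Ω) (p₁ p₂ : specOver β ⟶ P),
    (∀ x, p₁.left x ∈ V) → (∀ x, p₂.left x ∈ V) →
    ∃ (Ω' : Type u) (_ : Field Ω') (j : Ω →+* Ω') (b : Fin n → Ω'),
      a.act b (specOverMap j rfl ≫ p₂) = specOverMap j rfl ≫ p₁

section Coordinates

variable {A : Type u} [CommRing A] [HopfAlgebra k A] {x : Fin n → A}

/-- The ring homomorphism out of a polynomial Hopf algebra with prescribed values of the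
coordinates. -/
def coordHom (hx : Function.Bijective (MvPolynomial.aeval (R := k) x)) {B : Type u} [CommRing B]
    (β : k →+* B) (b : Fin n → B) : A →+* B :=
  (MvPolynomial.eval₂Hom β b).comp
    (AlgEquiv.ofBijective (MvPolynomial.aeval (R := k) x) hx).symm.toRingEquiv.toRingHom

variable (hx : Function.Bijective (MvPolynomial.aeval (R := k) x)) {B : Type u} [CommRing B]

lemma coordHom_aeval (β : k →+* B) (b : Fin n → B) (F : MvPolynomial (Fin n) k) :
    coordHom hx β b (MvPolynomial.aeval x F) = MvPolynomial.eval₂ β b F := by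
  change MvPolynomial.eval₂ β b ((AlgEquiv.ofBijective (MvPolynomial.aeval (R := k) x) hx).symm
    (AlgEquiv.ofBijective (MvPolynomial.aeval (R := k) x) hx F)) = _
  rw [AlgEquiv.symm_apply_apply]

@[simp] lemma coordHom_x (β : k →+* B) (b : Fin n → B) (i : Fin n) :
    coordHom hx β b (x i) = b i := by
  simpa using coordHom_aeval hx β b (MvPolynomial.X i)

lemma coordHom_comp_algebraMap (β : k →+* B) (b : Fin n → B) :
    (coordHom hx β b).comp (algebraMap k A) = β := by
  ext c
  simpa using coordHom_aeval hx β b (MvPolynomial.C c)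

include hx in
lemma hom_ext_of_coordinates {f g : A →+* B} (h₁ : f.comp (algebraMap k A) = g.comp (algebraMap k A))
    (h₂ : ∀ i, f (x i) = g (x i)) : f = g := by
  ext a
  obtain ⟨F, rfl⟩ := hx.2 a
  induction F using MvPolynomial.induction_on with
  | C c => simpa using congr($h₁ c)
  | add p q hp hq => simp only [map_add, hp, hq]
  | mul_X p i hp => simp only [map_mul, hp, MvPolynomial.aeval_X, h₂]

end Coordinates

/-- The action of `𝔾ₐⁿ` defined by the action of a vector group with additive coordinates `x`. -/
def vectorActionOfModObj {A : Type u} [CommRing A] [HopfAlgebra k A] (x : Fin n → A)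
    (hprim : ∀ i, UnipotentHopf.IsPrimitive k (x i))
    (hx : Function.Bijective (MvPolynomial.aeval (R := k) x)) [ModObj (groupScheme k A) P] :
    VectorAction k n P where
  act {B _ β} b p := pointAct (groupPoint (coordHom hx β b) (coordHom_comp_algebraMap hx β b)) p
  map_act {B C _ _ β β'} f hf b p := by
    rw [comp_pointAct, specOverMap_groupPoint]
    congr 2
    refine hom_ext_of_coordinates hx ?_ fun i => by simp
    rw [RingHom.comp_assoc, coordHom_comp_algebraMap, coordHom_comp_algebraMap, hf]
  zero_act {B _ β} p := by
    rw [groupPoint_counit, one_pointAct]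
    refine hom_ext_of_coordinates hx ?_ fun i => ?_
    · rw [coordHom_comp_algebraMap]
      ext c
      simp
    · have := (hprim i).counit_eq_zero
      simp [this]
  add_act {B _ β} b b' p := by
    rw [← mul_pointAct]
    let := β.toAlgebra
    let g₁ : A →ₐ[k] B := { coordHom hx β b with
      commutes' := fun c => congr($(coordHom_comp_algebraMap hx β b) c) }
    let g₂ : A →ₐ[k] B := { coordHom hx β b' with
      commutes' := fun c => congr($(coordHom_comp_algebraMap hx β b') c) }
    have h₁ : ∀ a, g₁ a = coordHom hx β b a := fun a => rfl
    have h₂ : ∀ a, g₂ a = coordHom hx β b' a := fun a => rfl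
    rw [groupPoint_mul _ _ _ _ (Algebra.TensorProduct.lift g₁ g₂ fun _ _ => .all _ _).toRingHom
      (fun a => by simp [h₁]) (fun a => by simp [h₂])]
    congr 2
    refine hom_ext_of_coordinates hx ?_ fun i => ?_
    · rw [coordHom_comp_algebraMap]
      ext c
      simp
      rfl
    · have := hprim i
      simp only [UnipotentHopf.IsPrimitive] at this
      simp [this, h₁, h₂]

/-- A tangent vector `c` is a `k[ε]`-point of the group. If it acts trivially on all points over
`k[ε]`, effectiveness makes it neutral, and the `ε`-parts of its coordinates are the `c i`. -/
lemma isFaithful_vectorActionOfModObj {A : Type u} [CommRing A] [HopfAlgebra k A] (x : Fin n → A)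
    (hprim : ∀ i, UnipotentHopf.IsPrimitive k (x i))
    (hx : Function.Bijective (MvPolynomial.aeval (R := k) x)) [ModObj (groupScheme k A) P]
    (heff : IsEffectiveAction (groupScheme k A) P) :
    (vectorActionOfModObj (P := P) x hprim hx).IsFaithful := by
  intro c hc
  let β₀ : k →+* DualNumber k := TrivSqZeroExt.inlHom k k
  let g₀ : A →+* DualNumber k := coordHom hx β₀ fun i => TrivSqZeroExt.inr (c i)
  have hg₀ : g₀.comp (algebraMap k A) = β₀ := coordHom_comp_algebraMap hx _ _
  have h1 := heff (specOver β₀) (groupPoint g₀ hg₀) (by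
    refine over_hom_ext fun {B _ β} m => ?_
    obtain ⟨f, hf, hfm⟩ := specOverMap_surjective (m ≫ fst (specOver β₀) P)
    subst hf
    have e₁ : m ≫ groupPoint g₀ hg₀ ▷ P = lift (specOverMap f rfl ≫ groupPoint g₀ hg₀)
        (m ≫ snd _ _) := by
      rw [hfm]
      refine CartesianMonoidalCategory.hom_ext _ _ ?_ ?_ <;> simp
    have e₂ := hc B f (m ≫ snd _ _)
    rw [← Category.assoc, e₁, specOverMap_groupPoint]
    refine Eq.trans ?_ e₂
    change pointAct _ _ = pointAct _ _
    congr 2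
    refine hom_ext_of_coordinates hx ?_ fun i => by simp [g₀]
    rw [RingHom.comp_assoc, coordHom_comp_algebraMap, coordHom_comp_algebraMap])
  have h2 := groupPoint_counit (β₀.comp (Bialgebra.counitAlgHom k A).toRingHom) (β := β₀) (by
    ext c <;> simp) rfl
  have h3 : Spec.map (CommRingCat.ofHom g₀) =
    Spec.map (CommRingCat.ofHom (β₀.comp (Bialgebra.counitAlgHom k A).toRingHom)) :=
    congr(($(h1.trans h2.symm)).left)
  have h4 : g₀ = _ := congr(($(Spec.map_injective h3)).hom)
  funext i
  have h5 := congr((($h4 (x i)) : DualNumber k).snd)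
  simpa [g₀, β₀] using h5

/-- The pair `(p₁, p₂)` is a point of `P × P` over `V`, so it meets the image of the action graph. A
point of the fibre product over `Spec Ω` gives, in its residue field, a group element moving `p₂` to
`p₁`. -/
lemma isTransitiveOn_vectorActionOfModObj {A : Type u} [CommRing A] [HopfAlgebra k A]
    (x : Fin n → A) (hprim : ∀ i, UnipotentHopf.IsPrimitive k (x i))
    (hx : Function.Bijective (MvPolynomial.aeval (R := k) x)) [ModObj (groupScheme k A) P]
    {V : P.left.Opens} (hV : IsOpenOrbit (groupScheme k A) P V) :
    (vectorActionOfModObj (P := P) x hprim hx).IsTransitiveOn V := by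
  intro Ω _ β p₁ p₂ h₁ h₂
  let t : Spec (.of Ω) := IsLocalRing.closedPoint Ω
  let z : specOver β ⟶ P ⊗ P := lift p₁ p₂
  have hz₁ : (fst P P).left (z.left t) = p₁.left t := by
    rw [← Scheme.Hom.comp_apply, ← Over.comp_left, lift_fst]
  have hz₂ : (snd P P).left (z.left t) = p₂.left t := by
    rw [← Scheme.Hom.comp_apply, ← Over.comp_left, lift_snd]
  obtain ⟨y, hy⟩ := (hV.2 (z.left t) (hz₂ ▸ h₂ t)).mpr (hz₁ ▸ h₁ t)
  obtain ⟨w, hw₁, hw₂⟩ := Scheme.Pullback.exists_preimage_pullback y t hy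
  let Y := pullback (actionGraph (groupScheme k A) P).left z.left
  let Ω' := Y.residueField w
  let q : Spec Ω' ⟶ Y := Y.fromSpecResidueField w
  let jm : Spec Ω' ⟶ Spec (.of Ω) := q ≫ pullback.snd _ _
  let j : Ω →+* Ω' := (Spec.preimage jm).hom
  have hj : Spec.map (CommRingCat.ofHom j) = jm := Spec.map_preimage jm
  have hq : (q ≫ pullback.fst _ _) ≫ (actionGraph (groupScheme k A) P).left = jm ≫ z.left := by
    simp only [jm, Category.assoc, pullback.condition]
  let y' : specOver (j.comp β) ⟶ groupScheme k A ⊗ P := Over.homMk (q ≫ pullback.fst _ _) (by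
    rw [← Over.w (actionGraph (groupScheme k A) P), ← Category.assoc, hq, ← hj, Category.assoc,
      Over.w z]
    exact (Spec.map_comp _ _).symm)
  have hy' : y' ≫ actionGraph (groupScheme k A) P = specOverMap j rfl ≫ z := by
    refine Over.OverMorphism.ext (hq.trans ?_)
    rw [← hj]
    rfl
  have e₁ : y' ≫ γ[groupScheme k A, P] = specOverMap j rfl ≫ p₁ := by
    have := congr($hy' ≫ fst P P)
    simpa [actionGraph, z] using this
  have e₂ : y' ≫ snd (groupScheme k A) P = specOverMap j rfl ≫ p₂ := by
    have := congr($hy' ≫ snd P P)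
    simpa [actionGraph, z] using this
  obtain ⟨g, hg, hgy⟩ := groupPoint_surjective (y' ≫ fst (groupScheme k A) P)
  refine ⟨Ω', inferInstance, j, fun i => g (x i), ?_⟩
  have e₃ : groupPoint (coordHom hx (j.comp β) fun i => g (x i))
      (coordHom_comp_algebraMap hx _ _) = y' ≫ fst (groupScheme k A) P := by
    rw [← hgy]
    congr 1
    refine hom_ext_of_coordinates hx ?_ fun i => by simp
    rw [coordHom_comp_algebraMap, hg]
  change pointAct (groupPoint (coordHom hx (j.comp β) fun i => g (x i)) _) _ = _
  rw [e₃, ← e₂, ← e₁, ← comp_pointAct, pointAct]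
  simp

/-- A vector group structure gives a faithful action of some `𝔾ₐⁿ` with a dense open orbit. -/
theorem AdmitsVectorGroupStructure.exists_vectorAction [CharZero k]
    (h : AdmitsVectorGroupStructure k P) :
    ∃ (n : ℕ) (a : VectorAction k n P) (V : P.left.Opens), a.IsFaithful ∧
      Dense (V : Set P.left) ∧ a.IsTransitiveOn V := by
  obtain ⟨A, _, _, hA, _, heff, V, hV, horb⟩ := h
  obtain ⟨n, x, hprim, hx⟩ := UnipotentHopf.exists_primitive_coordinates hA
  exact ⟨n, vectorActionOfModObj x hprim hx, V, isFaithful_vectorActionOfModObj x hprim hx heff, hV,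
    isTransitiveOn_vectorActionOfModObj x hprim hx horb⟩

end VectorActions

/-! ### Charts and points specializing to the generic point -/

section GenericOrbit

variable {k : Type u} [Field k] {n : ℕ} {P : Over (Spec (.of k))}

lemma specOverMap_congr {B C : Type u} [CommRing B] [CommRing C] {β : k →+* B} {β' : k →+* C}
    {f g : B →+* C} (h : f = g) (hf : f.comp β = β') :
    specOverMap f hf = specOverMap g (h ▸ hf) := by
  subst h; rfl

section Lifting

variable {S C : Type u} [CommRing S] [CommRing C] {β : k →+* S} {β' : k →+* C}

lemma exists_specOverMap_comp_eq (j : specOver β ⟶ P) [IsOpenImmersion j.left]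
    (q : specOver β' ⟶ P) (h : ∀ x, q.left x ∈ Set.range j.left) :
    ∃ (f : S →+* C) (hf : f.comp β = β'), specOverMap f hf ≫ j = q := by
  have h1 : Set.range q.left ⊆ Set.range j.left := by rintro _ ⟨x, rfl⟩; exact h x
  let l : Spec (.of C) ⟶ Spec (.of S) := IsOpenImmersion.lift j.left q.left h1
  have hl : l ≫ j.left = q.left := IsOpenImmersion.lift_fac _ _ _
  let m : specOver β' ⟶ specOver β := Over.homMk l (by
    rw [← Over.w j, ← Category.assoc, hl, Over.w q])
  obtain ⟨f, hf, hfm⟩ := specOverMap_surjective m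
  refine ⟨f, hf, ?_⟩
  rw [hfm]
  exact Over.OverMorphism.ext hl

lemma eq_of_specOverMap_comp_eq (j : specOver β ⟶ P) [IsOpenImmersion j.left] {f g : S →+* C}
    {hf : f.comp β = β'} {hg : g.comp β = β'}
    (h : specOverMap f hf ≫ j = specOverMap g hg ≫ j) : f = g := by
  refine specOverMap_injective (hf := hf) (hg := hg) (Over.OverMorphism.ext ?_)
  rw [← cancel_mono j.left]
  exact congr(($h).left)

end Lifting

/-- An affine open chart of `P`, together with the embedding of its coordinate ring in the field of
rational functions `K`. -/
structure IsFieldChart {K : Type u} [Field K] (ζ : Spec (.of K) ⟶ P.left) {S : Type u} [CommRing S]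
    (j : Spec (.of S) ⟶ P.left) (κ : S →+* K) : Prop where
  isOpenImmersion : IsOpenImmersion j
  fac : Spec.map (CommRingCat.ofHom κ) ≫ j = ζ

lemma IsFieldChart.exists_over {K : Type u} [Field K] [Algebra k K]
    {ζ : specOver (algebraMap k K) ⟶ P} {S : Type u} [CommRing S] {j : Spec (.of S) ⟶ P.left}
    {κ : S →+* K} (h : IsFieldChart ζ.left j κ) :
    ∃ (β : k →+* S) (j' : specOver β ⟶ P) (hκ : κ.comp β = algebraMap k K),
      j'.left = j ∧ specOverMap κ hκ ≫ j' = ζ := by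
  let β : k →+* S := (Spec.preimage (j ≫ P.hom)).hom
  have hβ : Spec.map (CommRingCat.ofHom β) = j ≫ P.hom := Spec.map_preimage _
  let j' : specOver β ⟶ P := Over.homMk j hβ.symm
  have h1 : Spec.map (CommRingCat.ofHom κ) ≫ Spec.map (CommRingCat.ofHom β) =
      Spec.map (CommRingCat.ofHom (algebraMap k K)) := by
    rw [hβ, ← Category.assoc, h.fac]
    exact Over.w ζ
  rw [← Spec.map_comp] at h1
  exact ⟨β, j', congr(($(Spec.map_injective h1)).hom), rfl, Over.OverMorphism.ext h.fac⟩

/-- The derivation `D` of `K` preserves the coordinate rings of all affine charts of `P`. -/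
def PreservesCharts {K : Type u} [Field K] (ζ : Spec (.of K) ⟶ P.left) (D : K → K) : Prop :=
  ∀ (S : Type u) [CommRing S] (j : Spec (.of S) ⟶ P.left) (κ : S →+* K), IsFieldChart ζ j κ →
    ∀ s, ∃ s', D (κ s) = κ s'

section GenericPoint

variable {S₀ K : Type u} [CommRing S₀] [Field K] [Algebra S₀ K] [IsFractionRing S₀ K] [Algebra k K]
  {β₀ : k →+* S₀} (h₀ : (algebraMap S₀ K).comp β₀ = algebraMap k K) (j₀ : specOver β₀ ⟶ P)
  [IsOpenImmersion j₀.left]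

include h₀ in
lemma eq_of_comp_genericPoint_eq {C : Type u} [CommRing C] {β' : k →+* C} {f g : K →+* C}
    {hf : f.comp (algebraMap k K) = β'} {hg : g.comp (algebraMap k K) = β'}
    (h : specOverMap f hf ≫ specOverMap (algebraMap S₀ K) h₀ ≫ j₀ =
      specOverMap g hg ≫ specOverMap (algebraMap S₀ K) h₀ ≫ j₀) : f = g := by
  rw [← Category.assoc, ← Category.assoc, specOverMap_comp, specOverMap_comp] at h
  exact IsLocalization.ringHom_ext (nonZeroDivisors S₀) (eq_of_specOverMap_comp_eq j₀ h)

/-- A point of `P` with values in a local ring which specializes to the generic point factors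
through the generic point. -/
lemma exists_lift_genericPoint {C Ω : Type u} [CommRing C] [IsLocalRing C] [Field Ω]
    {β' : k →+* C} {β'' : k →+* Ω}
    (q : specOver β' ⟶ P) (ev : C →+* Ω) [IsLocalHom ev] (hev : ev.comp β' = β'') (i : K →+* Ω)
    (hi : i.comp (algebraMap k K) = β'')
    (h : specOverMap ev hev ≫ q = specOverMap i hi ≫ specOverMap (algebraMap S₀ K) h₀ ≫ j₀) :
    ∃ (ρ : K →+* C) (hρ : ρ.comp (algebraMap k K) = β'),
      specOverMap ρ hρ ≫ specOverMap (algebraMap S₀ K) h₀ ≫ j₀ = q ∧ ev.comp ρ = i := by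
  have h1 : q.left (IsLocalRing.closedPoint C) ∈ Set.range j₀.left := by
    have h2 : Spec.map (CommRingCat.ofHom ev) (IsLocalRing.closedPoint Ω) =
        IsLocalRing.closedPoint C := IsLocalRing.comap_closedPoint ev
    rw [← h2]
    have h3 := congr(($h).left (IsLocalRing.closedPoint Ω))
    exact ⟨Spec.map (CommRingCat.ofHom (algebraMap S₀ K))
      (Spec.map (CommRingCat.ofHom i) (IsLocalRing.closedPoint Ω)), h3.symm⟩
  -- Every point of a local spectrum specializes to the closed point, so once the closed point lands
  -- in the open chart, all points do.
  obtain ⟨f, hf, hfq⟩ := exists_specOverMap_comp_eq j₀ q fun x =>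
    ((IsLocalRing.specializes_closedPoint x).map q.left.continuous).mem_open
      j₀.left.opensRange.2 h1
  have h2 : ev.comp f = i.comp (algebraMap S₀ K) := by
    refine eq_of_specOverMap_comp_eq (β' := β'') j₀ (hf := by rw [RingHom.comp_assoc, hf, hev])
      (hg := by rw [RingHom.comp_assoc, h₀, hi]) ?_
    rw [← specOverMap_comp f hf ev hev, ← specOverMap_comp _ h₀ i hi, Category.assoc, hfq, h,
      Category.assoc]
  -- A non-zero-divisor becomes a unit in `K`, hence in `Ω`, hence already in `C`, because `ev` is
  -- local.
  have h3 : ∀ y : nonZeroDivisors S₀, IsUnit (f y) := fun y => by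
    refine isUnit_of_map_unit ev _ ?_
    have h4 := congr($h2 y.1)
    simp only [RingHom.comp_apply] at h4
    rw [h4]
    exact (IsLocalization.map_units K y).map i
  have h5 : (IsLocalization.lift (S := K) h3).comp (algebraMap S₀ K) = f :=
    IsLocalization.lift_comp h3
  have h6 : (IsLocalization.lift (S := K) h3).comp (algebraMap k K) = β' := by
    rw [← h₀, ← RingHom.comp_assoc, h5, hf]
  refine ⟨IsLocalization.lift (S := K) h3, h6, ?_, ?_⟩
  · rw [← Category.assoc, specOverMap_comp, specOverMap_congr h5, hfq]
  · refine IsLocalization.ringHom_ext (nonZeroDivisors S₀) ?_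
    rw [RingHom.comp_assoc, h5, h2]

end GenericPoint

end GenericOrbit

/-! ### Vector fields of an infinitesimal action -/

section InfinitesimalAction

open TrivSqZeroExt

variable {k : Type u} [Field k] {n : ℕ} {P : Over (Spec (.of k))} (a : VectorAction k n P)

lemma DualNumber.mapRingHom_comp_inlHom {R S : Type*} [CommRing R] [CommRing S] (f : R →+* S) :
    (DualNumber.mapRingHom f).comp (inlHom R R) = (inlHom S S).comp f := by
  ext x <;> simp

lemma DualNumber.mapRingHom_inr {R S : Type*} [CommRing R] [CommRing S] (f : R →+* S) (x : R) :
    DualNumber.mapRingHom f (inr x) = inr (f x) := by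
  ext <;> simp

/-- The projection `R[ε] → R`. -/
def DualNumber.fstRingHom (R : Type*) [CommRing R] : DualNumber R →+* R :=
  (fstHom R R R).toRingHom

@[simp] lemma DualNumber.fstRingHom_apply {R : Type*} [CommRing R] (x : DualNumber R) :
    DualNumber.fstRingHom R x = x.fst := rfl

lemma DualNumber.fstRingHom_comp_inlHom (R : Type*) [CommRing R] :
    (DualNumber.fstRingHom R).comp (inlHom R R) = RingHom.id R := by
  ext x; simp

lemma DualNumber.specMap_fstRingHom_surjective (R : Type u) [CommRing R] :
    Function.Surjective (Spec.map (CommRingCat.ofHom (DualNumber.fstRingHom R))) := by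
  intro x
  have h1 : x ∈ Set.range (PrimeSpectrum.comap (DualNumber.fstRingHom R)) := by
    rw [range_comap_of_surjective _ _ (fun r => ⟨inl r, by simp⟩)]
    intro y hy
    have h2 : IsNilpotent y := by
      refine ⟨2, ?_⟩
      have h3 : y.fst = 0 := hy
      ext <;> simp [pow_two, h3]
    obtain ⟨m, hm⟩ := h2
    exact x.2.mem_of_pow_mem m (hm ▸ x.asIdeal.zero_mem)
  exact h1

/-- The tangent vector `c` moves a `B`-valued point infinitesimally. -/
def VectorAction.tangent {B : Type u} [CommRing B] {β : k →+* B} (c : Fin n → k)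
    (p : specOver β ⟶ P) : specOver ((inlHom B B).comp β) ⟶ P :=
  a.act (fun i => inr (β (c i))) (specOverMap (inlHom B B) rfl ≫ p)

lemma VectorAction.fst_tangent {B : Type u} [CommRing B] {β : k →+* B} (c : Fin n → k)
    (p : specOver β ⟶ P) :
    specOverMap (DualNumber.fstRingHom B) (by
      rw [← RingHom.comp_assoc, DualNumber.fstRingHom_comp_inlHom, RingHom.id_comp]) ≫
      a.tangent c p = p := by
  rw [tangent, a.map_act, ← Category.assoc, specOverMap_comp,
    specOverMap_congr (DualNumber.fstRingHom_comp_inlHom B), specOverMap_id, Category.id_comp]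
  simp only [DualNumber.fstRingHom_apply, fst_inr]
  exact a.zero_act p

lemma VectorAction.map_tangent {B C : Type u} [CommRing B] [CommRing C] {β : k →+* B} {β' : k →+* C}
    (f : B →+* C) (hf : f.comp β = β') (c : Fin n → k) (p : specOver β ⟶ P) :
    specOverMap (DualNumber.mapRingHom f) (by
      rw [← RingHom.comp_assoc, DualNumber.mapRingHom_comp_inlHom, RingHom.comp_assoc, hf]) ≫
      a.tangent c p = a.tangent c (specOverMap f hf ≫ p) := by
  subst hf
  rw [tangent, tangent, a.map_act, ← Category.assoc, ← Category.assoc, specOverMap_comp,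
    specOverMap_comp, specOverMap_congr (DualNumber.mapRingHom_comp_inlHom f)]
  simp only [DualNumber.mapRingHom_inr, RingHom.comp_apply]

/-- Thickening by `ε` adds no points, so the infinitesimal translate of a chart has its image in
that chart and is given by a ring map `S → S[ε]`. -/
lemma VectorAction.exists_tangent_chart {S : Type u} [CommRing S] {β : k →+* S} (c : Fin n → k)
    (j : specOver β ⟶ P) [IsOpenImmersion j.left] :
    ∃ (θ : S →+* DualNumber S) (hθ : θ.comp β = (inlHom S S).comp β), (∀ s, (θ s).fst = s) ∧
      specOverMap θ hθ ≫ j = a.tangent c j := by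
  have h1 : (DualNumber.fstRingHom S).comp ((inlHom S S).comp β) = β := by
    rw [← RingHom.comp_assoc, DualNumber.fstRingHom_comp_inlHom, RingHom.id_comp]
  obtain ⟨θ, hθ, h⟩ := exists_specOverMap_comp_eq j (a.tangent c j) (fun x => by
    obtain ⟨y, rfl⟩ := DualNumber.specMap_fstRingHom_surjective S x
    exact ⟨y, congr(($(a.fst_tangent c j)).left y).symm⟩)
  refine ⟨θ, hθ, ?_, h⟩
  have h2 : (DualNumber.fstRingHom S).comp θ = RingHom.id S := by
    refine eq_of_specOverMap_comp_eq (β' := β) j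
      (hf := by rw [RingHom.comp_assoc, hθ, h1]) (hg := by simp) ?_
    rw [specOverMap_id, Category.id_comp, ← specOverMap_comp θ hθ _ h1, Category.assoc, h,
      a.fst_tangent]
  exact fun s => congr($h2 s)

section Generic

variable {S₀ K : Type u} [CommRing S₀] [Field K] [Algebra S₀ K] [IsFractionRing S₀ K] [Algebra k K]
  {β₀ : k →+* S₀} (h₀ : (algebraMap S₀ K).comp β₀ = algebraMap k K) (j₀ : specOver β₀ ⟶ P)
  [IsOpenImmersion j₀.left]

/-- The generic point of a chart. -/
def genericPt : specOver (algebraMap k K) ⟶ P := specOverMap (algebraMap S₀ K) h₀ ≫ j₀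

/-- `K[ε]` is local with residue field `K`, so its point specializing to the generic point factors
through the generic point. -/
lemma VectorAction.exists_tangent_generic (c : Fin n → k) :
    ∃ (θ : K →+* DualNumber K) (hθ : θ.comp (algebraMap k K) = (inlHom K K).comp (algebraMap k K)),
      (∀ s, (θ s).fst = s) ∧ specOverMap θ hθ ≫ genericPt h₀ j₀ = a.tangent c (genericPt h₀ j₀) := by
  have : IsLocalHom (DualNumber.fstRingHom K) :=
    ⟨fun x hx => isUnit_iff_isUnit_fst.mpr hx⟩
  obtain ⟨θ, hθ, h1, h2⟩ := exists_lift_genericPoint (β'' := algebraMap k K) h₀ j₀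
    (a.tangent c (genericPt h₀ j₀))
    (DualNumber.fstRingHom K) (by
      rw [← RingHom.comp_assoc, DualNumber.fstRingHom_comp_inlHom, RingHom.id_comp])
    (RingHom.id K) (by simp) (by rw [a.fst_tangent, specOverMap_id, Category.id_comp]; rfl)
  exact ⟨θ, hθ, fun s => congr($h2 s), h1⟩

/-- The infinitesimal translation `K → K[ε]` by the tangent vector `c`. -/
def VectorAction.tangentHom (c : Fin n → k) : K →+* DualNumber K :=
  (a.exists_tangent_generic h₀ j₀ c).choose

lemma VectorAction.tangentHom_comp (c : Fin n → k) :
    (a.tangentHom h₀ j₀ c).comp (algebraMap k K) = (inlHom K K).comp (algebraMap k K) :=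
  (a.exists_tangent_generic h₀ j₀ c).choose_spec.choose

lemma VectorAction.fst_tangentHom (c : Fin n → k) (s : K) : (a.tangentHom h₀ j₀ c s).fst = s :=
  (a.exists_tangent_generic h₀ j₀ c).choose_spec.choose_spec.1 s

lemma VectorAction.specOverMap_tangentHom (c : Fin n → k) :
    specOverMap (a.tangentHom h₀ j₀ c) (a.tangentHom_comp h₀ j₀ c) ≫ genericPt h₀ j₀ =
      a.tangent c (genericPt h₀ j₀) :=
  (a.exists_tangent_generic h₀ j₀ c).choose_spec.choose_spec.2

/-- The vector field on `P` defined by the tangent vector `c`. -/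
def VectorAction.vectorField (c : Fin n → k) : Derivation k K K :=
  DualNumber.derivation (a.tangentHom h₀ j₀ c) (a.fst_tangentHom h₀ j₀ c)
    (fun x => congr($(a.tangentHom_comp h₀ j₀ c) x))

lemma VectorAction.tangentHom_chart {S : Type u} [CommRing S] {β : k →+* S} (c : Fin n → k)
    (j : specOver β ⟶ P) [IsOpenImmersion j.left] {κ : S →+* K} (hκ : κ.comp β = algebraMap k K)
    (h : specOverMap κ hκ ≫ j = genericPt h₀ j₀) {θ : S →+* DualNumber S}
    (hθ : θ.comp β = (inlHom S S).comp β) (hθj : specOverMap θ hθ ≫ j = a.tangent c j) (s : S) :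
    a.tangentHom h₀ j₀ c (κ s) = DualNumber.mapRingHom κ (θ s) := by
  have h1 : (DualNumber.mapRingHom κ).comp ((inlHom S S).comp β) =
      (inlHom K K).comp (algebraMap k K) := by
    rw [← RingHom.comp_assoc, DualNumber.mapRingHom_comp_inlHom, RingHom.comp_assoc, hκ]
  have h2 : (a.tangentHom h₀ j₀ c).comp κ = (DualNumber.mapRingHom κ).comp θ := by
    refine eq_of_specOverMap_comp_eq (β' := (inlHom K K).comp (algebraMap k K)) j
      (hf := by rw [RingHom.comp_assoc, hκ, a.tangentHom_comp])
      (hg := by rw [RingHom.comp_assoc, hθ, h1]) ?_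
    rw [← specOverMap_comp κ hκ _ (a.tangentHom_comp h₀ j₀ c), ← specOverMap_comp θ hθ _ h1,
      Category.assoc, Category.assoc, hθj, h, a.specOverMap_tangentHom, a.map_tangent κ hκ, h]
  exact congr($h2 s)

/-- On a chart the translation is already a map `S → S[ε]`; its `ε`-part is the derivative computed
inside `S`. -/
lemma VectorAction.preservesCharts_vectorField (c : Fin n → k) :
    PreservesCharts (genericPt h₀ j₀).left (a.vectorField h₀ j₀ c) := by
  intro S _ j κ hj s
  obtain ⟨β, j', hκ, rfl, h1⟩ := hj.exists_over
  have := hj.isOpenImmersion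
  obtain ⟨θ, hθ, -, h2⟩ := a.exists_tangent_chart c j'
  refine ⟨(θ s).snd, ?_⟩
  rw [vectorField, DualNumber.derivation_apply, a.tangentHom_chart h₀ j₀ c j' hκ h1 hθ h2]
  simp

/-- A homomorphism `S[ε] → C` from homomorphisms on `S` and on `k[ε]`. -/
def DualNumber.liftRingHom {S C : Type*} [CommRing S] [CommRing C] (g : S →+* C) (e : C)
    (he : e * e = 0) : DualNumber S →+* C where
  toFun x := g x.fst + g x.snd * e
  map_one' := by simp
  map_zero' := by simp
  map_add' x y := by simp; ring
  map_mul' x y := by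
    simp
    linear_combination (- g x.snd * g y.snd) * he

/-- A nonzero tangent vector of a faithful action has a nonzero vector field. -/
lemma VectorAction.IsFaithful.eq_zero_of_vectorField_eq_zero (ha : a.IsFaithful)
    (hcover : ∀ x : P.left, ∃ (S : Type u) (_ : CommRing S) (j : Spec (.of S) ⟶ P.left)
      (κ : S →+* K), IsFieldChart (genericPt h₀ j₀).left j κ ∧ Function.Injective κ ∧
      x ∈ Set.range j) {c : Fin n → k} (hc : a.vectorField h₀ j₀ c = 0) : c = 0 := by
  refine ha c fun B _ f p => Over.OverMorphism.ext (Scheme.hom_ext_of_forall _ _ fun x => ?_)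
  obtain ⟨S, _, j, κ, hj, hκinj, hx⟩ := hcover (p.left x)
  obtain ⟨β, j, hκ, rfl, h1⟩ := hj.exists_over
  have := hj.isOpenImmersion
  obtain ⟨θ, hθ, hfst, h2⟩ := a.exists_tangent_chart c j
  -- The vanishing of the derivation of `K` passes to the chart, since `κ` is injective; so the
  -- infinitesimal translation of the chart is trivial.
  have hθ' : θ = inlHom S S := by
    ext s
    · simp [hfst]
    · refine hκinj ?_
      have h3 := congr($hc (κ s))
      rw [vectorField, DualNumber.derivation_apply, a.tangentHom_chart h₀ j₀ c j hκ h1 hθ h2] at h3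
      simpa using h3
  obtain ⟨U, hU, hxU, hUV⟩ := exists_isAffineOpen_mem_and_subset (U := p.left ⁻¹ᵁ j.left.opensRange)
    (x := x) hx
  refine ⟨U, hxU, ?_⟩
  rw [← cancel_epi hU.isoSpec.inv, ← Category.assoc, ← Category.assoc]
  change hU.fromSpec ≫ _ = hU.fromSpec ≫ _
  let C := Γ(Spec (.of B), U)
  let φ : B →+* C := (Spec.preimage hU.fromSpec).hom
  have hφ : Spec.map (CommRingCat.ofHom φ) = hU.fromSpec := Spec.map_preimage _
  suffices h : specOverMap φ rfl ≫ a.act (fun i => f (inr (c i))) p = specOverMap φ rfl ≫ p by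
    have h3 := congr(($h).left)
    rw [← hφ]
    exact h3
  rw [a.map_act]
  obtain ⟨g, hg, hgj⟩ := exists_specOverMap_comp_eq j (specOverMap φ rfl ≫ p) (fun y => by
    have h3 : hU.fromSpec y ∈ U := by
      have : hU.fromSpec y ∈ Set.range hU.fromSpec := ⟨y, rfl⟩
      rwa [hU.range_fromSpec] at this
    have h4 := hUV h3
    rw [← hφ] at h4
    exact h4)
  -- The test ring `B` is any `k[ε]`-algebra. Locally the point `p` lands in a chart through `g : S
  -- → C`, and sending `ε` to `e` extends `g` to `S[ε]`, which pulls the translation back from the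
  -- universal one on the chart.
  let e : C := φ (f DualNumber.eps)
  have he : e * e = 0 := by
    rw [← map_mul, ← map_mul, DualNumber.eps_mul_eps, map_zero, map_zero]
  let G := DualNumber.liftRingHom g e he
  have hG : G.comp (inlHom S S) = g := by
    ext s
    simp [G, DualNumber.liftRingHom]
  have hG' : G.comp ((inlHom S S).comp β) = φ.comp (f.comp (inlHom k k)) := by
    rw [← RingHom.comp_assoc, hG, hg]
  have h5 : ∀ i, φ (f (inr (c i))) = G (inr (β (c i))) := fun i => by
    have h6 : (inr (c i) : DualNumber k) = inl (c i) * DualNumber.eps := by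
      ext <;> simp
    have h7 := congr($hg (c i))
    simp only [RingHom.comp_apply, inlHom_apply] at h7
    rw [h6, map_mul, map_mul, ← h7]
    simp [G, DualNumber.liftRingHom, e]
  simp only [h5]
  rw [← hgj]
  have h8 := congr(specOverMap G hG' ≫ $h2)
  rw [tangent, a.map_act, specOverMap_congr hθ', ← Category.assoc, specOverMap_comp,
    specOverMap_congr hG] at h8
  exact h8.symm

end Generic

end InfinitesimalAction

/-! ### The generic orbit map -/

section GenericOrbitMap

open TrivSqZeroExt

/-- The local ring of the affine space over `K` at the kernel of `ev`. -/
abbrev AffineLocalRing {n : ℕ} {K Ω : Type u} [Field K] [Field Ω]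
    (ev : MvPolynomial (Fin n) K →+* Ω) : Type u :=
  haveI : (RingHom.ker ev).IsPrime := RingHom.ker_isPrime ev
  Localization.AtPrime (RingHom.ker ev)

namespace AffineLocalRing

variable {n : ℕ} {K Ω : Type u} [Field K] [Field Ω] (ev : MvPolynomial (Fin n) K →+* Ω)

instance isPrime_ker : (RingHom.ker ev).IsPrime := RingHom.ker_isPrime ev

/-- The evaluation on the local ring. -/
def eval : AffineLocalRing ev →+* Ω :=
  IsLocalization.lift (M := (RingHom.ker ev).primeCompl) (g := ev)
    (fun y => isUnit_iff_ne_zero.mpr y.2)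

lemma eval_algebraMap (F : MvPolynomial (Fin n) K) :
    eval ev (algebraMap _ (AffineLocalRing ev) F) = ev F := IsLocalization.lift_eq _ _

instance isLocalHom_eval : IsLocalHom (eval ev) := by
  refine ⟨fun x hx => ?_⟩
  obtain ⟨F, s, rfl⟩ := IsLocalization.exists_mk'_eq (RingHom.ker ev).primeCompl x
  rw [eval, IsLocalization.lift_mk', isUnit_iff_ne_zero] at hx
  rw [IsLocalization.AtPrime.isUnit_mk'_iff (AffineLocalRing ev) (RingHom.ker ev)]
  exact fun h => left_ne_zero_of_mul hx h

/-- The embedding of the local ring in the field of rational functions. -/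
def incl : AffineLocalRing ev →+* RatField n K :=
  IsLocalization.lift (M := (RingHom.ker ev).primeCompl)
    (g := algebraMap (MvPolynomial (Fin n) K) (RatField n K))
    (fun y => isUnit_iff_ne_zero.mpr fun h => y.2 (by
      rw [(map_eq_zero_iff _ (IsFractionRing.injective _ (RatField n K))).mp h]
      exact (RingHom.ker ev).zero_mem))

lemma incl_algebraMap (F : MvPolynomial (Fin n) K) :
    incl ev (algebraMap _ (AffineLocalRing ev) F) = algebraMap _ _ F := IsLocalization.lift_eq _ _

lemma incl_injective : Function.Injective (incl ev) := by
  rw [injective_iff_map_eq_zero]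
  intro x hx
  obtain ⟨F, s, rfl⟩ := IsLocalization.exists_mk'_eq (RingHom.ker ev).primeCompl x
  have h1 : incl ev (IsLocalization.mk' _ F s) * incl ev (algebraMap _ _ s.1) =
      algebraMap _ (RatField n K) F := by
    rw [← map_mul, IsLocalization.mk'_spec, incl_algebraMap]
  rw [hx, zero_mul] at h1
  rw [(map_eq_zero_iff _ (IsFractionRing.injective _ (RatField n K))).mp h1.symm,
    IsLocalization.mk'_zero]

/-- The constants in the local ring. -/
def const : K →+* AffineLocalRing ev := (algebraMap (MvPolynomial (Fin n) K) (AffineLocalRing ev)).comp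
  MvPolynomial.C

lemma incl_const (x : K) : incl ev (const ev x) = algebraMap K _ x := by
  rw [const, RingHom.comp_apply, incl_algebraMap, ← MvPolynomial.algebraMap_eq,
    ← IsScalarTower.algebraMap_apply]

end AffineLocalRing

variable {k : Type u} [Field k] {n : ℕ} {P : Over (Spec (.of k))} (a : VectorAction k n P)
  {S₀ K : Type u} [CommRing S₀] [Field K] [Algebra S₀ K] [IsFractionRing S₀ K] [Algebra k K]
  {β₀ : k →+* S₀} (h₀ : (algebraMap S₀ K).comp β₀ = algebraMap k K) (j₀ : specOver β₀ ⟶ P)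
  [IsOpenImmersion j₀.left]

/-- The generic translate of the generic point. -/
def VectorAction.genericTranslate :
    specOver ((algebraMap K (RatField n K)).comp (algebraMap k K)) ⟶ P :=
  a.act (fun i => algebraMap _ (RatField n K) (MvPolynomial.X i : MvPolynomial (Fin n) K))
    (specOverMap (algebraMap K (RatField n K)) rfl ≫ genericPt h₀ j₀)

/-- `O` is the local ring of affine space over `K` at the point `b`. The translate of the generic
point by the generic vector `(X₁, …, Xₙ)` is defined over `O` and specializes at `b` to the generic
point via `i₁`, so it comes from a map `ρ' : K → O`. Over `K(x)` it is the generic translate. -/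
lemma VectorAction.exists_specialization {Ω : Type u} [Field Ω]
    (i₁ i₂ : K →+* Ω) (hi : i₁.comp (algebraMap k K) = i₂.comp (algebraMap k K)) (b : Fin n → Ω)
    (h : a.act b (specOverMap i₂ rfl ≫ genericPt h₀ j₀) = specOverMap i₁ hi ≫ genericPt h₀ j₀) :
    ∃ (O : Type u) (_ : CommRing O) (incl : O →+* RatField n K) (ev : O →+* Ω) (ρ' σ : K →+* O),
      Function.Injective incl ∧ (∀ x, incl (σ x) = algebraMap K _ x) ∧
      (∀ x, ev (σ x) = i₂ x) ∧ (∀ x, ev (ρ' x) = i₁ x) ∧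
      ∃ hρ : (incl.comp ρ').comp (algebraMap k K) =
        (algebraMap K (RatField n K)).comp (algebraMap k K),
        specOverMap (incl.comp ρ') hρ ≫ genericPt h₀ j₀ = a.genericTranslate h₀ j₀ := by
  let ev : MvPolynomial (Fin n) K →+* Ω := MvPolynomial.eval₂Hom i₂ b
  let O := AffineLocalRing ev
  let σ : K →+* O := AffineLocalRing.const ev
  have hσ : (AffineLocalRing.eval ev).comp σ = i₂ := by
    ext x
    simp only [σ, AffineLocalRing.const, RingHom.comp_apply, AffineLocalRing.eval_algebraMap]
    simp [ev]
  have hσ' : (AffineLocalRing.incl ev).comp σ = algebraMap K _ :=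
    RingHom.ext (AffineLocalRing.incl_const ev)
  let q : specOver (σ.comp (algebraMap k K)) ⟶ P :=
    a.act (fun i => algebraMap (MvPolynomial (Fin n) K) O (MvPolynomial.X i)) (specOverMap σ rfl ≫ genericPt h₀ j₀)
  have hev : (AffineLocalRing.eval ev).comp (σ.comp (algebraMap k K)) =
      i₂.comp (algebraMap k K) := by rw [← RingHom.comp_assoc, hσ]
  obtain ⟨ρ', hρ', h1, h2⟩ := exists_lift_genericPoint h₀ j₀ q (AffineLocalRing.eval ev) hev i₁ hi
    (by
      refine Eq.trans ?_ h
      rw [a.map_act, ← Category.assoc, specOverMap_comp, specOverMap_congr hσ]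
      congr 1
      funext i
      rw [AffineLocalRing.eval_algebraMap]
      simp [ev])
  have h3 : (AffineLocalRing.incl ev).comp (σ.comp (algebraMap k K)) =
      (algebraMap K (RatField n K)).comp (algebraMap k K) := by
    rw [← RingHom.comp_assoc, hσ']
  refine ⟨O, inferInstance, AffineLocalRing.incl ev, AffineLocalRing.eval ev, ρ', σ,
    AffineLocalRing.incl_injective ev, AffineLocalRing.incl_const ev, fun x => congr($hσ x),
    fun x => congr($h2 x), ?_, ?_⟩
  · rw [RingHom.comp_assoc, hρ', h3]
  · rw [← specOverMap_comp ρ' hρ' _ h3, Category.assoc, genericPt, h1, a.map_act, ← Category.assoc,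
      specOverMap_comp, specOverMap_congr hσ']
    exact congrArg (fun b => a.act b _) (funext fun i => AffineLocalRing.incl_algebraMap ev _)

/-- Specialize at the vector 0, which fixes the generic point. -/
lemma VectorAction.exists_orbitMap :
    ∃ (ρ : K →+* RatField n K)
      (hρ : ρ.comp (algebraMap k K) = (algebraMap K (RatField n K)).comp (algebraMap k K)),
      specOverMap ρ hρ ≫ genericPt h₀ j₀ = a.genericTranslate h₀ j₀ := by
  obtain ⟨O, _, incl, ev, ρ', σ, -, -, -, -, hρ, h⟩ := a.exists_specialization h₀ j₀
    (RingHom.id K) (RingHom.id K) rfl (fun _ => 0) (a.zero_act _)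
  exact ⟨_, hρ, h⟩

/-- Transitivity on `V` supplies, after a field extension, the vector `b` at which to specialize.
The resulting map into `K(x)` is `ρ`, because a map out of `K` is determined by the point it
induces. -/
lemma VectorAction.isGenericallyTransitive {V : P.left.Opens} (hV : a.IsTransitiveOn V)
    (hgen : ∀ x, (genericPt h₀ j₀).left x ∈ V) {ρ : K →+* RatField n K}
    (hρ : ρ.comp (algebraMap k K) = (algebraMap K (RatField n K)).comp (algebraMap k K))
    (h : specOverMap ρ hρ ≫ genericPt h₀ j₀ = a.genericTranslate h₀ j₀) :
    IsGenericallyTransitive k ρ := by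
  intro Ω _ i₁ i₂ hi
  obtain ⟨Ω', _, j, b, hb⟩ := hV Ω (i₂.comp (algebraMap k K)) (specOverMap i₁ hi ≫ genericPt h₀ j₀)
    (specOverMap i₂ rfl ≫ genericPt h₀ j₀) (fun x => hgen _) (fun x => hgen _)
  rw [← Category.assoc, ← Category.assoc, specOverMap_comp, specOverMap_comp] at hb
  obtain ⟨O, _, incl, ev, ρ', σ, h1, h2, h3, h4, h5, h6⟩ := a.exists_specialization h₀ j₀
    (j.comp i₁) (j.comp i₂) (by rw [RingHom.comp_assoc, hi, RingHom.comp_assoc]) b hb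
  refine ⟨Ω', inferInstance, j, O, inferInstance, incl, ev, ρ', σ, h1, h2, fun x => ?_, h3, h4⟩
  exact congr($(eq_of_comp_genericPoint_eq h₀ j₀ (h6.trans h.symm)) x)

/-- Additivity: translating `x · η` by `c ε` is the same as translating `η` by `x + c ε`. The first
computes `ρ` of the vector field, the second the shift `xᵢ ↦ xᵢ + cᵢ ε` on `K(x)`. -/
lemma VectorAction.orbitMap_vectorField {ρ : K →+* RatField n K}
    (hρ : ρ.comp (algebraMap k K) = (algebraMap K (RatField n K)).comp (algebraMap k K))
    (h : specOverMap ρ hρ ≫ genericPt h₀ j₀ = a.genericTranslate h₀ j₀) (c : Fin n → k) (x : K) :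
    ρ (a.vectorField h₀ j₀ c x) = ratDeriv (fun i => algebraMap k K (c i)) (ρ x) := by
  let c' : Fin n → K := fun i => algebraMap k K (c i)
  let M := RatField n K
  let β : k →+* M := (algebraMap K M).comp (algebraMap k K)
  have hs : (ratShift c').comp (algebraMap K M) = (inlHom M M).comp (algebraMap K M) :=
    RingHom.ext (ratShift_algebraMap c')
  have hs' : (ratShift c').comp β = (inlHom M M).comp β := by
    rw [← RingHom.comp_assoc, hs, RingHom.comp_assoc]
  have h1 : (DualNumber.mapRingHom ρ).comp ((inlHom K K).comp (algebraMap k K)) =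
      (inlHom M M).comp β := by
    rw [← RingHom.comp_assoc, DualNumber.mapRingHom_comp_inlHom, RingHom.comp_assoc, hρ]
  have h2 : (DualNumber.mapRingHom ρ).comp (a.tangentHom h₀ j₀ c) = (ratShift c').comp ρ := by
    refine eq_of_comp_genericPoint_eq h₀ j₀ (β' := (inlHom M M).comp β)
      (hf := by rw [RingHom.comp_assoc, a.tangentHom_comp, h1])
      (hg := by rw [RingHom.comp_assoc, hρ, hs']) ?_
    rw [← specOverMap_comp _ (a.tangentHom_comp h₀ j₀ c) _ h1, ← specOverMap_comp _ hρ _ hs',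
      Category.assoc, Category.assoc]
    change _ ≫ _ ≫ genericPt h₀ j₀ = _ ≫ _ ≫ genericPt h₀ j₀
    rw [a.specOverMap_tangentHom, a.map_tangent ρ hρ, h, tangent, genericTranslate, a.map_act,
      a.map_act, ← a.add_act, ← Category.assoc, ← Category.assoc, specOverMap_comp,
      specOverMap_comp, specOverMap_congr hs]
    congr 1
    funext i
    rw [ratShift_poly, polyShift_X, add_comm]
    rfl
  have h3 := congr((($h2 x) : DualNumber M).snd)
  simp only [RingHom.comp_apply, DualNumber.snd_mapRingHom] at h3
  exact h3

/-- If `P` has a vector group structure and its vector fields preserve a field `L` of rational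
functions over which `P` is not algebraic, then there is a nonzero vector field trivial on `L`. -/
theorem AdmitsVectorGroupStructure.exists_derivation [CharZero k] [IsDomain S₀]
    (h : AdmitsVectorGroupStructure k P)
    (hcover : ∀ x : P.left, ∃ (S : Type u) (_ : CommRing S) (j : Spec (.of S) ⟶ P.left)
      (κ : S →+* K), IsFieldChart (genericPt h₀ j₀).left j κ ∧ Function.Injective κ ∧
      x ∈ Set.range j)
    (L : IntermediateField k K)
    (hL : ∀ D : Derivation k K K, PreservesCharts (genericPt h₀ j₀).left D → ∀ x ∈ L, D x ∈ L)
    (t : K) (ht : Transcendental L t) :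
    ∃ D : Derivation k K K, D ≠ 0 ∧ PreservesCharts (genericPt h₀ j₀).left D ∧
      ∀ x ∈ L, D x = 0 := by
  obtain ⟨n, a, V, hfaith, hdense, htrans⟩ := h.exists_vectorAction
  obtain ⟨ρ, hρ, hρ'⟩ := a.exists_orbitMap h₀ j₀
  -- The dense `V` meets the chart, and the generic point specializes to every point of the chart.
  have hgen : ∀ x, (genericPt h₀ j₀).left x ∈ V := by
    intro x
    obtain ⟨_, ⟨y, rfl⟩, hv⟩ := hdense.inter_open_nonempty _ j₀.left.opensRange.2
      ⟨_, ⟨Spec.map (CommRingCat.ofHom (algebraMap S₀ K)) x, rfl⟩⟩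
    have h2 : Spec.map (CommRingCat.ofHom (algebraMap S₀ K)) x ⤳ y := by
      refine (PrimeSpectrum.le_iff_specializes _ _).mp fun s hs => ?_
      have h3 : algebraMap S₀ K s ∈ x.asIdeal := hs
      rw [(Ideal.eq_bot_or_top x.asIdeal).resolve_right x.2.ne_top, Ideal.mem_bot,
        map_eq_zero_iff _ (IsFractionRing.injective S₀ K)] at h3
      rw [h3]
      exact y.asIdeal.zero_mem
    exact (h2.map j₀.left.continuous).mem_open V.2 hv
  have h1 := a.isGenericallyTransitive h₀ j₀ htrans hgen hρ hρ'
  obtain ⟨c, hc, h2⟩ := h1.exists_eq_zero_on_intermediateField (fun x => congr($hρ x))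
    (a.vectorField h₀ j₀) (a.orbitMap_vectorField h₀ j₀ hρ hρ') L
    (fun c => hL _ (a.preservesCharts_vectorField h₀ j₀ c)) t ht
  exact ⟨a.vectorField h₀ j₀ c,
    fun h3 => hc (hfaith.eq_zero_of_vectorField_eq_zero a h₀ j₀ hcover h3),
    a.preservesCharts_vectorField h₀ j₀ c, h2⟩

end GenericOrbitMap

/-! ### Frames of locally free modules -/

namespace SheafOfModules
open Classical

variable {C : Type*} [Category C] {J : GrothendieckTopology C} {R : Sheaf J RingCat.{u}}
  [HasSheafify J AddCommGrpCat.{u}] [J.WEqualsLocallyBijective AddCommGrpCat.{u}]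

/-- The coordinate projections of a free sheaf of modules. -/
def freeProj {I : Type u} (i : I) : free (R := R) I ⟶ unit R :=
  Cofan.IsColimit.desc (isColimitFreeCofan I) (fun j ↦ if j = i then 𝟙 _ else 0)

lemma ιFree_freeProj {I : Type u} (i j : I) :
    ιFree (R := R) j ≫ freeProj i = if j = i then 𝟙 _ else 0 :=
  Cofan.IsColimit.fac (isColimitFreeCofan I) _ j

lemma sum_freeProj_ιFree {I : Type u} [Fintype I] :
    ∑ i : I, freeProj (R := R) i ≫ ιFree i = 𝟙 (free I) := by
  refine Cofan.IsColimit.hom_ext (isColimitFreeCofan I) _ _ fun j => ?_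
  have h : ιFree (R := R) j ≫ ∑ i : I, freeProj (R := R) i ≫ ιFree i = ιFree j ≫ 𝟙 (free I) := by
    rw [Preadditive.comp_sum, Finset.sum_eq_single j]
    · rw [← Category.assoc, ιFree_freeProj, if_pos rfl, Category.id_comp, Category.comp_id]
    · intro i _ hij
      rw [← Category.assoc, ιFree_freeProj, if_neg hij.symm, zero_comp]
    · simp
  exact h

variable {M : SheafOfModules.{u} R}

/-- The value of a global section at an object of the site. -/
def sectionAt (s : M.sections) (X : Cᵒᵖ) : M.val.obj X := s.val X

omit [HasSheafify J AddCommGrpCat.{u}] [J.WEqualsLocallyBijective AddCommGrpCat.{u}] in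
lemma unit_app_eq_smul (f : unit R ⟶ M) (X : Cᵒᵖ) (a : R.obj.obj X) :
    f.val.app X a = a • sectionAt (M.unitHomEquiv f) X := by
  have h := (f.val.app X).hom.map_smul a (1 : R.obj.obj X)
  refine Eq.trans ?_ h
  congr 1
  exact (mul_one a).symm

variable (σ : M.GeneratingSections) [IsIso σ.π]

/-- The coordinates of a free sheaf of modules with respect to a basis. -/
def GeneratingSections.coord (i : σ.I) : M ⟶ unit R := inv σ.π ≫ freeProj i

omit [IsIso σ.π] in
lemma GeneratingSections.ιFree_π (i : σ.I) : ιFree i ≫ σ.π = M.unitHomEquiv.symm (σ.s i) :=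
  Cofan.IsColimit.fac (isColimitFreeCofan σ.I) _ i

lemma GeneratingSections.symm_coord (i j : σ.I) :
    M.unitHomEquiv.symm (σ.s j) ≫ σ.coord i = if j = i then 𝟙 _ else 0 := by
  rw [← σ.ιFree_π, coord, Category.assoc, IsIso.hom_inv_id_assoc, ιFree_freeProj]

lemma GeneratingSections.sum_coord [Fintype σ.I] :
    ∑ i, σ.coord i ≫ M.unitHomEquiv.symm (σ.s i) = 𝟙 M := by
  simp_rw [← σ.ιFree_π, coord, Category.assoc]
  rw [← Preadditive.comp_sum]
  simp_rw [← Category.assoc (freeProj _)]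
  rw [← Preadditive.sum_comp, sum_freeProj_ιFree, Category.id_comp, IsIso.inv_hom_id]

omit [HasSheafify J AddCommGrpCat.{u}] [J.WEqualsLocallyBijective AddCommGrpCat.{u}] in
lemma sum_val_app {N : SheafOfModules.{u} R} {I : Type*} (s : Finset I) (f : I → (M ⟶ N)) (X : Cᵒᵖ)
    (m : M.val.obj X) : (∑ i ∈ s, f i).val.app X m = ∑ i ∈ s, (f i).val.app X m := by
  induction s using Finset.induction_on with
  | empty => rfl
  | insert a s ha ih =>
    rw [Finset.sum_insert ha, Finset.sum_insert ha, ← ih]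
    rfl

lemma GeneratingSections.exists_basis [Fintype σ.I] (X : Cᵒᵖ) :
    ∃ b : Module.Basis σ.I (R.obj.obj X) (M.val.obj X), ∀ i, b i = sectionAt (σ.s i) X := by
  have h1 : ∀ m : M.val.obj X,
      ∑ i, (show R.obj.obj X from (σ.coord i).val.app X m) • sectionAt (σ.s i) X = m := by
    intro m
    have h := congr(($(σ.sum_coord)).val.app X m)
    rw [sum_val_app] at h
    refine Eq.trans (Finset.sum_congr rfl fun i _ => ?_) h
    refine Eq.trans ?_ (unit_app_eq_smul (M.unitHomEquiv.symm (σ.s i)) X _).symm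
    rw [Equiv.apply_symm_apply]
    rfl
  have h2 : ∀ i j, (show R.obj.obj X from (σ.coord i).val.app X (sectionAt (σ.s j) X)) =
      if j = i then 1 else 0 := by
    intro i j
    have h := congr((unitHomEquiv _ $(σ.symm_coord i j)).val X)
    rw [unitHomEquiv_comp_apply, Equiv.apply_symm_apply] at h
    refine Eq.trans h ?_
    split_ifs <;> rfl
  refine ⟨Module.Basis.ofEquivFun
    ⟨⟨⟨fun m i => (show R.obj.obj X from (σ.coord i).val.app X m), ?_⟩, ?_⟩, fun a => ∑ i, a i • sectionAt (σ.s i) X, ?_, ?_⟩, ?_⟩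
  · intro x y; ext i; exact ((σ.coord i).val.app X).hom.map_add x y
  · intro a x; ext i; exact ((σ.coord i).val.app X).hom.map_smul a x
  · exact h1
  · intro a
    ext i
    refine (map_sum ((σ.coord i).val.app X).hom _ _).trans ?_
    refine Eq.trans (Finset.sum_congr rfl fun j _ =>
      ((σ.coord i).val.app X).hom.map_smul (a j) _) ?_
    refine Eq.trans (Finset.sum_congr rfl fun j _ =>
      (congr(a j * $(h2 i j)) : _ = a j * if j = i then 1 else 0)) ?_
    have e : (∑ j, a j * if j = i then 1 else 0 : R.obj.obj X) = a i := by
      rw [Finset.sum_eq_single i]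
      · simp
      · intro j _ hj
        simp [hj]
      · simp
    exact e
  · intro i
    rw [Module.Basis.coe_ofEquivFun]
    change ∑ j, (Function.update (0 : σ.I → R.obj.obj X) i 1) j • sectionAt (σ.s j) X = _
    rw [Finset.sum_eq_single i]
    · simp
    · intro j _ hj
      simp [hj]
    · simp

end SheafOfModules

namespace AlgebraicGeometry.Scheme.Modules

variable {X : Scheme.{u}} {E : X.Modules} {r : ℕ}

/-- A frame of `E` on an open `N`: sections which form a basis over every smaller open. -/
def IsFrame (E : X.Modules) {N : X.Opens} (s : Fin r → Γ(E, N)) : Prop :=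
  ∀ (U : X.Opens) (hU : U ≤ N), ∃ b : Module.Basis (Fin r) Γ(X, U) Γ(E, U),
    ∀ i, b i = E.res hU (s i)

/-- The local trivialization is an isomorphism of sheaves on the opens inside `q.X i`, so its
generators restrict to a basis over every such open. -/
theorem IsLocallyFreeOfRank.exists_isFrame (h : E.IsLocallyFreeOfRank r) (x : X) :
    ∃ (N : X.Opens) (s : Fin r → Γ(E, N)), x ∈ N ∧ E.IsFrame s := by
  obtain ⟨q, hq, hc⟩ := h
  obtain ⟨V, f, ⟨i, ⟨g⟩⟩, hxV⟩ := q.coversTop ⊤ x trivial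
  obtain ⟨e⟩ := hc i
  let : Fintype (q.generators i).I := Fintype.ofEquiv _ e.symm
  refine ⟨q.X i, fun j => SheafOfModules.sectionAt ((q.generators i).s (e.symm j))
    (.op (Over.mk (𝟙 (q.X i)))), g.le hxV, fun U hU => ?_⟩
  have := hq.isIso i
  obtain ⟨b, hb⟩ := (q.generators i).exists_basis (.op (Over.mk (homOfLE hU)))
  refine ⟨(b.reindex e : Module.Basis (Fin r) Γ(X, U) Γ(E, U)), fun j => ?_⟩
  have h1 := PresheafOfModules.sections_property ((q.generators i).s (e.symm j))
    (Over.homMk (homOfLE hU) : Over.mk (homOfLE hU) ⟶ Over.mk (𝟙 (q.X i))).op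
  exact ((Module.Basis.reindex_apply b e j).trans (hb _)).trans h1.symm

end AlgebraicGeometry.Scheme.Modules

/-! ### Evaluating homogeneous coordinates at field-valued points of Proj -/

namespace AlgebraicGeometry.Proj

open HomogeneousLocalization

variable {A B : Type u} [CommRing A] [CommRing B] {σ τ : Type u} [SetLike σ A]
  [AddSubgroupClass σ A] [SetLike τ B] [AddSubgroupClass τ B]
  {𝒜 : ℕ → σ} {ℬ : ℕ → τ} [GradedRing 𝒜] [GradedRing ℬ] {K : Type u} [Field K]

/-- The evaluation of degree zero fractions `a / fⁿ` at a ring homomorphism `ev : A → K` with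
`ev f ≠ 0`. -/
def awayEval (𝒜 : ℕ → σ) [GradedRing 𝒜] (ev : A →+* K) (f : A) (hf : ev f ≠ 0) : Away 𝒜 f →+* K :=
  (IsLocalization.Away.lift (S := Localization.Away f) f (g := ev) (IsUnit.mk0 _ hf)).comp
    (algebraMap (Away 𝒜 f) (Localization.Away f))

lemma awayEval_mk (ev : A →+* K) {f : A} (hf : ev f ≠ 0) {d : ℕ} (hfd : f ∈ 𝒜 d) (n : ℕ) (a : A)
    (ha : a ∈ 𝒜 (n • d)) :
    awayEval 𝒜 ev f hf (Away.mk 𝒜 hfd n a ha) * ev f ^ n = ev a := by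
  have h1 : Localization.mk a (⟨f ^ n, n, rfl⟩ : Submonoid.powers f) *
      algebraMap A (Localization.Away f) (f ^ n) = algebraMap A (Localization.Away f) a := by
    rw [Localization.mk_eq_mk']
    exact IsLocalization.mk'_spec (M := Submonoid.powers f) (Localization.Away f) a ⟨f ^ n, n, rfl⟩
  have h2 := congr(IsLocalization.Away.lift (S := Localization.Away f) f (g := ev)
    (IsUnit.mk0 _ hf) $h1)
  rw [map_mul, IsLocalization.Away.lift_eq, IsLocalization.Away.lift_eq, map_pow] at h2
  exact h2

lemma ringHom_ext_away {f : A} {d : ℕ} (hfd : f ∈ 𝒜 d) {C : Type*} [CommRing C]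
    {φ ψ : Away 𝒜 f →+* C}
    (h : ∀ n a ha, φ (Away.mk 𝒜 hfd n a ha) = ψ (Away.mk 𝒜 hfd n a ha)) : φ = ψ := by
  refine RingHom.ext fun z => ?_
  obtain ⟨n, a, ha, rfl⟩ := Away.mk_surjective 𝒜 hfd z
  exact h n a ha

/-- The `K`-valued point of `Proj 𝒜` with homogeneous coordinates given by `ev : A → K`. -/
def evalPt (𝒜 : ℕ → σ) [GradedRing 𝒜] (ev : A →+* K) {f : A} (hf : ev f ≠ 0) {d : ℕ}
    (hfd : f ∈ 𝒜 d) (hd : 0 < d) : Spec (.of K) ⟶ Proj 𝒜 :=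
  Spec.map (CommRingCat.ofHom (awayEval 𝒜 ev f hf)) ≫ awayι 𝒜 f hfd hd

lemma evalPt_mul (ev : A →+* K) {f g : A} (hf : ev f ≠ 0) {d e : ℕ}
    (hfd : f ∈ 𝒜 d) (hd : 0 < d) (hge : g ∈ 𝒜 e) (hfg : ev (f * g) ≠ 0) :
    evalPt 𝒜 ev hfg (SetLike.mul_mem_graded hfd hge) (by omega) = evalPt 𝒜 ev hf hfd hd := by
  rw [evalPt, evalPt, ← SpecMap_awayMap_awayι 𝒜 hfd hd hge rfl, ← Category.assoc, ← Spec.map_comp]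
  congr 2
  ext1
  refine ringHom_ext_away hfd fun n a ha => ?_
  refine mul_right_cancel₀ (pow_ne_zero n hf) ?_
  refine Eq.trans ?_ (awayEval_mk ev hf hfd n a ha).symm
  change awayEval 𝒜 ev (f * g) hfg (awayMap 𝒜 hge rfl _) * _ = _
  rw [awayMap_mk]
  refine mul_right_cancel₀ (pow_ne_zero n (right_ne_zero_of_mul (map_mul ev f g ▸ hfg))) ?_
  rw [mul_assoc, ← mul_pow, ← map_mul, awayEval_mk, map_mul, map_pow]

/-- Both points agree with the one computed on the common chart of `f * g`. -/
lemma evalPt_eq (ev : A →+* K) {f g : A} (hf : ev f ≠ 0) (hg : ev g ≠ 0) {d e : ℕ}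
    (hfd : f ∈ 𝒜 d) (hd : 0 < d) (hge : g ∈ 𝒜 e) (he : 0 < e) :
    evalPt 𝒜 ev hf hfd hd = evalPt 𝒜 ev hg hge he := by
  have h1 : ev (f * g) ≠ 0 := by rw [map_mul]; exact mul_ne_zero hf hg
  have h2 : ev (g * f) ≠ 0 := by rw [map_mul]; exact mul_ne_zero hg hf
  rw [← evalPt_mul ev hf hfd hd hge h1, ← evalPt_mul ev hg hge he hfd h2]
  congr 1
  · exact mul_comm f g
  · exact add_comm d e

lemma evalPt_map (g : 𝒜 →+*ᵍ ℬ)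
    (hg : HomogeneousIdeal.irrelevant ℬ ≤ (HomogeneousIdeal.irrelevant 𝒜).map g)
    (ev : A →+* K) (ev' : B →+* K) (hev : ∀ a, ev' (g a) = ev a) {f : A} (hf : ev f ≠ 0)
    (hf' : ev' (g f) ≠ 0) {d : ℕ} (hfd : f ∈ 𝒜 d) (hd : 0 < d) :
    evalPt ℬ ev' hf' (g.map_mem hfd) hd ≫ Proj.map g hg = evalPt 𝒜 ev hf hfd hd := by
  have h1 := awayι_comp_map g hg hd f hfd
  rw [evalPt, evalPt, Category.assoc]
  refine (congr(Spec.map (CommRingCat.ofHom (awayEval ℬ ev' (g f) hf')) ≫ $h1)).trans ?_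
  rw [← Category.assoc, ← Spec.map_comp]
  congr 2
  ext1
  refine ringHom_ext_away hfd fun n a ha => ?_
  refine mul_right_cancel₀ (pow_ne_zero n hf) ?_
  refine Eq.trans ?_ (awayEval_mk ev hf hfd n a ha).symm
  rw [← hev, ← hev]
  change awayEval ℬ ev' (g f) hf' (Away.map g f _) * _ = _
  rw [Away.map_mk, awayEval_mk]

end AlgebraicGeometry.Proj

namespace SymmetricAlgebra

open MvPolynomial

section Eval

variable {R M B : Type*} [CommRing R] [AddCommGroup M] [Module R M] [CommRing B]

/-- The ring homomorphism `Sym_R M → B` extending a semilinear map `M → B`. -/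
def semilinearLift (ρ : R →+* B) (ν : M →ₛₗ[ρ] B) : SymmetricAlgebra R M →+* B :=
  letI := ρ.toAlgebra
  (lift (R := R) (M := M) (A := B)
    { toFun := ν, map_add' := map_add ν, map_smul' := fun r m => ν.map_smulₛₗ r m }).toRingHom

@[simp] lemma semilinearLift_ι (ρ : R →+* B) (ν : M →ₛₗ[ρ] B) (m : M) :
    semilinearLift ρ ν (ι R M m) = ν m := by
  let := ρ.toAlgebra
  exact lift_ι_apply _ m

@[simp] lemma semilinearLift_algebraMap (ρ : R →+* B) (ν : M →ₛₗ[ρ] B) (r : R) :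
    semilinearLift ρ ν (algebraMap R _ r) = ρ r := by
  let := ρ.toAlgebra
  exact AlgHom.commutes (lift (R := R) (M := M) (A := B) _) r

end Eval

section Basis

variable {R M κ : Type*} [CommRing R] [AddCommGroup M] [Module R M] (b : Module.Basis κ R M)

lemma aeval_ι_basis_injective : Function.Injective (aeval (R := R) fun i => ι R M (b i)) := by
  have : aeval (R := R) (fun i => ι R M (b i)) = (equivMvPolynomial b).symm.toAlgHom := by
    ext i; simp
  rw [this]
  exact (equivMvPolynomial b).symm.injective

lemma aeval_mem_gradedPiece {n : ℕ} {F : MvPolynomial κ R} (hF : F.IsHomogeneous n) :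
    aeval (fun i => ι R M (b i)) F ∈ gradedPiece R M n := by
  rw [aeval_def, eval₂_eq]
  refine sum_mem fun d hd => ?_
  rw [← Algebra.smul_def]
  refine Submodule.smul_mem _ _ ?_
  have h : ∑ i ∈ d.support, d i • 1 = n := by
    have := hF (mem_support_iff.mp hd)
    simpa [Finsupp.weight_apply, Finsupp.sum] using this
  rw [← h]
  exact SetLike.prod_pow_mem_graded (gradedPiece R M) (fun _ => 1) _ _
    fun i _ => ι_mem_gradedPiece (b i)

lemma exists_aeval_of_mem_gradedPiece {n : ℕ} {a : SymmetricAlgebra R M}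
    (ha : a ∈ gradedPiece R M n) :
    ∃ F : MvPolynomial κ R, F.IsHomogeneous n ∧ aeval (fun i => ι R M (b i)) F = a := by
  have ha' : a ∈ LinearMap.range (ι R M) ^ n := ha
  induction ha' using Submodule.pow_induction_on_left' with
  | algebraMap r => exact ⟨C r, isHomogeneous_C _ _, by simp⟩
  | add x y i hx hy ihx ihy =>
    obtain ⟨F, hF, rfl⟩ := ihx hx
    obtain ⟨G, hG, rfl⟩ := ihy hy
    exact ⟨F + G, hF.add hG, by simp⟩
  | mem_mul m hm i x hx ih =>
    obtain ⟨m, rfl⟩ := hm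
    obtain ⟨F, hF, rfl⟩ := ih hx
    refine ⟨(∑ j ∈ (b.repr m).support, C (b.repr m j) * X j) * F, ?_, ?_⟩
    · rw [Nat.succ_eq_add_one, add_comm]
      refine IsHomogeneous.mul (IsHomogeneous.sum _ _ _ fun j _ => ?_) hF
      simpa using (isHomogeneous_C κ (b.repr m j)).mul (isHomogeneous_X R j)
    · rw [map_mul, map_sum]
      congr 1
      conv_rhs => rw [← b.linearCombination_repr m]
      simp [Finsupp.linearCombination_apply, Finsupp.sum, Algebra.smul_def]

end Basis

end SymmetricAlgebra

/-! ### Homogeneous independence under change of ring, frame and chart -/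

namespace IsHomogeneouslyIndependent

open MvPolynomial

variable {R F K ι : Type*} [CommRing R] [CommRing F] [Field K] [Algebra R F] [Algebra F K]
  [Algebra R K] [IsScalarTower R F K]

lemma restrictScalars (hRF : Function.Injective (algebraMap R F)) {y : ι → K}
    (hy : IsHomogeneouslyIndependent F y) : IsHomogeneouslyIndependent R y := by
  intro N G hG h
  refine map_injective _ hRF ?_
  rw [map_zero]
  refine hy N _ (hG.map _) ?_
  rwa [aeval_map_algebraMap]

/-- Clear the denominators of a homogeneous relation. -/
lemma extendScalars (S : Submonoid R) [IsLocalization S F]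
    {y : ι → K} (hy : IsHomogeneouslyIndependent R y) :
    IsHomogeneouslyIndependent F y := by
  classical
  intro N G hG h
  obtain ⟨c, hc⟩ := IsLocalization.exist_integer_multiples S G.support (fun d => G.coeff d)
  choose! a ha using hc
  let G' : MvPolynomial ι R := ∑ d ∈ G.support, monomial d (a d)
  have hG' : map (algebraMap R F) G' = algebraMap R F c • G := by
    ext d
    simp only [G', map_sum, map_monomial, coeff_sum, coeff_monomial, coeff_smul,
      Finset.sum_ite_eq', smul_eq_mul]
    split_ifs with hd
    · rw [ha d hd, Algebra.smul_def]
    · rw [notMem_support_iff.mp hd, mul_zero]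
  have h1 : G'.IsHomogeneous N := IsHomogeneous.sum _ _ _ fun d hd =>
    isHomogeneous_monomial _ (by
      rw [Finsupp.degree_eq_weight_one]
      exact hG (mem_support_iff.mp hd))
  have h2 : G' = 0 := by
    refine hy N _ h1 ?_
    rw [← aeval_map_algebraMap F, hG', map_smul, h, smul_zero]
  rw [h2, map_zero] at hG'
  have hu : IsUnit (algebraMap R F c) := IsLocalization.map_units F c
  exact (hu.smul_eq_zero.mp hG'.symm)

/-- An invertible linear substitution preserves homogeneous degree and is injective on polynomials.
-/
lemma linear_comp [Fintype ι] [DecidableEq ι] {y : ι → K} (hy : IsHomogeneouslyIndependent F y)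
    (g h : Matrix ι ι F) (hgh : g * h = 1) :
    IsHomogeneouslyIndependent F fun l => ∑ j, algebraMap F K (g j l) * y j := by
  intro N G hG h0
  have hhg : h * g = 1 := mul_eq_one_comm.mp hgh
  have h1 : aeval y (bind₁ (fun l => ∑ j, C (g j l) * X j) G) =
      aeval (fun l => ∑ j, algebraMap F K (g j l) * y j) G := by
    rw [aeval_bind₁]
    congr 2
    ext l
    simp
  have h2 : (bind₁ (fun l => ∑ j, C (g j l) * X j) G).IsHomogeneous N := by
    have := hG.eval₂ (C : F →+* MvPolynomial ι F) (fun l => ∑ j, C (g j l) * X j)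
      (fun r => isHomogeneous_C _ _) (n := 1) (fun l => IsHomogeneous.sum _ _ _ fun j _ => by
        simpa using (isHomogeneous_C ι (g j l)).mul (isHomogeneous_X F j))
    rw [one_mul] at this
    exact this
  have h3 := hy N _ h2 (h1.trans h0)
  have h4 := congr(bind₁ (fun j => ∑ l, C (h l j) * X l) $h3)
  rw [bind₁_bind₁, map_zero] at h4
  have h5 : (fun l => bind₁ (fun j => ∑ l, C (h l j) * X l) (∑ j, C (g j l) * X j :
      MvPolynomial ι F)) = X := by
    ext1 l
    simp only [map_sum, map_mul, bind₁_C_right, bind₁_X_right, Finset.mul_sum]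
    rw [Finset.sum_comm]
    have : ∀ m, ∑ j, C (g j l) * (C (h m j) * X m) = C ((h * g) m l) * (X m : MvPolynomial ι F) := by
      intro m
      rw [Matrix.mul_apply, map_sum, Finset.sum_mul]
      refine Finset.sum_congr rfl fun j _ => ?_
      rw [map_mul]
      ring
    simp only [this, hhg, Matrix.one_apply]
    simp
  rw [h5] at h4
  simpa using h4

end IsHomogeneouslyIndependent

namespace SymmetricAlgebra

open MvPolynomial HomogeneousLocalization Proj

variable {R M K : Type u} {κ : Type*} [CommRing R] [AddCommGroup M] [Module R M] [Field K]

/-- A homomorphism from the chart ring is determined by its values on `R` and on the fractions `m /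
m₀`, since `Sym M` is generated in degree one. -/
lemma awayEval_eq {m₀ : M} (ev : SymmetricAlgebra R M →+* K) (h0 : ev (ι R M m₀) = 1)
    (φ : Away (gradedPiece R M) (ι R M m₀) →+* K)
    (hr : ∀ r, φ (fromZeroRingHom _ _ (toZero R M r)) = ev (algebraMap R _ r))
    (hm : ∀ m, φ (Away.mk _ (ι_mem_gradedPiece m₀) 1 (ι R M m) (ι_mem_gradedPiece m)) =
      ev (ι R M m)) (h0' : ev (ι R M m₀) ≠ 0) :
    awayEval (gradedPiece R M) ev (ι R M m₀) h0' = φ := by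
  refine ringHom_ext_away (ι_mem_gradedPiece m₀) fun n a ha => ?_
  have h1 := awayEval_mk ev h0' (ι_mem_gradedPiece m₀) n a ha
  rw [h0, one_pow, mul_one] at h1
  rw [h1]
  have key : ∀ (n : ℕ) (a : SymmetricAlgebra R M) (ha : a ∈ LinearMap.range (ι R M) ^ n)
      (ha' : a ∈ gradedPiece R M (n • 1)),
      ev a = φ (Away.mk _ (ι_mem_gradedPiece m₀) n a ha') := by
    intro n a ha
    induction ha using Submodule.pow_induction_on_left' with
    | algebraMap r =>
      intro ha'
      rw [← hr]
      congr 1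
      ext
      simp only [Away.val_mk, pow_zero]
      rfl
    | add x y i hx hy ihx ihy =>
      intro ha'
      have hx' : x ∈ gradedPiece R M (i • 1) := by simpa [gradedPiece] using hx
      have hy' : y ∈ gradedPiece R M (i • 1) := by simpa [gradedPiece] using hy
      rw [map_add, ihx hx', ihy hy', ← map_add]
      congr 1
      ext
      simp only [Away.val_mk, val_add]
      rw [← Localization.add_mk_self]
    | mem_mul m hm' i x hx ih =>
      intro ha'
      obtain ⟨m, rfl⟩ := hm'
      have hx' : x ∈ gradedPiece R M (i • 1) := by simpa [gradedPiece] using hx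
      rw [map_mul, ih hx', ← hm, ← map_mul]
      congr 1
      ext
      simp only [Away.val_mk, val_mul]
      rw [Localization.mk_mul]
      congr 1
      ext
      simp [pow_succ']
  exact key n a (by simpa [gradedPiece] using ha) ha

variable (b : Module.Basis κ R M) [Algebra R K] (ev : SymmetricAlgebra R M →+* K)

include b in
lemma ev_aeval (hev : ∀ r, ev (algebraMap R _ r) = algebraMap R K r) (F : MvPolynomial κ R) :
    ev (aeval (fun i => ι R M (b i)) F) = aeval (fun i => ev (ι R M (b i))) F := by
  rw [aeval_def, aeval_def, hom_eval₂]
  congr 1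
  ext r
  exact hev r

lemma range_awayEval (hev : ∀ r, ev (algebraMap R _ r) = algebraMap R K r) (i : κ)
    (hi : ev (ι R M (b i)) ≠ 0) :
    Set.range (awayEval (gradedPiece R M) ev (ι R M (b i)) hi) =
      chartRing R (fun j => ev (ι R M (b j))) i := by
  ext s
  constructor
  · rintro ⟨z, rfl⟩
    obtain ⟨n, a, ha, rfl⟩ := Away.mk_surjective _ (ι_mem_gradedPiece (b i)) z
    obtain ⟨F, hF, rfl⟩ := exists_aeval_of_mem_gradedPiece b ha
    refine ⟨n, F, by simpa using hF, ?_⟩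
    rw [awayEval_mk, ev_aeval b ev hev]
  · rintro ⟨N, F, hF, h⟩
    refine ⟨Away.mk _ (ι_mem_gradedPiece (b i)) N (aeval (fun i => ι R M (b i)) F)
      (by simpa using aeval_mem_gradedPiece b hF), ?_⟩
    refine mul_right_cancel₀ (pow_ne_zero N hi) ?_
    rw [awayEval_mk, ev_aeval b ev hev, h]

lemma awayEval_injective (hev : ∀ r, ev (algebraMap R _ r) = algebraMap R K r) (i : κ)
    (hi : ev (ι R M (b i)) ≠ 0)
    (hind : IsHomogeneouslyIndependent R fun j => ev (ι R M (b j))) :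
    Function.Injective (awayEval (gradedPiece R M) ev (ι R M (b i)) hi) := by
  rw [injective_iff_map_eq_zero]
  intro z hz
  obtain ⟨n, a, ha, rfl⟩ := Away.mk_surjective _ (ι_mem_gradedPiece (b i)) z
  have h1 := awayEval_mk ev hi (ι_mem_gradedPiece (b i)) n a ha
  rw [hz, zero_mul] at h1
  obtain ⟨F, hF, rfl⟩ := exists_aeval_of_mem_gradedPiece b ha
  rw [ev_aeval b ev hev] at h1
  have h2 := hind _ F hF h1.symm
  ext
  simp [Away.val_mk, h2, Localization.mk_zero]

/-- A homogeneous relation `F` of degree `N` is the vanishing of the degree-zero fraction `F / bᵢ^N`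
at the point, so injectivity makes `F` zero. -/
lemma isHomogeneouslyIndependent_of_awayEval_injective [IsDomain R]
    (hev : ∀ r, ev (algebraMap R _ r) = algebraMap R K r) (i : κ)
    (hi : ev (ι R M (b i)) ≠ 0)
    (hinj : Function.Injective (awayEval (gradedPiece R M) ev (ι R M (b i)) hi)) :
    IsHomogeneouslyIndependent R fun j => ev (ι R M (b j)) := by
  have : Module.Free R M := .of_basis b
  intro N F hF h
  refine aeval_ι_basis_injective b ?_
  rw [map_zero]
  let a := aeval (fun i => ι R M (b i)) F
  have ha : a ∈ gradedPiece R M (N • 1) := by simpa using aeval_mem_gradedPiece b hF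
  have h1 := awayEval_mk ev hi (ι_mem_gradedPiece (b i)) N a ha
  rw [ev_aeval b ev hev, h, mul_eq_zero, or_iff_left (pow_ne_zero N hi)] at h1
  have h2 := congr(HomogeneousLocalization.val $(hinj (h1.trans (map_zero _).symm)))
  rw [Away.val_mk, val_zero, Localization.mk_eq_mk', IsLocalization.mk'_eq_zero_iff] at h2
  obtain ⟨⟨_, l, rfl⟩, hl⟩ := h2
  refine (mul_eq_zero.mp hl).resolve_left (pow_ne_zero l fun h0 => hi ?_)
  rw [h0, map_zero]

lemma isDomain_away [IsDomain R] (i : κ) :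
    IsDomain (Away (gradedPiece R M) (ι R M (b i))) := by
  have : Module.Free R M := .of_basis b
  have h0 : ι R M (b i) ≠ 0 := by
    intro h
    have := aeval_ι_basis_injective b (a₁ := X i) (a₂ := 0) (by simpa using h)
    exact X_ne_zero i this
  have : IsDomain (Localization.Away (ι R M (b i))) :=
    IsLocalization.isDomain_localization (powers_le_nonZeroDivisors_of_noZeroDivisors h0)
  have h : Function.Injective (algebraMap (Away (gradedPiece R M) (ι R M (b i)))
      (Localization.Away (ι R M (b i)))) := HomogeneousLocalization.val_injective _
  exact h.isDomain _

end SymmetricAlgebra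

/-! ### Coordinates of sections in the function field -/

namespace AlgebraicGeometry.Scheme

variable (X : Scheme.{u}) [IsIntegral X]

/-- The restriction of functions to the generic point. -/
def genericGerm (U : X.Opens) (hU : genericPoint X ∈ U) : Γ(X, U) →+* X.functionField :=
  (X.presheaf.germ U (genericPoint X) hU).hom

lemma genericGerm_injective (U : X.Opens) (hU : genericPoint X ∈ U) :
    Function.Injective (X.genericGerm U hU) :=
  have : Nonempty U := ⟨⟨_, hU⟩⟩
  germToFunctionField_injective X U

lemma genericGerm_res {U V : X.Opens} (h : V ≤ U) (hV : genericPoint X ∈ V) (a : Γ(X, U)) :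
    X.genericGerm V hV (X.presheaf.map (homOfLE h).op a) = X.genericGerm U (h hV) a :=
  X.presheaf.germ_res_apply (homOfLE h) _ hV a

lemma genericPoint_mem {U : X.Opens} (hU : (U : Set X).Nonempty) : genericPoint X ∈ U :=
  (genericPoint_spec X).mem_open_set_iff U.isOpen |>.mpr (by simpa using hU)

lemma isDomain_sections {U : X.Opens} (hU : genericPoint X ∈ U) : IsDomain Γ(X, U) :=
  have : Nonempty U := ⟨⟨_, hU⟩⟩
  inferInstance

namespace Modules

variable {X} {E : X.Modules} {r : ℕ} {N : X.Opens} {s : Fin r → Γ(E, N)}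

omit [IsIntegral X] in
lemma IsFrame.restrict (hs : E.IsFrame s) {U : X.Opens} (hU : U ≤ N) :
    E.IsFrame fun i => E.res hU (s i) := by
  intro V hV
  obtain ⟨b, hb⟩ := hs V (hV.trans hU)
  exact ⟨b, fun i => by rw [hb, res_res]⟩

/-- The basis of sections given by a frame. -/
def IsFrame.basis (hs : E.IsFrame s) {U : X.Opens} (hU : U ≤ N) :
    Module.Basis (Fin r) Γ(X, U) Γ(E, U) := (hs U hU).choose

omit [IsIntegral X] in
lemma IsFrame.basis_apply (hs : E.IsFrame s) {U : X.Opens} (hU : U ≤ N) (i : Fin r) :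
    hs.basis hU i = E.res hU (s i) := (hs U hU).choose_spec i

omit [IsIntegral X] in
lemma IsFrame.repr_res (hs : E.IsFrame s) {U V : X.Opens} (hU : U ≤ N) (h : V ≤ U) (m : Γ(E, U))
    (i : Fin r) : (hs.basis (h.trans hU)).repr (E.res h m) i =
      X.presheaf.map (homOfLE h).op ((hs.basis hU).repr m i) := by
  have h1 : E.res h m = ∑ j, X.presheaf.map (homOfLE h).op ((hs.basis hU).repr m j) •
      hs.basis (h.trans hU) j := by
    conv_lhs => rw [← (hs.basis hU).sum_repr m]
    rw [map_sum]
    refine Finset.sum_congr rfl fun j _ => ?_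
    rw [LinearMap.map_smulₛₗ, hs.basis_apply, hs.basis_apply, res_res]
  rw [h1, Module.Basis.repr_sum_self]

/-- The coordinates, in the function field, of a section of `E` with respect to a frame. -/
def IsFrame.coord (hs : E.IsFrame s) (hN : genericPoint X ∈ N) (U : X.Opens)
    (hU : genericPoint X ∈ U) :
    Γ(E, U) →ₛₗ[X.genericGerm U hU] (Fin r → X.functionField) where
  toFun m i := X.genericGerm (U ⊓ N) ⟨hU, hN⟩ ((hs.basis inf_le_right).repr (E.res inf_le_left m) i)
  map_add' x y := by ext i; simp
  map_smul' a x := by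
    ext i
    rw [LinearMap.map_smulₛₗ, _root_.map_smul, Finsupp.smul_apply, smul_eq_mul, map_mul, Pi.smul_apply,
      smul_eq_mul]
    congr 1
    exact X.genericGerm_res inf_le_left ⟨hU, hN⟩ a

lemma IsFrame.coord_res (hs : E.IsFrame s) (hN : genericPoint X ∈ N) {U V : X.Opens} (h : V ≤ U)
    (hV : genericPoint X ∈ V) (m : Γ(E, U)) :
    hs.coord hN V hV (E.res h m) = hs.coord hN U (h hV) m := by
  ext i
  change X.genericGerm (V ⊓ N) ⟨hV, hN⟩ _ = X.genericGerm (U ⊓ N) ⟨h hV, hN⟩ _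
  rw [← X.genericGerm_res (inf_le_inf_right N h) ⟨hV, hN⟩, ← hs.repr_res, res_res, res_res]

lemma IsFrame.coord_of_le (hs : E.IsFrame s) (hN : genericPoint X ∈ N) {U : X.Opens} (h : U ≤ N)
    (hU : genericPoint X ∈ U) (m : Γ(E, U)) (i : Fin r) :
    hs.coord hN U hU m i = X.genericGerm U hU ((hs.basis h).repr m i) := by
  change X.genericGerm (U ⊓ N) ⟨hU, hN⟩ _ = _
  rw [← X.genericGerm_res (inf_le_left : U ⊓ N ≤ U) ⟨hU, hN⟩, ← hs.repr_res]

lemma IsFrame.coord_self (hs : E.IsFrame s) (hN : genericPoint X ∈ N) (i : Fin r) :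
    hs.coord hN N hN (s i) = Pi.single i 1 := by
  ext j
  rw [hs.coord_of_le hN le_rfl]
  have : s i = hs.basis le_rfl i := by rw [hs.basis_apply, res_self]
  rw [this, Module.Basis.repr_self, Finsupp.single_apply, Pi.single_apply]
  simp only [eq_comm (a := i)]
  split_ifs <;> simp

/-- Both frames are bases over the intersection of their opens, so the transition matrix is
invertible over the function field. -/
lemma IsFrame.exists_inverse (hs : E.IsFrame s) (hN : genericPoint X ∈ N) {N' : X.Opens}
    {s' : Fin r → Γ(E, N')} (hs' : E.IsFrame s') (hN' : genericPoint X ∈ N') :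
    ∃ h : Matrix (Fin r) (Fin r) X.functionField,
      (Matrix.of fun j l => hs.coord hN N' hN' (s' l) j) * h = 1 := by
  refine ⟨Matrix.of fun l i => hs'.coord hN' N hN (s i) l, ?_⟩
  have hW : genericPoint X ∈ N ⊓ N' := ⟨hN, hN'⟩
  ext j i
  have h1 := (hs'.basis (U := N ⊓ N') inf_le_right).sum_repr (E.res inf_le_left (s i))
  have h2 := congr(hs.coord hN _ hW $h1 j)
  rw [hs.coord_res, hs.coord_self, map_sum, Finset.sum_apply] at h2
  rw [Matrix.mul_apply, Matrix.one_apply]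
  refine Eq.trans (Eq.trans (Finset.sum_congr rfl fun l _ => ?_) h2) ?_
  · rw [LinearMap.map_smulₛₗ, hs'.basis_apply, hs.coord_res, Pi.smul_apply, smul_eq_mul, mul_comm,
      ← hs'.coord_of_le hN' inf_le_right hW, hs'.coord_res]
    rfl
  · rw [Pi.single_apply]

end Modules

end AlgebraicGeometry.Scheme

namespace SymmetricAlgebra

variable {R M : Type u} {κ : Type*} [CommRing R] [AddCommGroup M] [Module R M]

lemma iSup_basicOpen_ι_basis (b : Module.Basis κ R M) :
    ⨆ i, Proj.basicOpen (gradedPiece R M) (ι R M (b i)) = ⊤ := by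
  refine Proj.iSup_basicOpen_eq_top _ _ ((HomogeneousIdeal.toIdeal_irrelevant_le _).mpr ?_)
  have h1 : ∀ m : M, ι R M m ∈ Ideal.span (Set.range fun i => ι R M (b i)) := by
    intro m
    rw [← b.linearCombination_repr m, Finsupp.linearCombination_apply, Finsupp.sum, map_sum]
    refine sum_mem fun i _ => ?_
    rw [map_smul, Algebra.smul_def]
    exact Ideal.mul_mem_left _ _ (Ideal.subset_span ⟨i, rfl⟩)
  intro i hi x hx
  obtain ⟨j, rfl⟩ : ∃ j, i = j + 1 := ⟨i - 1, by omega⟩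
  have hx' : x ∈ LinearMap.range (ι R M) ^ (j + 1) := hx
  rw [pow_succ'] at hx'
  induction hx' using Submodule.mul_induction_on' with
  | mem_mul_mem m hm n hn =>
    obtain ⟨m, rfl⟩ := hm
    exact Ideal.mul_mem_right _ _ (h1 m)
  | add x hx₁ y hy₁ ihx ihy =>
    rw [← pow_succ'] at hx₁ hy₁
    exact add_mem (ihx hx₁) (ihy hy₁)

end SymmetricAlgebra

/-! ### Standard charts and generic points of the projective bundle -/

namespace AlgebraicGeometry.Scheme

lemma Cover.RelativeGluingData.map_cover_f {S : Scheme.{u}} {𝒰 : S.OpenCover} [Category 𝒰.I₀]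
    [𝒰.LocallyDirected] (d : Cover.RelativeGluingData 𝒰) [Small.{u} 𝒰.I₀] [Quiver.IsThin 𝒰.I₀]
    {i j : 𝒰.I₀} (hij : i ⟶ j) : d.functor.map hij ≫ d.cover.f j = d.cover.f i :=
  colimit.w d.functor hij

namespace Modules

open AffineZariskiSite SymmetricAlgebra

variable {X : Scheme.{u}} {E : X.Modules} [E.IsQuasicoherent]

variable (E) in
/-- The inclusion of `Proj (Sym Γ(E, U))` in the projective bundle. -/
def projι (U : X.AffineZariskiSite) :
    Proj (gradedPiece Γ(X, U.toOpens) Γ(E, U.toOpens)) ⟶ E.projectiveBundle :=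
  E.projGluingData.cover.f U

instance (U : X.AffineZariskiSite) : IsOpenImmersion (E.projι U) :=
  E.projGluingData.cover.map_prop U

lemma map_projι {U V : X.AffineZariskiSite} (h : V ≤ U) :
    Proj.map (gradedMap _ (E.res (toOpens_mono h))) (irrelevant_le_map _ _ (E.span_range_res h)) ≫
      E.projι U = E.projι V :=
  E.projGluingData.map_cover_f (homOfLE h)

lemma mem_range_projι {U : X.AffineZariskiSite} {z : E.projectiveBundle}
    (hz : E.projectiveBundleπ z ∈ U.toOpens) : z ∈ Set.range (E.projι U) := by
  have h := E.projGluingData.preimage_toBase_eq_range_ι U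
  have h1 : z ∈ E.projGluingData.toBase ⁻¹' (Set.range <| (directedCover X).f U) := by
    change E.projectiveBundleπ z ∈ Set.range U.toOpens.ι
    rw [Opens.range_ι]
    exact hz
  rw [h] at h1
  exact h1

/-- The standard affine charts of the projective bundle. -/
def projChart {U : X.AffineZariskiSite} {f : SymmetricAlgebra Γ(X, U.toOpens) Γ(E, U.toOpens)}
    {d : ℕ} (hf : f ∈ gradedPiece Γ(X, U.toOpens) Γ(E, U.toOpens) d) (hd : 0 < d) :
    Spec (.of (HomogeneousLocalization.Away (gradedPiece Γ(X, U.toOpens) Γ(E, U.toOpens)) f)) ⟶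
      E.projectiveBundle :=
  Proj.awayι _ f hf hd ≫ E.projι U

instance {U : X.AffineZariskiSite} {f : SymmetricAlgebra Γ(X, U.toOpens) Γ(E, U.toOpens)}
    {d : ℕ} (hf : f ∈ gradedPiece Γ(X, U.toOpens) Γ(E, U.toOpens) d) (hd : 0 < d) :
    IsOpenImmersion (projChart hf hd) := by
  unfold projChart; infer_instance

lemma exists_mem_range_projChart {U : X.AffineZariskiSite} {κ : Type*}
    (b : Module.Basis κ Γ(X, U.toOpens) Γ(E, U.toOpens)) {z : E.projectiveBundle}
    (hz : E.projectiveBundleπ z ∈ U.toOpens) :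
    ∃ i, z ∈ Set.range (projChart (E := E) (ι_mem_gradedPiece (b i)) one_pos) := by
  obtain ⟨w, rfl⟩ := mem_range_projι hz
  have hw : w ∈ ⨆ i, Proj.basicOpen (gradedPiece Γ(X, U.toOpens) Γ(E, U.toOpens)) (ι _ _ (b i)) := by
    rw [iSup_basicOpen_ι_basis]; trivial
  obtain ⟨i, hi⟩ := TopologicalSpace.Opens.mem_iSup.mp hw
  rw [← Proj.opensRange_awayι _ _ (ι_mem_gradedPiece (b i)) one_pos] at hi
  obtain ⟨v, rfl⟩ := hi
  exact ⟨i, v, rfl⟩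

section Generic

variable [IsIntegral X] {r : ℕ} {N : X.Opens} {s : Fin r → Γ(E, N)} (hs : E.IsFrame s)
  (hN : genericPoint X ∈ N) {K : Type u} [Field K] (τ : X.functionField →+* K) (t : Fin r → K)

/-- The linear form on sections of `E` whose values on the frame `s` are the `t j`. -/
def IsFrame.form (U : X.Opens) (hU : genericPoint X ∈ U) :
    Γ(E, U) →ₛₗ[τ.comp (X.genericGerm U hU)] K where
  toFun m := ∑ j, τ (hs.coord hN U hU m j) * t j
  map_add' x y := by simp [add_mul, Finset.sum_add_distrib]
  map_smul' a x := by
    rw [LinearMap.map_smulₛₗ, smul_eq_mul, Finset.mul_sum]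
    refine Finset.sum_congr rfl fun j _ => ?_
    rw [Pi.smul_apply, smul_eq_mul, map_mul, mul_assoc]
    rfl

/-- The evaluation of homogeneous forms at the generic point of the projective bundle with
homogeneous coordinates `t`. -/
def IsFrame.eval (U : X.Opens) (hU : genericPoint X ∈ U) :
    SymmetricAlgebra Γ(X, U) Γ(E, U) →+* K :=
  semilinearLift _ (hs.form hN τ t U hU)

omit [E.IsQuasicoherent] in
lemma IsFrame.eval_res {U V : X.Opens} (h : V ≤ U) (hV : genericPoint X ∈ V)
    (a : SymmetricAlgebra Γ(X, U) Γ(E, U)) :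
    hs.eval hN τ t V hV (semilinearMap _ (E.res h) a) = hs.eval hN τ t U (h hV) a := by
  have : (hs.eval hN τ t V hV).comp (semilinearMap _ (E.res h)) = hs.eval hN τ t U (h hV) := by
    refine ringHom_ext (fun a => ?_) fun m => ?_
    · rw [RingHom.comp_apply, semilinearMap_algebraMap]
      simp only [eval, semilinearLift_algebraMap]
      exact congr(τ $(X.genericGerm_res h hV a))
    · rw [RingHom.comp_apply, semilinearMap_ι]
      simp only [eval, semilinearLift_ι]
      change ∑ j, τ (hs.coord hN V hV (E.res h m) j) * t j = _
      rw [hs.coord_res]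
      rfl
  exact congr($this a)

/-- The generic point of the projective bundle with homogeneous coordinates `t`. -/
def IsFrame.genericPt {U : X.AffineZariskiSite} (hU : genericPoint X ∈ U.toOpens)
    {f : SymmetricAlgebra Γ(X, U.toOpens) Γ(E, U.toOpens)}
    (hf : hs.eval hN τ t _ hU f ≠ 0)
    {d : ℕ} (hfd : f ∈ gradedPiece Γ(X, U.toOpens) Γ(E, U.toOpens) d) (hd : 0 < d) :
    Spec (.of K) ⟶ E.projectiveBundle :=
  Spec.map (CommRingCat.ofHom (Proj.awayEval _ (hs.eval hN τ t _ hU) f hf)) ≫ projChart hfd hd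

lemma IsFrame.genericPt_res {U V : X.AffineZariskiSite} (h : V ≤ U)
    (hV : genericPoint X ∈ V.toOpens)
    {f : SymmetricAlgebra Γ(X, U.toOpens) Γ(E, U.toOpens)}
    (hf : hs.eval hN τ t _ (toOpens_mono h hV) f ≠ 0) {d : ℕ}
    (hfd : f ∈ gradedPiece Γ(X, U.toOpens) Γ(E, U.toOpens) d) (hd : 0 < d)
    {g : SymmetricAlgebra Γ(X, V.toOpens) Γ(E, V.toOpens)}
    (hg : hs.eval hN τ t _ hV g ≠ 0) {e : ℕ}
    (hge : g ∈ gradedPiece Γ(X, V.toOpens) Γ(E, V.toOpens) e) (he : 0 < e) :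
    hs.genericPt hN τ t _ hf hfd hd = hs.genericPt hN τ t hV hg hge he := by
  have h1 := Proj.evalPt_map (gradedMap _ (E.res (toOpens_mono h)))
    (irrelevant_le_map _ _ (E.span_range_res h)) (hs.eval hN τ t _ (toOpens_mono h hV))
    (hs.eval hN τ t _ hV) (hs.eval_res hN τ t (toOpens_mono h) hV) hf
    (by rw [gradedMap_apply, hs.eval_res]; exact hf) hfd hd
  have h2 := Proj.evalPt_eq (𝒜 := gradedPiece Γ(X, V.toOpens) Γ(E, V.toOpens))
    (hs.eval hN τ t _ hV) (f := gradedMap _ (E.res (toOpens_mono h)) f)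
    (by rw [gradedMap_apply, hs.eval_res]; exact hf) hg
    ((gradedMap _ (E.res (toOpens_mono h))).map_mem hfd) hd hge he
  rw [h2] at h1
  unfold genericPt projChart
  rw [← map_projι h]
  refine Eq.trans (congr($h1.symm ≫ E.projι U)) ?_
  simp only [Proj.evalPt, Category.assoc]

/-- Compare the two points over an affine open that is basic in both `U` and `V`. -/
lemma IsFrame.genericPt_eq {U V : X.AffineZariskiSite} (hU : genericPoint X ∈ U.toOpens)
    (hV : genericPoint X ∈ V.toOpens)
    {f : SymmetricAlgebra Γ(X, U.toOpens) Γ(E, U.toOpens)}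
    (hf : hs.eval hN τ t _ hU f ≠ 0) {d : ℕ}
    (hfd : f ∈ gradedPiece Γ(X, U.toOpens) Γ(E, U.toOpens) d) (hd : 0 < d)
    {g : SymmetricAlgebra Γ(X, V.toOpens) Γ(E, V.toOpens)}
    (hg : hs.eval hN τ t _ hV g ≠ 0) {e : ℕ}
    (hge : g ∈ gradedPiece Γ(X, V.toOpens) Γ(E, V.toOpens) e) (he : 0 < e) :
    hs.genericPt hN τ t hU hf hfd hd = hs.genericPt hN τ t hV hg hge he := by
  obtain ⟨a, b, hab, ha⟩ := exists_basicOpen_le_affine_inter U.2 V.2 (genericPoint X) ⟨hU, hV⟩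
  have hWU : U.basicOpen a ≤ U := U.basicOpen_le a
  have hWV : U.basicOpen a ≤ V := ⟨b, hab.symm⟩
  have h3 : hs.eval hN τ t _ ha (gradedMap _ (E.res (toOpens_mono hWU)) f) ≠ 0 :=
    fun h => hf ((hs.eval_res hN τ t (toOpens_mono hWU) ha f).symm.trans h)
  rw [hs.genericPt_res hN τ t hWU ha hf hfd hd h3
    ((gradedMap _ (E.res (toOpens_mono hWU))).map_mem hfd) hd,
    hs.genericPt_res hN τ t hWV ha hg hge he h3
    ((gradedMap _ (E.res (toOpens_mono hWU))).map_mem hfd) hd]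

end Generic

end Modules

end AlgebraicGeometry.Scheme

/-! ### Homogeneous coordinates of the generic point -/

namespace SymmetricAlgebra

open HomogeneousLocalization

variable {R M : Type u} [CommRing R] [AddCommGroup M] [Module R M]

/-- The structure map from `R` to the coordinate ring of a standard chart of `Proj (Sym M)`. -/
def toAway (f : SymmetricAlgebra R M) : R →+* Away (gradedPiece R M) f :=
  (fromZeroRingHom _ _).comp (toZero R M)

lemma val_toAway (f : SymmetricAlgebra R M) (a : R) :
    (toAway f a).val = algebraMap _ (Localization.Away f) (algebraMap R (SymmetricAlgebra R M) a) := rfl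

/-- The fraction `m / m₀` in the coordinate ring of a standard chart of `Proj (Sym M)`. -/
def coordFrac (m₀ m : M) : Away (gradedPiece R M) (ι R M m₀) :=
  Away.mk _ (ι_mem_gradedPiece m₀) 1 (ι R M m) (ι_mem_gradedPiece m)

lemma val_coordFrac (m₀ m : M) : (coordFrac (R := R) m₀ m).val =
    algebraMap _ (Localization.Away (ι R M m₀)) (ι R M m) *
      Localization.mk 1 ⟨ι R M m₀, Submonoid.mem_powers _⟩ := by
  rw [coordFrac, Away.val_mk, ← Localization.mk_one_eq_algebraMap, Localization.mk_mul]
  congr 1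
  simp

lemma coordFrac_self (m₀ : M) : coordFrac (R := R) m₀ m₀ = 1 := by
  ext
  rw [coordFrac, Away.val_mk, val_one]
  simp only [pow_one]
  exact Localization.mk_self (⟨ι R M m₀, Submonoid.mem_powers _⟩ : Submonoid.powers (ι R M m₀))

lemma coordFrac_sum {κ : Type*} (s : Finset κ) (m₀ : M) (c : κ → R) (m : κ → M) :
    coordFrac m₀ (∑ j ∈ s, c j • m j) = ∑ j ∈ s, toAway (ι R M m₀) (c j) * coordFrac m₀ (m j) := by
  refine HomogeneousLocalization.val_injective _ ?_
  change _ = algebraMap (Away (gradedPiece R M) (ι R M m₀)) (Localization.Away (ι R M m₀)) _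
  rw [map_sum, val_coordFrac, map_sum, map_sum, Finset.sum_mul]
  refine Finset.sum_congr rfl fun j _ => ?_
  rw [map_mul, map_smul, Algebra.smul_def, map_mul, mul_assoc, ← val_coordFrac]
  rfl

lemma toAway_injective [IsDomain R] {κ : Type*} (b : Module.Basis κ R M) (i : κ) :
    Function.Injective (toAway (ι R M (b i))) := by
  have : Module.Free R M := .of_basis b
  rw [injective_iff_map_eq_zero]
  intro a ha
  have h1 := congr(HomogeneousLocalization.val $ha)
  rw [val_toAway, val_zero] at h1
  have h0 : ι R M (b i) ≠ 0 := by
    intro h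
    exact MvPolynomial.X_ne_zero i
      (aeval_ι_basis_injective b (a₁ := .X i) (a₂ := 0) (by simpa using h))
  have h2 := IsLocalization.injective (Localization.Away (ι R M (b i)))
    (powers_le_nonZeroDivisors_of_noZeroDivisors h0) (h1.trans (map_zero _).symm)
  exact (algebraMap_eq_zero_iff M a).mp h2

end SymmetricAlgebra

namespace AlgebraicGeometry.Scheme.Modules

open AffineZariskiSite SymmetricAlgebra HomogeneousLocalization

variable {X : Scheme.{u}} [IsIntegral X] {E : X.Modules} {r : ℕ}

omit [IsIntegral X] in
lemma IsFrame.basis_isFrame {N : X.Opens} {s : Fin r → Γ(E, N)} (hs : E.IsFrame s) {U : X.Opens}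
    (hU : U ≤ N) : E.IsFrame (hs.basis hU) := by
  have : (hs.basis hU : Fin r → Γ(E, U)) = fun i => E.res hU (s i) :=
    funext (hs.basis_apply hU)
  rw [this]
  exact hs.restrict hU

section Independent

variable {N : X.Opens} {s : Fin r → Γ(E, N)} (hs : E.IsFrame s)
  (hN : genericPoint X ∈ N) {K : Type u} [Field K]

lemma IsFrame.form_self (τ : X.functionField →+* K) (t : Fin r → K) (i : Fin r) :
    hs.form hN τ t N hN (s i) = t i := by
  change ∑ j, τ (hs.coord hN N hN (s i) j) * t j = t i
  rw [hs.coord_self, Finset.sum_eq_single i]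
  · simp
  · intro j _ hj
    simp [hj]
  · simp

variable [Algebra X.functionField K]

variable (K) in
/-- The embedding of the ring of functions on `U` in an extension of the function field. -/
abbrev sectionAlgebra (U : X.Opens) (hU : genericPoint X ∈ U) : Algebra Γ(X, U) K :=
  ((algebraMap X.functionField K).comp (X.genericGerm U hU)).toAlgebra

/-- Changing the frame changes the homogeneous coordinates by a matrix invertible over the function
field, so independence holds in every frame once it holds in one. -/
theorem IsFrame.isHomogeneouslyIndependent {t : Fin r → K}
    (ht : IsHomogeneouslyIndependent X.functionField t) {U : X.Opens} (hU : genericPoint X ∈ U)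
    {s' : Fin r → Γ(E, U)} (hs' : E.IsFrame s') :
    letI := sectionAlgebra K U hU
    IsHomogeneouslyIndependent Γ(X, U)
      fun l => hs.form hN (algebraMap X.functionField K) t U hU (s' l) := by
  let := sectionAlgebra K U hU
  have : Nonempty U := ⟨⟨_, hU⟩⟩
  have : IsScalarTower Γ(X, U) X.functionField K := .of_algebraMap_eq fun _ => rfl
  obtain ⟨h, hh⟩ := hs.exists_inverse hN hs' hU
  exact (ht.linear_comp _ h hh).restrictScalars (X.genericGerm_injective U hU)

end Independent

/-- `K` is the fraction field of a standard chart and the coordinates are the fractions `bⱼ / bᵢ`;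
evaluation at them is then the tautological embedding of the chart ring. -/
theorem exists_generic_coordinates {U : X.AffineZariskiSite} (hU : genericPoint X ∈ U.toOpens)
    (b : Module.Basis (Fin r) Γ(X, U.toOpens) Γ(E, U.toOpens))
    (hb : E.IsFrame b) (i : Fin r) :
    ∃ (K : Type u) (_ : Field K) (_ : Algebra X.functionField K)
      (_ : Algebra (Away (gradedPiece Γ(X, U.toOpens) Γ(E, U.toOpens)) (ι _ _ (b i))) K)
      (_ : IsFractionRing (Away (gradedPiece Γ(X, U.toOpens) Γ(E, U.toOpens)) (ι _ _ (b i))) K)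
      (t : Fin r → K), t i = 1 ∧ IsHomogeneouslyIndependent X.functionField t ∧
      ∃ h, Proj.awayEval (gradedPiece Γ(X, U.toOpens) Γ(E, U.toOpens))
        (hb.eval hU (algebraMap X.functionField K) t U.toOpens hU) (ι _ _ (b i)) h = algebraMap _ K := by
  have := X.isDomain_sections hU
  have : Nonempty U.toOpens := ⟨⟨_, hU⟩⟩
  have := isDomain_away b i
  have hfr := functionField_isFractionRing_of_isAffineOpen X U.toOpens U.2
  let S := Away (gradedPiece Γ(X, U.toOpens) Γ(E, U.toOpens)) (ι _ _ (b i))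
  let K := FractionRing S
  let ρ : Γ(X, U.toOpens) →+* K := (algebraMap S K).comp (toAway _)
  have hρ : Function.Injective ρ :=
    (IsFractionRing.injective S K).comp (toAway_injective b i)
  let τ : X.functionField →+* K := IsFractionRing.lift (A := Γ(X, U.toOpens)) hρ
  have hτ : ∀ a, τ (X.genericGerm _ hU a) = ρ a := fun a => IsFractionRing.lift_algebraMap hρ a
  let : Algebra X.functionField K := τ.toAlgebra
  let t : Fin r → K := fun j => algebraMap S K (coordFrac (b i) (b j))
  have ht : t i = 1 := by simp only [t, coordFrac_self, map_one]
  have hι : ∀ m, hb.eval hU τ t U.toOpens hU (ι _ _ m) = hb.form hU τ t U.toOpens hU m :=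
    fun m => semilinearLift_ι _ _ m
  have h0 : hb.eval hU τ t U.toOpens hU (ι _ _ (b i)) = 1 := by
    rw [hι, hb.form_self, ht]
  have hr : ∀ a, hb.eval hU τ t U.toOpens hU (algebraMap _ _ a) = ρ a := fun a =>
    (semilinearLift_algebraMap _ _ a).trans (hτ a)
  have h0' : hb.eval hU τ t U.toOpens hU (ι _ _ (b i)) ≠ 0 := by rw [h0]; exact one_ne_zero
  have hA : Proj.awayEval _ (hb.eval hU τ t U.toOpens hU) (ι _ _ (b i)) h0' = algebraMap S K := by
    refine awayEval_eq _ h0 _ (fun a => (hr a).symm) (fun m => ?_) h0'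
    rw [hι]
    conv_rhs => rw [← b.sum_repr m, map_sum]
    change algebraMap S K (coordFrac (b i) m) = _
    conv_lhs => rw [← b.sum_repr m, coordFrac_sum, map_sum]
    refine Finset.sum_congr rfl fun j _ => ?_
    rw [LinearMap.map_smulₛₗ, hb.form_self, map_mul, smul_eq_mul]
    congr 1
    exact (hτ _).symm
  refine ⟨K, inferInstance, inferInstance, inferInstance, inferInstance, t, ht, ?_, h0', hA⟩
  let : Algebra Γ(X, U.toOpens) K := ρ.toAlgebra
  have : IsScalarTower Γ(X, U.toOpens) X.functionField K :=
    .of_algebraMap_eq fun a => (hτ a).symm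
  refine IsHomogeneouslyIndependent.extendScalars (R := Γ(X, U.toOpens)) (nonZeroDivisors _) ?_
  have h2 := isHomogeneouslyIndependent_of_awayEval_injective b _ hr i h0'
    (hA ▸ IsFractionRing.injective S K)
  have h3 : (fun j => hb.eval hU τ t U.toOpens hU (ι _ _ (b j))) = t := by
    ext j
    rw [hι, hb.form_self]
  rwa [h3] at h2

end AlgebraicGeometry.Scheme.Modules

/-! ### Endomorphisms of the module from the generic fibre -/

namespace AlgebraicGeometry.Scheme.Modules

variable {X : Scheme.{u}} {E : X.Modules}

lemma eq_of_res_eq {U : X.Opens} (m m' : Γ(E, U))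
    (h : ∀ x ∈ U, ∃ (V : X.Opens) (hV : V ≤ U), x ∈ V ∧ E.res hV m = E.res hV m') : m = m' := by
  choose V hV hxV hm using h
  refine TopCat.Sheaf.eq_of_locally_eq' (⟨E.presheaf, E.isSheaf⟩ : TopCat.Sheaf Ab X)
    (fun x : U => V x.1 x.2) U (fun x => homOfLE (hV x.1 x.2)) (fun x hx => ?_) m m'
    (fun x => hm x.1 x.2)
  exact TopologicalSpace.Opens.mem_iSup.mpr ⟨⟨x, hx⟩, hxV x hx⟩

lemma exists_res_eq {I : Type*} {U : X.Opens} (V : I → X.Opens) (hV : ∀ i, V i ≤ U)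
    (hcover : ∀ x ∈ U, ∃ i, x ∈ V i) (m : ∀ i, Γ(E, V i))
    (h : ∀ i j, E.res (inf_le_left : V i ⊓ V j ≤ V i) (m i) =
      E.res (inf_le_right : V i ⊓ V j ≤ V j) (m j)) :
    ∃ m' : Γ(E, U), ∀ i, E.res (hV i) m' = m i := by
  obtain ⟨m', hm', -⟩ := TopCat.Sheaf.existsUnique_gluing'
    (⟨E.presheaf, E.isSheaf⟩ : TopCat.Sheaf Ab X) V U (fun i => homOfLE (hV i))
    (fun x hx => TopologicalSpace.Opens.mem_iSup.mpr (hcover x hx)) m (fun i j => h i j)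
  exact ⟨m', hm'⟩

lemma exists_hom (φ : ∀ U : X.Opens, Γ(E, U) →ₗ[Γ(X, U)] Γ(E, U))
    (h : ∀ (U V : X.Opens) (hVU : V ≤ U) (m : Γ(E, U)), E.res hVU (φ U m) = φ V (E.res hVU m)) :
    ∃ ψ : E ⟶ E, ∀ (U : X.Opens) (m : Γ(E, U)), ψ.app U m = φ U m := by
  let α : E.presheaf ⟶ E.presheaf :=
    { app := fun U => AddCommGrpCat.ofHom (φ U.unop).toAddMonoidHom
      naturality := fun U V f => by
        ext m
        exact (h _ _ f.unop.le m).symm }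
  exact ⟨⟨PresheafOfModules.homMk (M₁ := E.val) (M₂ := E.val) α
    fun U a m => (φ U.unop).map_smul a m⟩, fun U m => rfl⟩

variable [IsIntegral X] {r : ℕ} {N : X.Opens} {s : Fin r → Γ(E, N)} (hs : E.IsFrame s)
  (hN : genericPoint X ∈ N) (hE : E.IsLocallyFreeOfRank r)

include hE in
-- A locally free module on an integral scheme is torsion-free: locally, coordinates in a frame
-- inject into the function field, and the transition matrix to the fixed frame is invertible.
lemma IsFrame.eq_of_coord_eq {U : X.Opens} (m m' : Γ(E, U))
    (h : ∀ hU, hs.coord hN U hU m = hs.coord hN U hU m') : m = m' := by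
  refine eq_of_res_eq m m' fun x hx => ?_
  have hU : genericPoint X ∈ U := X.genericPoint_mem ⟨x, hx⟩
  obtain ⟨N', s', hx', hs'⟩ := hE.exists_isFrame x
  have hV : genericPoint X ∈ U ⊓ N' := X.genericPoint_mem ⟨x, hx, hx'⟩
  refine ⟨U ⊓ N', inf_le_left, ⟨hx, hx'⟩, ?_⟩
  have hsV := hs'.basis_isFrame (inf_le_right : U ⊓ N' ≤ N')
  let b := hs'.basis (inf_le_right : U ⊓ N' ≤ N')
  rw [← sub_eq_zero, ← map_sub]
  have h0 : hs.coord hN _ hV (E.res (inf_le_left : U ⊓ N' ≤ U) (m - m')) = 0 := by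
    rw [hs.coord_res, map_sub, h, sub_self]
  generalize E.res (inf_le_left : U ⊓ N' ≤ U) (m - m') = n at h0
  obtain ⟨g, hg⟩ := hs.exists_inverse hN hsV hV
  have hg' := mul_eq_one_comm.mp hg
  refine b.repr.map_eq_zero_iff.mp (Finsupp.ext fun i => ?_)
  refine X.genericGerm_injective _ hV ?_
  rw [Finsupp.zero_apply, map_zero]
  have h1 : (Matrix.of fun j l => hs.coord hN _ hV (b l) j).mulVec
      (fun l => X.genericGerm _ hV (b.repr n l)) = 0 := by
    ext j
    have h2 := congr(hs.coord hN _ hV $(b.sum_repr n) j)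
    rw [h0, map_sum, Finset.sum_apply] at h2
    rw [Matrix.mulVec, dotProduct]
    refine Eq.trans (Finset.sum_congr rfl fun l _ => ?_) h2
    rw [LinearMap.map_smulₛₗ, Pi.smul_apply, smul_eq_mul, mul_comm]
    rfl
  have h2 := congr(g.mulVec $h1)
  rw [Matrix.mulVec_mulVec, hg', Matrix.one_mulVec, Matrix.mulVec_zero] at h2
  exact congr($h2 i)

include hE in
/-- An endomorphism of the generic fibre of `E` which preserves sections locally extends to an
endomorphism of `E`. -/
theorem IsFrame.exists_endomorphism
    (A : (Fin r → X.functionField) →ₗ[X.functionField] (Fin r → X.functionField))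
    (hA : ∀ (W : X.Opens), ∀ x ∈ W, ∃ U ≤ W, x ∈ U ∧ ∀ (hU : genericPoint X ∈ U) (m : Γ(E, U)),
      ∃ m', hs.coord hN U hU m' = A (hs.coord hN U hU m)) :
    ∃ ψ : E ⟶ E, ∀ (U : X.Opens) (hU : genericPoint X ∈ U) (m : Γ(E, U)),
      hs.coord hN U hU (ψ.app U m) = A (hs.coord hN U hU m) := by
  have key : ∀ (W : X.Opens) (m : Γ(E, W)), ∃ m' : Γ(E, W), ∀ hW,
      hs.coord hN W hW m' = A (hs.coord hN W hW m) := by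
    intro W m
    choose U hUW hxU hU using hA W
    have hη : ∀ x : W, genericPoint X ∈ U x.1 x.2 := fun x =>
      X.genericPoint_mem ⟨x.1, hxU x.1 x.2⟩
    choose n hn using fun x : W => hU x.1 x.2 (hη x) (E.res (hUW x.1 x.2) m)
    -- The local images have the same generic coordinates, so they agree on overlaps and glue.
    obtain ⟨m', hm'⟩ := exists_res_eq (fun x : W => U x.1 x.2) (fun x => hUW x.1 x.2)
      (fun x hx => ⟨⟨x, hx⟩, hxU x hx⟩) n fun x y =>
        hs.eq_of_coord_eq hN hE _ _ fun h => by
          rw [hs.coord_res, hs.coord_res, hn, hn, hs.coord_res, hs.coord_res]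
    refine ⟨m', fun hW => ?_⟩
    rw [← hs.coord_res hN (hUW _ hW) (hη ⟨_, hW⟩), hm' ⟨_, hW⟩]
    exact (hn ⟨_, hW⟩).trans (by rw [hs.coord_res])
  choose φ hφ using key
  obtain ⟨ψ, hψ⟩ := exists_hom (E := E)
    (fun U =>
      { toFun := φ U
        map_add' := fun m m' => hs.eq_of_coord_eq hN hE _ _ fun hU => by
          rw [hφ, map_add, map_add, map_add, hφ, hφ]
        map_smul' := fun a m => hs.eq_of_coord_eq hN hE _ _ fun hU => by
          rw [hφ, LinearMap.map_smulₛₗ, LinearMap.map_smul, LinearMap.map_smulₛₗ, hφ]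
          rfl })
    (fun U V h m => hs.eq_of_coord_eq hN hE _ _ fun hV => by
      change hs.coord hN V hV (E.res h (φ U m)) = hs.coord hN V hV (φ V (E.res h m))
      rw [hφ, hs.coord_res, hs.coord_res, hφ])
  exact ⟨ψ, fun U hU m => by rw [hψ]; exact hφ U m hU⟩

end AlgebraicGeometry.Scheme.Modules

/-! ### Derivations acting on linear forms through a matrix -/

section LinearForms

variable {F K ι : Type*} [Field F] [Field K] [Algebra F K] [Fintype ι]

/-- The linear form with coefficients `v` in the homogeneous coordinates `y`. -/
def linForm (y : ι → K) (v : ι → F) : K := ∑ l, algebraMap F K (v l) * y l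

lemma linForm_single [DecidableEq ι] (y : ι → K) (i : ι) :
    linForm y (Pi.single i 1 : ι → F) = y i := by
  rw [linForm, Finset.sum_eq_single i]
  · simp
  · intro j _ hj
    simp [hj]
  · simp

lemma linForm_mulVec (y : ι → K) (g : Matrix ι ι F) (u : ι → F) :
    linForm y (g.mulVec u) = linForm (fun l => linForm y fun j => g j l) u := by
  simp only [linForm, Matrix.mulVec, dotProduct, map_sum, map_mul, Finset.sum_mul, Finset.mul_sum]
  rw [Finset.sum_comm]
  exact Finset.sum_congr rfl fun l _ => Finset.sum_congr rfl fun j _ => by ring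

lemma map_linForm {D : Derivation ℤ K K} (hD : ∀ x : F, D (algebraMap F K x) = 0) (y : ι → K)
    (u : ι → F) : D (linForm y u) = linForm (fun l => D (y l)) u := by
  simp only [linForm, map_sum, Derivation.leibniz, hD, smul_eq_mul, mul_zero, add_zero]

/-- The derivation `D` acts on quotients of linear forms in `y` through the matrix `A`. -/
def ActsThrough (D : K → K) (y : ι → K) (A : Matrix ι ι F) : Prop :=
  ∀ v w : ι → F, linForm y v * D (linForm y w) - linForm y w * D (linForm y v) =
    linForm y v * linForm y (A.mulVec w) - linForm y w * linForm y (A.mulVec v)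

lemma ActsThrough.of_coordinates {D : Derivation ℤ K K} (hD : ∀ x : F, D (algebraMap F K x) = 0)
    {y : ι → K} {A : Matrix ι ι F}
    (h : ∀ j i, y i * D (y j) - y j * D (y i) =
      y i * ∑ l, algebraMap F K (A l j) * y l - y j * ∑ l, algebraMap F K (A l i) * y l) :
    ActsThrough D y A := by
  intro v w
  rw [map_linForm hD, map_linForm hD, linForm_mulVec, linForm_mulVec]
  have key : ∀ z : ι → K, linForm y v * linForm z w - linForm y w * linForm z v =
      ∑ i, ∑ j, algebraMap F K (v i) * algebraMap F K (w j) * (y i * z j - y j * z i) := by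
    intro z
    simp only [linForm, Finset.sum_mul_sum, mul_sub, Finset.sum_sub_distrib]
    congr 1
    · exact Finset.sum_congr rfl fun i _ => Finset.sum_congr rfl fun j _ => by ring
    · rw [Finset.sum_comm]
      exact Finset.sum_congr rfl fun i _ => Finset.sum_congr rfl fun j _ => by ring
  rw [key, key]
  exact Finset.sum_congr rfl fun i _ => Finset.sum_congr rfl fun j _ => congrArg _ (h j i)

/-- The condition quantifies over all linear forms, so a linear change of coordinates only
conjugates the matrix. -/
lemma ActsThrough.change_coordinates [DecidableEq ι] {D : K → K} {y : ι → K} {g h A : Matrix ι ι F}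
    (hgh : g * h = 1) (hA : ActsThrough D (fun l => linForm y fun j => g j l) A) :
    ActsThrough D y (g * A * h) := by
  have hv : ∀ v : ι → F, linForm (fun l => linForm y fun j => g j l) (h.mulVec v) =
      linForm y v := fun v => by
    rw [← linForm_mulVec, Matrix.mulVec_mulVec, hgh, Matrix.one_mulVec]
  have hw : ∀ v : ι → F, linForm (fun l => linForm y fun j => g j l) (A.mulVec (h.mulVec v)) =
      linForm y ((g * A * h).mulVec v) := fun v => by
    rw [← linForm_mulVec, Matrix.mulVec_mulVec, Matrix.mulVec_mulVec, Matrix.mul_assoc]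
  intro v w
  have := hA (h.mulVec v) (h.mulVec w)
  rwa [hv, hv, hw, hw] at this

/-- The matrix is determined up to a scalar, and the zero trace fixes the scalar in characteristic
zero. -/
lemma ActsThrough.eq [CharZero F] [Nonempty ι] {D : K → K} {y : ι → K}
    (hy : IsHomogeneouslyIndependent F y) {A B : Matrix ι ι F} (hA : ActsThrough D y A)
    (hB : ActsThrough D y B) (hA0 : A.trace = 0) (hB0 : B.trace = 0) : A = B := by
  classical
  refine hy.traceless_unique (IsUnit.mk0 _ (Nat.cast_ne_zero.mpr Fintype.card_ne_zero)) hA0 hB0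
    fun j i => ?_
  have h := (hA (Pi.single i 1) (Pi.single j 1)).symm.trans (hB (Pi.single i 1) (Pi.single j 1))
  simp only [linForm_mulVec, linForm_single] at h
  exact h

end LinearForms

/-! ### Vertical vector fields on the bundle of a simple module -/

namespace AlgebraicGeometry.Scheme.Modules

open AffineZariskiSite SymmetricAlgebra HomogeneousLocalization

variable {k : Type u} [Field k] {X : Scheme.{u}} [IsIntegral X] {E : X.Modules} {r : ℕ}

/-- The structure map of the ring of functions on an open subset of a `k`-scheme. -/
def sectionsOfBase (f : X ⟶ Spec (.of k)) (U : X.Opens) : k →+* Γ(X, U) :=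
  (X.presheaf.map (homOfLE (le_top : U ≤ ⊤)).op).hom.comp
    (f.appTop.hom.comp (Scheme.ΓSpecIso (.of k)).inv.hom)

lemma IsFrame.coord_eq_mulVec {N : X.Opens} {s : Fin r → Γ(E, N)} (hs : E.IsFrame s)
    (hN : genericPoint X ∈ N) {U : X.Opens} (hU : genericPoint X ∈ U)
    (b : Module.Basis (Fin r) Γ(X, U) Γ(E, U)) (m : Γ(E, U)) :
    hs.coord hN U hU m = (Matrix.of fun j l => hs.coord hN U hU (b l) j).mulVec
      (fun l => X.genericGerm U hU (b.repr m l)) := by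
  ext j
  have h2 := congr(hs.coord hN _ hU $(b.sum_repr m) j)
  rw [map_sum, Finset.sum_apply] at h2
  rw [Matrix.mulVec, dotProduct]
  refine Eq.trans h2.symm (Finset.sum_congr rfl fun l _ => ?_)
  rw [LinearMap.map_smulₛₗ, Pi.smul_apply, smul_eq_mul, mul_comm]
  rfl

variable [E.IsQuasicoherent] {N : X.Opens} {s : Fin r → Γ(E, N)} (hs : E.IsFrame s)
  (hN : genericPoint X ∈ N) {K : Type u} [Field K] [Algebra X.functionField K] {t : Fin r → K}
  (ht : IsHomogeneouslyIndependent X.functionField t)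
  (f : X ⟶ Spec (.of k)) {ζ : Spec (.of K) ⟶ (Over.mk (E.projectiveBundleπ ≫ f)).left}

/-- `ζ` is the generic point of the projective bundle with homogeneous coordinates `t`. -/
def IsFrame.IsGenericPt (t : Fin r → K)
    (ζ : Spec (.of K) ⟶ (Over.mk (E.projectiveBundleπ ≫ f)).left) : Prop :=
  ∀ (U : X.AffineZariskiSite) (hU : genericPoint X ∈ U.toOpens)
    (m : SymmetricAlgebra Γ(X, U.toOpens) Γ(E, U.toOpens))
    (hm : hs.eval hN (algebraMap X.functionField K) t _ hU m ≠ 0) (d : ℕ)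
    (hmd : m ∈ gradedPiece Γ(X, U.toOpens) Γ(E, U.toOpens) d) (hd : 0 < d),
    hs.genericPt hN (algebraMap X.functionField K) t hU hm hmd hd = ζ

variable {f} (hζ : hs.IsGenericPt hN f t ζ) {U : X.AffineZariskiSite}
  (hU : genericPoint X ∈ U.toOpens)
  {b : Module.Basis (Fin r) Γ(X, U.toOpens) Γ(E, U.toOpens)} (hb : E.IsFrame b)

omit [E.IsQuasicoherent] in
include ht hb in
lemma IsFrame.eval_basis_ne_zero (i : Fin r) :
    hs.eval hN (algebraMap X.functionField K) t _ hU (ι _ _ (b i)) ≠ 0 := by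
  let := sectionAlgebra K U.toOpens hU
  have := X.isDomain_sections hU
  have h := (hs.isHomogeneouslyIndependent hN ht hU hb).ne_zero i
  rwa [eval, semilinearLift_ι]

include ht hb hζ in
lemma IsFrame.isFieldChart (i : Fin r) :
    IsFieldChart ζ (projChart (E := E) (ι_mem_gradedPiece (b i)) one_pos)
      (Proj.awayEval _ (hs.eval hN (algebraMap X.functionField K) t _ hU) _
        (hs.eval_basis_ne_zero hN ht hU hb i)) where
  isOpenImmersion := inferInstance
  fac := hζ U hU _ _ 1 _ _

omit [E.IsQuasicoherent] in
lemma IsFrame.eval_ι : (fun j => hs.eval hN (algebraMap X.functionField K) t _ hU (ι _ _ (b j))) =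
    fun l => hs.form hN (algebraMap X.functionField K) t _ hU (b l) := by
  ext j
  rw [eval, semilinearLift_ι]

include ht hb in
lemma IsFrame.awayEval_injective (i : Fin r) :
    Function.Injective (Proj.awayEval (gradedPiece Γ(X, U.toOpens) Γ(E, U.toOpens))
      (hs.eval hN (algebraMap X.functionField K) t _ hU) _
        (hs.eval_basis_ne_zero hN ht hU hb i)) := by
  let := sectionAlgebra K U.toOpens hU
  have hev : ∀ a, hs.eval hN (algebraMap X.functionField K) t _ hU (algebraMap _ _ a) =
    algebraMap Γ(X, U.toOpens) K a := fun a => semilinearLift_algebraMap _ _ a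
  refine SymmetricAlgebra.awayEval_injective b _ hev i _ ?_
  rw [hs.eval_ι]
  exact hs.isHomogeneouslyIndependent hN ht hU hb

include ht hb in
lemma IsFrame.range_awayEval (i : Fin r) :
    letI := sectionAlgebra K U.toOpens hU
    Set.range (Proj.awayEval (gradedPiece Γ(X, U.toOpens) Γ(E, U.toOpens))
      (hs.eval hN (algebraMap X.functionField K) t _ hU) _
        (hs.eval_basis_ne_zero hN ht hU hb i)) =
      chartRing Γ(X, U.toOpens)
        (fun l => hs.form hN (algebraMap X.functionField K) t _ hU (b l)) i := by
  let := sectionAlgebra K U.toOpens hU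
  have hev : ∀ a, hs.eval hN (algebraMap X.functionField K) t _ hU (algebraMap _ _ a) =
    algebraMap Γ(X, U.toOpens) K a := fun a => semilinearLift_algebraMap _ _ a
  rw [SymmetricAlgebra.range_awayEval b _ hev i, hs.eval_ι]

include ht hb hζ in
lemma IsFrame.map_mem_chartRing {D : K → K} (hD : PreservesCharts ζ D) (i : Fin r) {x : K}
    (hx : letI := sectionAlgebra K U.toOpens hU
      x ∈ chartRing Γ(X, U.toOpens)
        (fun l => hs.form hN (algebraMap X.functionField K) t _ hU (b l)) i) :
    letI := sectionAlgebra K U.toOpens hU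
    D x ∈ chartRing Γ(X, U.toOpens)
        (fun l => hs.form hN (algebraMap X.functionField K) t _ hU (b l)) i := by
  rw [← hs.range_awayEval hN ht hU hb i] at hx ⊢
  obtain ⟨z, rfl⟩ := hx
  obtain ⟨z', hz'⟩ := hD _ _ _ (hs.isFieldChart hN ht hζ hU hb i) z
  exact ⟨z', hz'.symm⟩

variable [CharZero k] [Nonempty (Fin r)]

lemma charZero_functionField (f : X ⟶ Spec (.of k)) : CharZero X.functionField :=
  charZero_of_injective_ringHom
    ((X.genericGerm ⊤ trivial).comp (sectionsOfBase f ⊤)).injective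

include ht hb hζ in
-- Apply `exists_traceless` over `Γ(X, U)`, where the rank is invertible because `k` maps to this
-- ring. The entries of the matrix are thus regular on `U`, so it acts on sections of `E` over `U`.
lemma IsFrame.exists_actsThrough {D : Derivation ℤ K K} (hD : PreservesCharts ζ D)
    (hF : ∀ x : X.functionField, D (algebraMap _ K x) = 0) :
    ∃ a : Matrix (Fin r) (Fin r) Γ(X, U.toOpens), (a.map (X.genericGerm _ hU)).trace = 0 ∧
      ActsThrough D (fun l => hs.form hN (algebraMap X.functionField K) t _ hU (b l))
        (a.map (X.genericGerm _ hU)) := by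
  let := sectionAlgebra K U.toOpens hU
  have := X.isDomain_sections hU
  have : CharZero Γ(X, U.toOpens) :=
    charZero_of_injective_ringHom (sectionsOfBase f U.toOpens).injective
  have hunit : IsUnit (Fintype.card (Fin r) : Γ(X, U.toOpens)) := by
    rw [← map_natCast (sectionsOfBase f U.toOpens)]
    exact (IsUnit.mk0 _ (Nat.cast_ne_zero.mpr Fintype.card_ne_zero)).map _
  obtain ⟨a, ha, h⟩ := (hs.isHomogeneouslyIndependent hN ht hU hb).exists_traceless hunit D
    fun i x hx => hs.map_mem_chartRing hN ht hζ hU hb hD i hx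
  refine ⟨a, ?_, ActsThrough.of_coordinates hF h⟩
  simp only [Matrix.trace, Matrix.diag_apply, Matrix.map_apply] at ha ⊢
  rw [← map_sum, ha, map_zero]

include ht hζ in
/-- A vector field on the projective bundle of a simple module which is vertical over the base
vanishes. -/
theorem IsFrame.vertical_derivation_eq_zero (hN' : IsAffineOpen N) (hE : E.IsLocallyFreeOfRank r)
    (hsimple : E.IsSimple) {D : Derivation ℤ K K} (hD : PreservesCharts ζ D)
    (hF : ∀ x : X.functionField, D (algebraMap _ K x) = 0) (i j : Fin r) :
    t i * D (t j) = t j * D (t i) := by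
  have := charZero_functionField f
  have hform : ∀ l, hs.form hN (algebraMap X.functionField K) t N hN (hs.basis le_rfl l) = t l := by
    intro l
    rw [hs.basis_apply, res_self, hs.form_self]
  obtain ⟨a₀, ha₀, hA⟩ := hs.exists_actsThrough (U := ⟨N, hN'⟩) hN ht hζ hN
    (hs.basis_isFrame le_rfl) hD hF
  set A := a₀.map (X.genericGerm N hN) with hAdef
  have hA0 : A.trace = 0 := ha₀
  replace hA : ActsThrough D t A := by
    have : (fun l => hs.form hN (algebraMap X.functionField K) t N hN (hs.basis le_rfl l)) = t :=
      funext hform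
    rw [← this]
    exact hA
  -- `A` describes the field on the generic fibre; it is to be shown that it preserves sections of
  -- `E` locally.
  obtain ⟨ψ, hψ⟩ := hs.exists_endomorphism hN hE A.mulVecLin (by
    intro W x hx
    obtain ⟨N', s', hxN', hs'⟩ := hE.exists_isFrame x
    obtain ⟨U, hUaff, hxU, hUW⟩ := exists_isAffineOpen_mem_and_subset (U := W ⊓ N') ⟨hx, hxN'⟩
    refine ⟨U, fun y hy => (hUW hy).1, hxU, fun hU m => ?_⟩
    have hUN' : U ≤ N' := fun y hy => (hUW hy).2
    obtain ⟨a, ha, hB⟩ := hs.exists_actsThrough (U := ⟨U, hUaff⟩) hN ht hζ hU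
      (hs'.basis_isFrame hUN') hD hF
    let b := hs'.basis hUN'
    obtain ⟨h, hh⟩ := hs.exists_inverse hN (hs'.basis_isFrame hUN') hU
    -- Uniqueness of the traceless matrix: the matrix with regular entries found over `U`,
    -- conjugated to the fixed frame, is `A` itself.
    have hAB : A = Matrix.of (fun j l => hs.coord hN U hU (b l) j) *
        a.map (X.genericGerm U hU) * h := by
      refine hA.eq ht (ActsThrough.change_coordinates hh hB) hA0 ?_
      rw [Matrix.trace_mul_comm, ← Matrix.mul_assoc, mul_eq_one_comm.mp hh, Matrix.one_mul]
      exact ha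
    refine ⟨b.equivFun.symm (a.mulVec (b.equivFun m)), ?_⟩
    rw [hs.coord_eq_mulVec hN hU b, hs.coord_eq_mulVec hN hU b m, Matrix.mulVecLin_apply, hAB,
      Matrix.mulVec_mulVec, Matrix.mul_assoc, mul_eq_one_comm.mp hh, Matrix.mul_one,
      ← Matrix.mulVec_mulVec]
    congr 1
    ext l
    rw [← b.equivFun_apply, LinearEquiv.apply_symm_apply]
    simp [Matrix.mulVec, dotProduct])
  obtain ⟨c, hc⟩ := hsimple ψ
  let c' := X.genericGerm ⊤ trivial c
  have h1 : ∀ l, A.mulVec (Pi.single l 1) = c' • Pi.single l 1 := by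
    intro l
    have := hψ N hN (s l)
    rw [hc, LinearMap.map_smulₛₗ, hs.coord_self] at this
    rw [← Matrix.mulVecLin_apply, ← this]
    congr 1
    exact X.genericGerm_res le_top hN c
  have h2 : A = c' • (1 : Matrix (Fin r) (Fin r) X.functionField) := by
    ext i l
    have := congr($(h1 l) i)
    simpa [Matrix.one_apply, Pi.single_apply] using this
  -- A scalar matrix of trace zero vanishes, since its size is nonzero in characteristic zero.
  have h3 : c' = 0 := by
    rw [h2, Matrix.trace_smul, Matrix.trace_one, smul_eq_mul, mul_eq_zero] at hA0
    exact hA0.resolve_right (Nat.cast_ne_zero.mpr Fintype.card_ne_zero)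
  rw [h3, zero_smul] at h2
  have h4 := hA (Pi.single i 1) (Pi.single j 1)
  rw [h2, Matrix.zero_mulVec, Matrix.zero_mulVec] at h4
  have h0 : linForm t (0 : Fin r → X.functionField) = 0 := by simp [linForm]
  rw [linForm_single, linForm_single, h0, mul_zero, mul_zero, sub_zero] at h4
  exact sub_eq_zero.mp h4

end AlgebraicGeometry.Scheme.Modules

/-! ### The function field of the base and the final contradiction -/

namespace IsHomogeneouslyIndependent

open MvPolynomial

variable {F K ι : Type*} [Field F] [Field K] [Algebra F K] {t : ι → K}
  (ht : IsHomogeneouslyIndependent F t)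

include ht in
-- As `t i = 1`, a polynomial relation for `t j` can be homogenized with powers of `t i`, and there
-- is no nontrivial homogeneous relation.
lemma transcendental {k : Type*} [Field k] [Algebra k K] (L : IntermediateField k K)
    (hL : ∀ x ∈ L, x ∈ Set.range (algebraMap F K)) {i j : ι} (hij : i ≠ j) (hi : t i = 1) :
    Transcendental L (t j) := by
  classical
  rintro ⟨p, hp0, hp⟩
  choose c hc using fun n => hL (p.coeff n) (p.coeff n).2
  let G : MvPolynomial ι F :=
    ∑ n ∈ Finset.range (p.natDegree + 1), C (c n) * (X j ^ n * X i ^ (p.natDegree - n))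
  have hG : G.IsHomogeneous p.natDegree := by
    refine IsHomogeneous.sum _ _ _ fun n hn => ?_
    have h1 : n + (p.natDegree - n) = p.natDegree := by
      have := Finset.mem_range.mp hn
      omega
    have h2 := (isHomogeneous_C ι (c n)).mul
      ((isHomogeneous_X_pow (R := F) j n).mul (isHomogeneous_X_pow i (p.natDegree - n)))
    rwa [zero_add, h1] at h2
  have h0 : G = 0 := by
    refine ht _ G hG ?_
    rw [Polynomial.aeval_eq_sum_range] at hp
    rw [← hp, map_sum]
    refine Finset.sum_congr rfl fun n _ => ?_
    simp only [map_mul, map_pow, aeval_C, aeval_X, hi, one_pow, mul_one, hc]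
    rfl
  have h1 := congr(aeval (fun l => if l = j then (Polynomial.X : Polynomial F) else 1) $h0)
  simp only [G, map_sum, map_mul, map_pow, aeval_C, aeval_X, if_neg hij, if_true, one_pow, mul_one,
    map_zero] at h1
  refine hp0 (Polynomial.ext fun n => ?_)
  by_cases hn : n < p.natDegree + 1
  · have h2 := congr(Polynomial.coeff $h1 n)
    simp only [Polynomial.finsetSum_coeff, Polynomial.algebraMap_eq, Polynomial.coeff_C_mul_X_pow,
      Finset.sum_ite_eq, Finset.mem_range, if_pos hn, Polynomial.coeff_zero] at h2
    refine Subtype.ext ?_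
    rw [← hc, h2]
    simp
  · rw [Polynomial.coeff_eq_zero_of_natDegree_lt (by omega), Polynomial.coeff_zero]

end IsHomogeneouslyIndependent

lemma Derivation.eq_zero_of_isFractionRing {k S K : Type*} [CommRing k] [CommRing S] [Field K]
    [Algebra S K] [IsFractionRing S K] [Algebra k K] (D : Derivation k K K)
    (h : ∀ z : S, D (algebraMap S K z) = 0) : D = 0 := by
  ext x
  obtain ⟨a, b, -, rfl⟩ := IsFractionRing.div_surjective (A := S) x
  simp [Derivation.leibniz_div, h]

lemma Derivation.map_aeval_eq_zero {k F K ι : Type*} [CommRing k] [CommRing F] [Field K]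
    [Algebra F K] [Algebra k K] (D : Derivation k K K) (hF : ∀ x : F, D (algebraMap F K x) = 0)
    {t : ι → K} (ht : ∀ i, D (t i) = 0) (p : MvPolynomial ι F) : D (MvPolynomial.aeval t p) = 0 := by
  induction p using MvPolynomial.induction_on with
  | C a => rw [MvPolynomial.aeval_C, hF]
  | add p q hp hq => rw [map_add, map_add, hp, hq, add_zero]
  | mul_X p i hp => rw [map_mul, MvPolynomial.aeval_X, Derivation.leibniz, hp, ht]; simp

namespace AlgebraicGeometry.Scheme.Modules

open AffineZariskiSite SymmetricAlgebra HomogeneousLocalization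

variable {k : Type u} [Field k] {X : Scheme.{u}} [IsIntegral X] {E : X.Modules}
  [E.IsQuasicoherent] {r : ℕ}

section Field

variable {f : X ⟶ Spec (.of k)} {U : X.AffineZariskiSite} (hU : genericPoint X ∈ U.toOpens)
  {b : Module.Basis (Fin r) Γ(X, U.toOpens) Γ(E, U.toOpens)} (hb : E.IsFrame b)
  {K : Type u} [Field K] [Algebra X.functionField K] {t : Fin r → K}
  (ht : IsHomogeneouslyIndependent X.functionField t)
  {ζ : Spec (.of K) ⟶ (Over.mk (E.projectiveBundleπ ≫ f)).left}
  (hζ : hb.IsGenericPt hU f t ζ) {i₀ i₁ : Fin r} (hi : i₀ ≠ i₁)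

include ht hi in
-- A function regular on two distinct standard charts above `U` is a function on `U`.
lemma IsFrame.mem_range_of_mem_range_awayEval {x : K}
    (hx : ∀ i, x ∈ Set.range (Proj.awayEval (gradedPiece Γ(X, U.toOpens) Γ(E, U.toOpens))
      (hb.eval hU (algebraMap X.functionField K) t _ hU) _
        (hb.eval_basis_ne_zero hU ht hU hb i))) :
    x ∈ Set.range (algebraMap X.functionField K) := by
  let := sectionAlgebra K U.toOpens hU
  have := X.isDomain_sections hU
  have h0 := hx i₀
  have h1 := hx i₁
  rw [hb.range_awayEval hU ht hU hb] at h0 h1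
  obtain ⟨a, ha⟩ := (hb.isHomogeneouslyIndependent hU ht hU hb).mem_range_algebraMap hi h0 h1
  exact ⟨_, ha⟩

include ht hζ hi in
-- Functions on `U` are regular on every chart above `U`. So are their derivatives, which therefore
-- come from `U` again. The quotient rule extends this to the function field of `X`.
lemma IsFrame.map_mem_range {D : Derivation ℤ K K} (hD : PreservesCharts ζ D) {x : K}
    (hx : x ∈ Set.range (algebraMap X.functionField K)) :
    D x ∈ Set.range (algebraMap X.functionField K) := by
  have : Nonempty U.toOpens := ⟨⟨_, hU⟩⟩
  have hfr := functionField_isFractionRing_of_isAffineOpen X U.toOpens U.2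
  have key : ∀ a : Γ(X, U.toOpens),
      D (algebraMap X.functionField K (X.genericGerm _ hU a)) ∈
        Set.range (algebraMap X.functionField K) := by
    intro a
    refine hb.mem_range_of_mem_range_awayEval hU ht hi fun i => ?_
    let := sectionAlgebra K U.toOpens hU
    rw [hb.range_awayEval hU ht hU hb]
    refine hb.map_mem_chartRing hU ht hζ hU hb hD i
      ⟨0, .C a, MvPolynomial.isHomogeneous_C _ _, ?_⟩
    rw [pow_zero, mul_one, MvPolynomial.aeval_C]
    rfl
  obtain ⟨y, rfl⟩ := hx
  obtain ⟨a, c, -, rfl⟩ := IsFractionRing.div_surjective (A := Γ(X, U.toOpens)) y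
  obtain ⟨a', ha'⟩ := key a
  obtain ⟨c', hc'⟩ := key c
  change D (algebraMap X.functionField K (X.genericGerm _ hU a / X.genericGerm _ hU c)) ∈ _
  rw [map_div₀, Derivation.leibniz_div, ← ha', ← hc']
  change _ ∈ (algebraMap X.functionField K).fieldRange
  have hmem : ∀ x, algebraMap X.functionField K x ∈ (algebraMap X.functionField K).fieldRange :=
    fun x => ⟨x, rfl⟩
  simp only [smul_eq_mul]
  exact mul_mem (pow_mem (inv_mem (hmem _)) 2) (sub_mem (mul_mem (hmem _) (hmem _))
    (mul_mem (hmem _) (hmem _)))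

end Field

/-- With `L` the function field of `X`, `exists_derivation` yields a nonzero vector field killing
`L`, while `vertical_derivation_eq_zero` forces every such field to vanish. -/
theorem not_admitsVectorGroupStructure [CharZero k] (f : X ⟶ Spec (.of k)) (hr : 2 ≤ r)
    (hE : E.IsLocallyFreeOfRank r) (hsimple : E.IsSimple) :
    ¬ AdmitsVectorGroupStructure k (Over.mk (E.projectiveBundleπ ≫ f)) := by
  intro hadm
  obtain ⟨i₀, i₁, hi⟩ : ∃ i₀ i₁ : Fin r, i₀ ≠ i₁ :=
    ⟨⟨0, by omega⟩, ⟨1, by omega⟩, by simp⟩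
  have : Nonempty (Fin r) := ⟨i₀⟩
  obtain ⟨N, s, hN, hs⟩ := hE.exists_isFrame (genericPoint X)
  obtain ⟨U', hU', hU, hUN⟩ := exists_isAffineOpen_mem_and_subset hN
  obtain ⟨U, rfl⟩ : ∃ U : X.AffineZariskiSite, U.toOpens = U' := ⟨⟨U', hU'⟩, rfl⟩
  obtain ⟨b, hb⟩ : ∃ b : Module.Basis (Fin r) Γ(X, U.toOpens) Γ(E, U.toOpens), E.IsFrame b :=
    ⟨hs.basis hUN, hs.basis_isFrame hUN⟩
  obtain ⟨K, _, _, _, _, t, ht₀, ht, hne, hA⟩ := exists_generic_coordinates hU b hb i₀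
  let S := Away (gradedPiece Γ(X, U.toOpens) Γ(E, U.toOpens)) (ι _ _ (b i₀))
  have := X.isDomain_sections hU
  have : IsDomain S := isDomain_away b i₀
  let P : Over (Spec (.of k)) := Over.mk (E.projectiveBundleπ ≫ f)
  let j : Spec (.of S) ⟶ P.left := projChart (E := E) (ι_mem_gradedPiece (b i₀)) one_pos
  have hj : IsOpenImmersion j :=
    inferInstanceAs (IsOpenImmersion (projChart (E := E) (ι_mem_gradedPiece (b i₀)) one_pos))
  let β₀ : k →+* S := (Spec.preimage (j ≫ P.hom)).hom
  have hβ₀ : Spec.map (CommRingCat.ofHom β₀) = j ≫ P.hom := Spec.map_preimage _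
  let : Algebra k K := ((algebraMap S K).comp β₀).toAlgebra
  have h₀ : (algebraMap S K).comp β₀ = algebraMap k K := rfl
  let j₀ : specOver β₀ ⟶ P := Over.homMk j hβ₀.symm
  have : IsOpenImmersion j₀.left := hj
  have hζ : hb.IsGenericPt hU f t (genericPt h₀ j₀).left := by
    intro V hV m hm d hmd hd
    rw [hb.genericPt_eq hU _ t hV hU hm hmd hd hne (ι_mem_gradedPiece (b i₀)) one_pos,
      IsFrame.genericPt, hA]
    rfl
  -- The scalars of `k` are regular on all charts, hence come from `U`; so the function field of `X`
  -- is an intermediate field of `K / k`.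
  have hk : ∀ c : k, algebraMap k K c ∈ Set.range (algebraMap X.functionField K) := by
    intro c
    refine hb.mem_range_of_mem_range_awayEval hU ht hi fun i => ?_
    obtain ⟨β, -, hκ, -⟩ := (hb.isFieldChart hU ht hζ hU hb i).exists_over
    exact ⟨β c, congr($hκ c)⟩
  let L : IntermediateField k K :=
    { (algebraMap X.functionField K).fieldRange with algebraMap_mem' := hk }
  have hL : ∀ x, x ∈ L ↔ x ∈ Set.range (algebraMap X.functionField K) := fun _ => Iff.rfl
  obtain ⟨D, hD0, hD, hDL⟩ := hadm.exists_derivation h₀ j₀ (by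
    intro x
    obtain ⟨N', s', hx, hs'⟩ := hE.exists_isFrame (E.projectiveBundleπ x)
    obtain ⟨V', hV', hxV, hVN⟩ := exists_isAffineOpen_mem_and_subset hx
    obtain ⟨V, rfl⟩ : ∃ V : X.AffineZariskiSite, V.toOpens = V' := ⟨⟨V', hV'⟩, rfl⟩
    have hV : genericPoint X ∈ V.toOpens := X.genericPoint_mem ⟨_, hxV⟩
    obtain ⟨b', hb'⟩ : ∃ b' : Module.Basis (Fin r) Γ(X, V.toOpens) Γ(E, V.toOpens),
      E.IsFrame b' := ⟨hs'.basis hVN, hs'.basis_isFrame hVN⟩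
    obtain ⟨i, hxi⟩ := exists_mem_range_projChart b' hxV
    exact ⟨_, _, _, _, hb.isFieldChart hU ht hζ hV hb' i, hb.awayEval_injective hU ht hV hb' i,
      hxi⟩)
    L (fun D hD x hx => hb.map_mem_range hU ht hζ hi (D := D.restrictScalars ℤ) hD hx)
    (t i₁) (ht.transcendental L (fun x hx => hx) hi ht₀)
  have hF : ∀ x : X.functionField, D (algebraMap _ K x) = 0 := fun x => hDL _ ⟨x, rfl⟩
  -- Verticality gives only the ratios of the coordinates; the normalization `t i₀ = 1` turns this
  -- into the vanishing of each `D (t i)`.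
  have hDt : ∀ i, D (t i) = 0 := by
    intro i
    have h := hb.vertical_derivation_eq_zero hU ht hζ U.2 hE hsimple (D := D.restrictScalars ℤ)
      hD hF i₀ i
    change t i₀ * D (t i) = t i * D (t i₀) at h
    rwa [ht₀, D.map_one_eq_zero, mul_zero, one_mul] at h
  refine hD0 (D.eq_zero_of_isFractionRing (S := S) fun z => ?_)
  have hz : algebraMap S K z ∈ Set.range (Proj.awayEval
      (gradedPiece Γ(X, U.toOpens) Γ(E, U.toOpens))
      (hb.eval hU (algebraMap X.functionField K) t _ hU) _
        (hb.eval_basis_ne_zero hU ht hU hb i₀)) := ⟨z, congr($hA z)⟩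
  rw [hb.range_awayEval hU ht hU hb] at hz
  let := sectionAlgebra K U.toOpens hU
  -- Since `t i₀ = 1`, every element of the chart ring is a polynomial in the `t j` over functions
  -- on `U`, all of which `D` kills.
  obtain ⟨n, G, -, hG⟩ := hz
  simp only [hb.form_self, ht₀, one_pow, mul_one] at hG
  rw [hG]
  exact D.map_aeval_eq_zero (F := Γ(X, U.toOpens)) (fun x => hF _) hDt G

end AlgebraicGeometry.Scheme.Modules

end
theorem mainTheorem7 (k : Type u) [Field k] [CharZero k] (X : Scheme.{u}) [IsIntegral X]
    (f : X ⟶ Spec (.of k)) [LocallyOfFiniteType f] [QuasiCompact f]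
    (hnormal : ∀ x : X, IsIntegrallyClosed (X.presheaf.stalk x))
    (E : X.Modules) [E.IsLocallyFree] (r : ℕ) (hr : 2 ≤ r) (hrank : E.IsLocallyFreeOfRank r)
    (hsimple : E.IsSimple) :
    ¬ AdmitsVectorGroupStructure k (Over.mk (E.projectiveBundleπ ≫ f)) := by
  exact AlgebraicGeometry.Scheme.Modules.not_admitsVectorGroupStructure f hr hrank hsimple
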